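/- **Theorem (Uniqueness).** Let $\overline M$ be a compact connected Riemann surface with a smooth Kähler metric $\bar g$ (volume measure $dV$), let $p_1,\dots,p_m\in\overline M$ be finitely many points, $M=\overline M\setminus\{p_1,\dots,p_m\}$, and let $g$ be a smooth Kähler metric on $M$ of finite volume (volume measure $d\nu$). Let $(E,\nabla)$ be a smooth complex vector bundle of rank $n$ with a smooth flat connection on $M$. Fix at each $p_j$ a holomorphic coordinate $z=re^{i\theta}$ centred at $p_j$, and on a punctured coordinate disc a smooth frame in which $\nabla=d+B\,d\theta$ with $B$ constant in Jordan normal form, with blocks $B_\ell=\kappa_\ell I+N_\ell$, $\mathrm{Im}\,\kappa_\ell\in[0,1)$ ($N_\ell$ has ones on the superdiagonal); the blocks define local indecomposable flat subbundles, $E=\bigoplus_\ell V_\ell$, $d_\ell=\dim V_\ell$. A parabolic structure $\Pi$ is a choice of real weights $w_\ell$ of the $V_\ell$ at every puncture. Put $\deg(E,\Pi)=\sum_j\sum_\ell w_\ell d_\ell$. A flat subbundle $S\subset E$ carries the parabolic structure induced by the flags $F_\beta=\bigoplus_{w_\ell\le\beta}V_\ell$, so that $\deg S=\sum_j\sum_\beta\beta\,(\mathrm{rk}(S\cap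 F_\beta)-\mathrm{rk}(S\cap F_{<\beta}))$. $(E,\nabla,\Pi)$ is *slope stable* if $\deg S/\mathrm{rk}\,S<\deg(E,\Pi)/n$ for every flat subbundle $S$ with $0<\mathrm{rk}\,S<n$. For a smooth hermitian metric $H$ on $E$ let $\Psi(H)$ be the $\mathrm{End}(E)$-valued one-form with $\langle\Psi(H)(v)\sigma,\tau\rangle=\tfrac12\big(v\langle\sigma,\tau\rangle-\langle\nabla_v\sigma,\tau\rangle-\langle\sigma,\nabla_v\tau\rangle\big)$, and $K(H)=-\tfrac12\star\nabla\star\Psi(H)$, with $\star$ the Hodge star of $g$. $H$ is a *Poisson metric* if $K(H)=c\,\mathrm{Id}$ for some constant $c\in\mathbb R$. $H$ is *strongly tamed by $\Pi$* if at every puncture: * (A) $|K(H)|_H$ is integrable near the puncture with respect to $d\nu$; * (B) for each choice of $0\le m_\ell\le d_\ell$, the subbundle $S=\bigoplus_\ell S_\ell$ with $S_\ell$ spanned by the first $m_\ell$ frame vectors of $V_\ell$, with its induced metric $H_S$, satisfies for some $\epsilon>0$: $\mathrm{Tr}\,\Psi(H_S)(\partial_r)=-\sum_\ell\frac{w_\ell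 m_\ell}{r}+o\big(\frac1{r|\log r|^\epsilon}\big)$; * (C) for every flat section $\sigma$ of $V_\ell$ over a ray $\theta=\theta_0$ lying in $\ker N_\ell^{i}$ but not in $\ker N_\ell^{i-1}$, with $\tau=2i-(d_\ell+1)$, there is $C>0$ with $C^{-1}r^{-w_\ell}|\log r|^{\tau/2}\le|\sigma|_H\le C\,r^{-w_\ell}|\log r|^{\tau/2}$ for all small $r$; * (D) for some $\epsilon>0$, $\Psi(H)=-\bigoplus_\ell\big(w_\ell\frac{dr}{r}+\mathrm{Re}(\kappa_\ell)\,d\theta\big)\mathrm{Id}_{V_\ell}+o\big(\frac{dr}{r|\log r|^\epsilon}+\frac{d\theta}{|\log r|^\epsilon}\big)$, the error being measured in the norm of $\mathrm{End}(E)$ given by $H$. Suppose that $(E,\nabla,\Pi)$ is slope stable, and that $H_1,H_2$ are Poisson metrics on $E$ for which there are functions $u\in C^\infty(M,\mathbb R)\cap L^2(\overline M,dV)$ and $f\in C^\infty(M,\mathbb R)\cap L^1(\overline M,dV)$ such that $\Delta_{\bar g}u=f$ in the sense of distributions on $\overline M$ and both $e^{-u}H_1$ and $e^{-u}H_2$ are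 strongly tamed by $\Pi$. Then $H_1=\lambda H_2$ for some constant $\lambda>0$. -/

import Mathlib

open scoped Manifold ContDiff Topology Bundle
open MeasureTheory

noncomputable section

/-! ## Riemann surfaces: metrics, volume, Laplacian -/

/-- A Riemann surface is in particular a smooth real surface. -/
instance instIsManifoldRealOfComplex {Y : Type*} [TopologicalSpace Y] [ChartedSpace ℂ Y]
    [IsManifold 𝓘(ℂ) ω Y] : IsManifold 𝓘(ℝ, ℂ) ∞ Y := by
  refine isManifold_of_contDiffOn _ _ _ ?_
  intro e e' he he'
  have h := HasGroupoid.compatible (G := contDiffGroupoid ω 𝓘(ℂ)) he he'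
  rw [contDiffGroupoid, mem_groupoid_of_pregroupoid, contDiffPregroupoid] at h
  have h2 := (ContDiffOn.restrict_scalars ℝ h.1).of_le (m := ∞) le_top
  simpa using h2

section Surface

variable {Y : Type*} [TopologicalSpace Y] [ChartedSpace ℂ Y] [IsManifold 𝓘(ℂ) ω Y]

/-- A smooth Riemannian metric on a Riemann surface. -/
abbrev SurfaceMetric (Y : Type*) [TopologicalSpace Y] [ChartedSpace ℂ Y] [IsManifold 𝓘(ℂ) ω Y] :=
  Bundle.ContMDiffRiemannianMetric 𝓘(ℝ, ℂ) ∞ ℂ (fun y : Y => TangentSpace 𝓘(ℝ, ℂ) y)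

/-- The vector field on the source of a holomorphic chart `e` whose expression in the coordinate
`e` is the constant `a : ℂ`: if `e = x + i y` then `a = 1` gives `∂/∂x` and `a = I` gives
`∂/∂y`. -/
def coordVec (e : OpenPartialHomeomorph Y ℂ) (a : ℂ) (y : Y) : TangentSpace 𝓘(ℝ, ℂ) y :=
  (mvfderiv 𝓘(ℝ, ℂ) e y).inverse a

/-- The squared length of `∂/∂x` in the chart `e`: a hermitian metric is `ρ (dx² + dy²)` in the
chart, where `ρ` is this function. -/
def confFactor (g : SurfaceMetric Y) (e : OpenPartialHomeomorph Y ℂ) (y : Y) : ℝ :=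
  g.inner y (coordVec e 1 y) (coordVec e 1 y)

/-- The metric is hermitian, that is, invariant under the complex structure. On a Riemann surface
this is the same as being Kähler. -/
def IsKahlerMetric (g : SurfaceMetric Y) : Prop :=
  ∀ e ∈ IsManifold.maximalAtlas 𝓘(ℂ) ω Y, ∀ y ∈ e.source, ∀ a b : ℂ,
    g.inner y (coordVec e (Complex.I * a) y) (coordVec e (Complex.I * b) y)
      = g.inner y (coordVec e a y) (coordVec e b y)

/-- The Riemannian volume measure of a hermitian metric: the measure which in every chart is
`ρ dx dy`, obtained as the least measure that dominates all these local ones. -/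
def surfaceVolume [MeasurableSpace Y] (g : SurfaceMetric Y) : Measure Y :=
  ⨆ e ∈ atlas ℂ Y, Measure.map e.symm
    ((volume.restrict e.target).withDensity fun z => ENNReal.ofReal (confFactor g e (e.symm z)))

/-- The Laplace-Beltrami operator of a hermitian metric, `ρ⁻¹ (∂²/∂x² + ∂²/∂y²)`. -/
def laplaceBeltrami (g : SurfaceMetric Y) (f : Y → ℝ) (y : Y) : ℝ :=
  (confFactor g (chartAt ℂ y) y)⁻¹ *
    Laplacian.laplacian (fun z => f ((chartAt ℂ y).symm z)) (chartAt ℂ y y)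

end Surface

/-! ## Flat bundles, hermitian metrics, and the curvature `K` -/

section FlatBundle

variable {Y : Type*} [TopologicalSpace Y] [ChartedSpace ℂ Y] [IsManifold 𝓘(ℂ) ω Y]
  {F : Type*} [NormedAddCommGroup F] [NormedSpace ℂ F]
  {E : Y → Type*} [TopologicalSpace (Bundle.TotalSpace F E)]
  [∀ y, AddCommGroup (E y)] [∀ y, Module ℂ (E y)] [∀ y, TopologicalSpace (E y)]
  [∀ y, IsTopologicalAddGroup (E y)] [∀ y, ContinuousSMul ℝ (E y)]
  [FiberBundle F E] [VectorBundle ℝ F E]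

variable (F) in
/-- The section `σ` is (real) smooth on `U`. -/
def SmoothSectionOn (σ : ∀ y, E y) (U : Set Y) : Prop :=
  ContMDiffOn 𝓘(ℝ, ℂ) (𝓘(ℝ, ℂ).prod 𝓘(ℝ, F)) ∞ (fun y => Bundle.TotalSpace.mk' F y (σ y)) U

/-- `nabla` is a smooth flat connection on the complex vector bundle `E`: it is smooth,
complex linear, and its curvature vanishes. -/
structure IsFlatConnection (nabla : CovariantDerivative 𝓘(ℝ, ℂ) F E) : Prop where
  smooth : CovariantDerivative.ContMDiffCovariantDerivative nabla ∞
  complex_linear : ∀ (U : Set Y) (σ : ∀ y, E y), IsOpen U → SmoothSectionOn F σ U →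
    ∀ y ∈ U, ∀ v : TangentSpace 𝓘(ℝ, ℂ) y,
      nabla (fun x => Complex.I • σ x) y v = Complex.I • nabla σ y v
  flat : ∀ (V W : ∀ y : Y, TangentSpace 𝓘(ℝ, ℂ) y) (σ : ∀ y, E y),
    ContMDiff 𝓘(ℝ, ℂ) 𝓘(ℝ, ℂ).tangent ∞
      (fun y => (Bundle.TotalSpace.mk' ℂ y (V y) : TangentBundle 𝓘(ℝ, ℂ) Y)) →
    ContMDiff 𝓘(ℝ, ℂ) 𝓘(ℝ, ℂ).tangent ∞
      (fun y => (Bundle.TotalSpace.mk' ℂ y (W y) : TangentBundle 𝓘(ℝ, ℂ) Y)) →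
    SmoothSectionOn F σ Set.univ → ∀ y,
      nabla (fun x => nabla σ x (W x)) y (V y) - nabla (fun x => nabla σ x (V x)) y (W y)
        - nabla σ y (VectorField.mlieBracket 𝓘(ℝ, ℂ) V W y) = 0

variable (F E) in
/-- A smooth hermitian metric on the complex vector bundle `E`, complex linear in the first
variable and conjugate linear in the second. -/
structure HermitianMetric where
  inner : ∀ y, E y →ₗ[ℂ] E y →ₗ⋆[ℂ] ℂ
  conj_symm : ∀ y (s t : E y), inner y s t = (starRingEnd ℂ) (inner y t s)
  pos : ∀ y (s : E y), s ≠ 0 → 0 < (inner y s s).re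
  smooth : ∀ (U : Set Y) (σ τ : ∀ y, E y), IsOpen U →
    SmoothSectionOn F σ U → SmoothSectionOn F τ U →
    ContMDiffOn 𝓘(ℝ, ℂ) 𝓘(ℝ, ℂ) ∞ (fun y => inner y (σ y) (τ y)) U

namespace HermitianMetric

/-- The pointwise length `|s|_H`. -/
def length (H : HermitianMetric F E) (y : Y) (s : E y) : ℝ := √(H.inner y s s).re

/-- The operator norm `|A|_H` of an endomorphism of a fibre. -/
def endNorm (H : HermitianMetric F E) (y : Y) (A : E y →ₗ[ℂ] E y) : ℝ :=
  sInf {c : ℝ | 0 ≤ c ∧ ∀ s, H.length y (A s) ≤ c * H.length y s}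

/-- The metric `e^{-u} H`. -/
def rescale (H : HermitianMetric F E) (u : Y → ℝ)
    (hu : ContMDiff 𝓘(ℝ, ℂ) 𝓘(ℝ, ℝ) ∞ u) : HermitianMetric F E where
  inner y := ((Real.exp (-u y) : ℝ) : ℂ) • H.inner y
  conj_symm y s t := by
    simp only [LinearMap.smul_apply, smul_eq_mul, map_mul, Complex.conj_ofReal]
    rw [H.conj_symm y s t]
  pos y s hs := by
    simp only [LinearMap.smul_apply, smul_eq_mul, Complex.re_ofReal_mul]
    exact mul_pos (Real.exp_pos _) (H.pos y s hs)
  smooth U σ τ hU hσ hτ := by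
    have h1 : ContMDiff 𝓘(ℝ, ℂ) 𝓘(ℝ, ℝ) ∞ (fun y => Real.exp (-u y)) :=
      (Real.contDiff_exp.comp contDiff_neg).contMDiff.comp hu
    refine (h1.contMDiffOn.smul (H.smooth U σ τ hU hσ hτ)).congr ?_
    intro y _
    simp only [LinearMap.smul_apply, Pi.smul_apply', Complex.real_smul, smul_eq_mul]

end HermitianMetric

/-- `½ ( v⟨σ, τ⟩ - ⟨∇_v σ, τ⟩ - ⟨σ, ∇_v τ⟩ )` at the point `y`. -/
def metricVariation (nabla : CovariantDerivative 𝓘(ℝ, ℂ) F E) (H : HermitianMetric F E)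
    (σ τ : ∀ y, E y) (y : Y) (v : TangentSpace 𝓘(ℝ, ℂ) y) : ℂ :=
  (1 / 2 : ℂ) * (mvfderiv 𝓘(ℝ, ℂ) (fun x => H.inner x (σ x) (τ x)) y v
    - H.inner y (nabla σ y v) (τ y) - H.inner y (σ y) (nabla τ y v))

/-- `Ψ` is the `End(E)`-valued one-form `Ψ(H) = ½ (∇̂ - ∇)`, where `∇̂` is the connection with
`d⟨σ, τ⟩ = ⟨∇̂ σ, τ⟩ + ⟨σ, ∇ τ⟩`. (It exists and is unique.) -/
def IsPsi (nabla : CovariantDerivative 𝓘(ℝ, ℂ) F E) (H : HermitianMetric F E)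
    (Ψ : ∀ y, TangentSpace 𝓘(ℝ, ℂ) y → E y →ₗ[ℂ] E y) : Prop :=
  ∀ (U : Set Y) (σ τ : ∀ y, E y), IsOpen U → SmoothSectionOn F σ U → SmoothSectionOn F τ U →
    ∀ y ∈ U, ∀ v, H.inner y (Ψ y v (σ y)) (τ y) = metricVariation nabla H σ τ y v

/-- `Ψ` is the `End(S)`-valued one-form `Ψ(H_S)` over the set `D`, where `H_S` is the metric
induced by `H` on the `∇`-invariant subbundle `S`. -/
def IsInducedPsi (nabla : CovariantDerivative 𝓘(ℝ, ℂ) F E) (H : HermitianMetric F E) (D : Set Y)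
    (S : ∀ y, Submodule ℂ (E y))
    (Ψ : ∀ y, TangentSpace 𝓘(ℝ, ℂ) y → S y →ₗ[ℂ] S y) : Prop :=
  ∀ (U : Set Y) (σ τ : ∀ y, S y), IsOpen U → U ⊆ D →
    SmoothSectionOn F (fun y => (σ y : E y)) U → SmoothSectionOn F (fun y => (τ y : E y)) U →
    ∀ y ∈ U, ∀ v, H.inner y (Ψ y v (σ y) : E y) (τ y)
      = metricVariation nabla H (fun x => (σ x : E x)) (fun x => (τ x : E x)) y v

/-- `K = -½ ⋆ ∇ ⋆ Ψ`. In a holomorphic coordinate `x + i y` in which the metric is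
`ρ (dx² + dy²)` one has `⋆dx = dy`, `⋆dy = -dx`, `⋆(dx ∧ dy) = ρ⁻¹`, hence
`K = -½ ρ⁻¹ (∇_x Ψ_x + ∇_y Ψ_y)`, with `∇` the induced connection on `End(E)`. -/
def IsCurvatureK (g : SurfaceMetric Y) (nabla : CovariantDerivative 𝓘(ℝ, ℂ) F E)
    (Ψ : ∀ y, TangentSpace 𝓘(ℝ, ℂ) y → E y →ₗ[ℂ] E y) (K : ∀ y, E y →ₗ[ℂ] E y) : Prop :=
  ∀ e ∈ IsManifold.maximalAtlas 𝓘(ℂ) ω Y, ∀ (U : Set Y) (σ : ∀ y, E y), IsOpen U →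
    U ⊆ e.source → SmoothSectionOn F σ U → ∀ y ∈ U,
    K y (σ y) = ((-1 / 2 * (confFactor g e y)⁻¹ : ℝ) : ℂ) • ∑ a ∈ ({1, Complex.I} : Finset ℂ),
      (nabla (fun x => Ψ x (coordVec e a x) (σ x)) y (coordVec e a y)
        - Ψ y (coordVec e a y) (nabla σ y (coordVec e a y)))

/-- `H` is a Poisson metric: `K(H) = c I` for some constant `c`. -/
def IsPoissonMetric (g : SurfaceMetric Y) (nabla : CovariantDerivative 𝓘(ℝ, ℂ) F E)
    (H : HermitianMetric F E) : Prop :=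
  ∃ (c : ℝ) (Ψ : ∀ y, TangentSpace 𝓘(ℝ, ℂ) y → E y →ₗ[ℂ] E y),
    IsPsi nabla H Ψ ∧ IsCurvatureK g nabla Ψ (fun _ => (c : ℂ) • LinearMap.id)

/-- `S` is a flat subbundle of rank `k`: a smooth subbundle preserved by the connection. -/
structure IsFlatSubbundle (nabla : CovariantDerivative 𝓘(ℝ, ℂ) F E) (k : ℕ)
    (S : ∀ y, Submodule ℂ (E y)) : Prop where
  subbundle : ∀ y₀ : Y, ∃ (U : Set Y) (s : Fin k → ∀ y, E y), IsOpen U ∧ y₀ ∈ U ∧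
    (∀ i, SmoothSectionOn F (s i) U) ∧
    ∀ y ∈ U, LinearIndependent ℂ (fun i => s i y) ∧
      Submodule.span ℂ (Set.range fun i => s i y) = S y
  invariant : ∀ (U : Set Y) (σ : ∀ y, E y), IsOpen U → SmoothSectionOn F σ U →
    (∀ y ∈ U, σ y ∈ S y) → ∀ y ∈ U, ∀ v, nabla σ y v ∈ S y

end FlatBundle

/-! ## Punctures, parabolic structures, degree and stability -/

section Parabolic

variable {X : Type*} [TopologicalSpace X] [T2Space X] [ChartedSpace ℂ X] [IsManifold 𝓘(ℂ) ω X]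

/-- The punctured surface `X \ P`. -/
def punctured (P : Finset X) : TopologicalSpace.Opens X :=
  ⟨(P : Set X)ᶜ, P.finite_toSet.isClosed.isOpen_compl⟩

/-- A holomorphic coordinate centred at `p`, together with a radius `R` such that the coordinate
disc of radius `R` contains no other puncture. -/
structure PunctureCoord (P : Finset X) (p : X) where
  chart : OpenPartialHomeomorph X ℂ
  mem_maximalAtlas : chart ∈ IsManifold.maximalAtlas 𝓘(ℂ) ω X
  mem_source : p ∈ chart.source
  map_center : chart p = 0
  radius : ℝ
  radius_pos : 0 < radius
  ball_subset : Metric.ball (0 : ℂ) radius ⊆ chart.target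
  isolated : ∀ q ∈ P, q ∈ chart.source → ‖chart q‖ < radius → q = p

/-- The filter of neighbourhoods of the puncture `p` in the punctured surface. -/
def nearPuncture (P : Finset X) (p : X) : Filter (punctured P) :=
  Filter.comap (fun x => (x : X)) (𝓝 p)

variable {P : Finset X} {p : X}

namespace PunctureCoord

/-- The coordinate `z = r e^{iθ}` as a function on the punctured surface. -/
def coord (z : PunctureCoord P p) (x : punctured P) : ℂ := z.chart (x : X)

/-- The punctured coordinate disc. -/
def disc (z : PunctureCoord P p) : Set (punctured P) :=
  {x | (x : X) ∈ z.chart.source ∧ ‖z.coord x‖ < z.radius}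

/-- The value of `dz / z = dr / r + i dθ` on a tangent vector. -/
def dlog (z : PunctureCoord P p) (x : punctured P) (v : TangentSpace 𝓘(ℝ, ℂ) x) : ℂ :=
  mvfderiv 𝓘(ℝ, ℂ) z.coord x v / z.coord x

/-- The point of the punctured disc with coordinate `R / 2`. -/
def basePoint (z : PunctureCoord P p) : punctured P :=
  ⟨z.chart.symm ((z.radius / 2 : ℝ) : ℂ), by
    have hR := z.radius_pos
    have hn : ‖((z.radius / 2 : ℝ) : ℂ)‖ = z.radius / 2 := by
      rw [Complex.norm_real, Real.norm_of_nonneg (by linarith)]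
    have ht : ((z.radius / 2 : ℝ) : ℂ) ∈ z.chart.target :=
      z.ball_subset (by rw [mem_ball_zero_iff, hn]; linarith)
    have hr := z.chart.right_inv ht
    intro hP
    have hp := z.isolated _ hP (z.chart.map_target ht) (by rw [hr, hn]; linarith)
    rw [hp, z.map_center] at hr
    rw [← hr, norm_zero] at hn
    linarith⟩

end PunctureCoord

variable {F : Type*} [NormedAddCommGroup F] [NormedSpace ℂ F]
  {E : punctured P → Type*} [TopologicalSpace (Bundle.TotalSpace F E)]
  [∀ y, AddCommGroup (E y)] [∀ y, Module ℂ (E y)] [∀ y, TopologicalSpace (E y)]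
  [∀ y, IsTopologicalAddGroup (E y)] [∀ y, ContinuousSMul ℝ (E y)]
  [FiberBundle F E] [VectorBundle ℝ F E]

/-- A temporal framing near the puncture `p`: a smooth frame of `E` over the punctured coordinate
disc in which `∇ = d + B dθ`, where `B` is constant and in Jordan normal form, with blocks
`B_ℓ = κ_ℓ + N_ℓ` of size `d_ℓ` (`N_ℓ` has ones on the superdiagonal) and `Im κ_ℓ ∈ [0, 1)`.
The frame vectors of the `ℓ`-th block span the local indecomposable subbundle `V_ℓ`. -/
structure TemporalFraming (nabla : CovariantDerivative 𝓘(ℝ, ℂ) F E)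
    (z : PunctureCoord P p) where
  blocks : ℕ
  size : Fin blocks → ℕ
  size_pos : ∀ l, 0 < size l
  kappa : Fin blocks → ℂ
  kappa_nonneg : ∀ l, 0 ≤ (kappa l).im
  kappa_lt_one : ∀ l, (kappa l).im < 1
  frame : ∀ l, Fin (size l) → ∀ x, E x
  smooth : ∀ l i, SmoothSectionOn F (frame l i) z.disc
  linearIndependent : ∀ x ∈ z.disc,
    LinearIndependent ℂ (fun j : Σ l, Fin (size l) => frame j.1 j.2 x)
  span_eq_top : ∀ x ∈ z.disc,
    Submodule.span ℂ (Set.range fun j : Σ l, Fin (size l) => frame j.1 j.2 x) = ⊤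
  nabla_frame : ∀ l i, ∀ x ∈ z.disc, ∀ v,
    nabla (frame l i) x v = ((z.dlog x v).im : ℂ) • (kappa l • frame l i x +
      if 0 < (i : ℕ) then frame l ⟨i - 1, lt_of_le_of_lt (Nat.sub_le _ _) i.2⟩ x else 0)

/-- A parabolic structure: at every puncture a weight for each local indecomposable subbundle, the
decomposition into these being the one of the temporal framing. -/
structure ParabolicStructure (nabla : CovariantDerivative 𝓘(ℝ, ℂ) F E)
    (z : ∀ p : P, PunctureCoord P (p : X)) where
  framing : ∀ p, TemporalFraming nabla (z p)
  weight : ∀ p, Fin (framing p).blocks → ℝ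

namespace ParabolicStructure

variable {nabla : CovariantDerivative 𝓘(ℝ, ℂ) F E} {z : ∀ p : P, PunctureCoord P (p : X)}

/-- `deg(E, Π) = ∑_p ∑_ℓ w_ℓ dim V_ℓ`. -/
def degree (Pi : ParabolicStructure nabla z) : ℝ :=
  ∑ p, ∑ l, Pi.weight p l * ((Pi.framing p).size l : ℝ)

/-- The sum of the fibres at `x` of those local indecomposable subbundles `V_ℓ` at `p` whose index
satisfies `A`. -/
def partialSum (Pi : ParabolicStructure nabla z) (p : P) (A : Fin (Pi.framing p).blocks → Prop)
    (x : punctured P) : Submodule ℂ (E x) :=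
  Submodule.span ℂ {s | ∃ l, A l ∧ ∃ i, s = (Pi.framing p).frame l i x}

/-- The degree of a flat subbundle `S` with the parabolic structure induced on it by the flag
`F_β = ⊕_{w_ℓ ≤ β} V_ℓ` at every puncture: the weight `β` counts with multiplicity
`dim (S ∩ F_β) - dim (S ∩ F_{<β})`, a number which does not depend on the point of the punctured
disc at which it is computed. If `S` is a sum of subbundles `S_ℓ` of the `V_ℓ` near the punctures,
this is `∑_p ∑_ℓ w_ℓ rk S_ℓ`. -/
def subDegree (Pi : ParabolicStructure nabla z) (S : ∀ x, Submodule ℂ (E x)) : ℝ :=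
  ∑ p, ∑ β ∈ Finset.univ.image (Pi.weight p), β *
    ((Module.finrank ℂ ↥(S (z p).basePoint ⊓
        Pi.partialSum p (fun l => Pi.weight p l ≤ β) (z p).basePoint) : ℝ)
      - (Module.finrank ℂ ↥(S (z p).basePoint ⊓
        Pi.partialSum p (fun l => Pi.weight p l < β) (z p).basePoint) : ℝ))

/-- Slope stability: every flat subbundle `S` with `0 ≠ S ≠ E` has slope less than that of `E`. -/
def IsSlopeStable (Pi : ParabolicStructure nabla z) : Prop :=
  ∀ (k : ℕ) (S : ∀ x, Submodule ℂ (E x)), IsFlatSubbundle nabla k S →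
    0 < k → k < Module.finrank ℂ F →
    Pi.subDegree S / (k : ℝ) < Pi.degree / (Module.finrank ℂ F : ℝ)

/-- The `∇`-invariant subbundle `S = S_1 ⊕ ⋯ ⊕ S_k` near `p`, where `S_ℓ` is the local invariant
subbundle of rank `m_ℓ` of `V_ℓ`, spanned by the first `m_ℓ` frame vectors. -/
def localInvariant (Pi : ParabolicStructure nabla z) (p : P)
    (m : ∀ l, Fin ((Pi.framing p).size l + 1)) (x : punctured P) : Submodule ℂ (E x) :=
  Submodule.span ℂ {s | ∃ l, ∃ i : Fin ((Pi.framing p).size l),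
    (i : ℕ) < (m l : ℕ) ∧ s = (Pi.framing p).frame l i x}

/-- Condition (A): `|K(H)|` is integrable near every puncture. -/
def CondA [MeasurableSpace X] (_Pi : ParabolicStructure nabla z) (g : SurfaceMetric (punctured P))
    (H : HermitianMetric F E) : Prop :=
  ∃ (Ψ : ∀ x, TangentSpace 𝓘(ℝ, ℂ) x → E x →ₗ[ℂ] E x) (K : ∀ x, E x →ₗ[ℂ] E x),
    IsPsi nabla H Ψ ∧ IsCurvatureK g nabla Ψ K ∧
    ∀ p : P, IntegrableAtFilter (fun x => H.endNorm x (K x)) (nearPuncture P (p : X))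
      (surfaceVolume g)

/-- Condition (B): for every local invariant `S`, `Tr Ψ(H_S)(∂_r)` equals
`- ∑_ℓ (w_ℓ / r) rk S_ℓ + o(1 / (r |log r|^ε))`. The vector `∂_r` is the one with
`dz / z = 1 / r`. -/
def CondB (Pi : ParabolicStructure nabla z) (H : HermitianMetric F E) : Prop :=
  ∀ (p : P) (m : ∀ l, Fin ((Pi.framing p).size l + 1)),
    ∃ Ψ : ∀ x, TangentSpace 𝓘(ℝ, ℂ) x →
        Pi.localInvariant p m x →ₗ[ℂ] Pi.localInvariant p m x,
      IsInducedPsi nabla H (z p).disc (Pi.localInvariant p m) Ψ ∧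
      ∃ ε : ℝ, 0 < ε ∧ ∀ δ : ℝ, 0 < δ → ∀ᶠ x in nearPuncture P (p : X), ∀ v,
        (z p).dlog x v = ((1 / ‖(z p).coord x‖ : ℝ) : ℂ) →
        ‖LinearMap.trace ℂ _ (Ψ x v)
            + ((∑ l, Pi.weight p l / ‖(z p).coord x‖ * ((m l : ℕ) : ℝ) : ℝ) : ℂ)‖
          ≤ δ * (1 / (‖(z p).coord x‖ * |Real.log ‖(z p).coord x‖| ^ ε))

/-- Condition (C): a flat section `σ` of `V_ℓ` over a ray `θ = θ₀`, of nilpotent weight `τ`,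
has length comparable to `r^{-w_ℓ} |log r|^{τ/2}` as `r → 0`. In the temporal framing the
connection is trivial in the radial direction, so the flat sections are the combinations
`∑ a_i e_i` with constant coefficients; `σ` is in `ker N^(j+1)` and not in `ker N^j` if and only if
`a_j` is its last nonzero coefficient (counting from `0`), and then `τ = 2 (j + 1) - (d_ℓ + 1)`. -/
def CondC (Pi : ParabolicStructure nabla z) (H : HermitianMetric F E) : Prop :=
  ∀ (p : P) (l : Fin (Pi.framing p).blocks) (θ₀ : ℝ) (a : Fin ((Pi.framing p).size l) → ℂ)
    (j : Fin ((Pi.framing p).size l)), a j ≠ 0 → (∀ i, j < i → a i = 0) →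
    ∃ C : ℝ, 0 < C ∧ ∀ᶠ x in nearPuncture P (p : X),
      (z p).coord x = (‖(z p).coord x‖ : ℂ) * Complex.exp (θ₀ * Complex.I) →
      C⁻¹ * (‖(z p).coord x‖ ^ (-Pi.weight p l) * |Real.log ‖(z p).coord x‖| ^
          ((2 * ((j : ℝ) + 1) - ((Pi.framing p).size l + 1)) / 2))
        ≤ H.length x (∑ i, a i • (Pi.framing p).frame l i x) ∧
      H.length x (∑ i, a i • (Pi.framing p).frame l i x) ≤
        C * (‖(z p).coord x‖ ^ (-Pi.weight p l) * |Real.log ‖(z p).coord x‖| ^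
          ((2 * ((j : ℝ) + 1) - ((Pi.framing p).size l + 1)) / 2))

/-- Condition (D): `Ψ(H) = - ⊕_ℓ (w_ℓ dr / r + Re κ_ℓ dθ) I + o(dr / (r |log r|^ε) + dθ / |log r|^ε)`
near every puncture, the size of the error endomorphism being measured by `H`. -/
def CondD (Pi : ParabolicStructure nabla z) (H : HermitianMetric F E) : Prop :=
  ∃ Ψ : ∀ x, TangentSpace 𝓘(ℝ, ℂ) x → E x →ₗ[ℂ] E x, IsPsi nabla H Ψ ∧
    ∀ p : P, ∃ ε : ℝ, 0 < ε ∧ ∀ δ : ℝ, 0 < δ → ∀ᶠ x in nearPuncture P (p : X), ∀ v,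
      ∀ a : (l : Fin (Pi.framing p).blocks) → Fin ((Pi.framing p).size l) → ℂ,
      H.length x (Ψ x v (∑ l, ∑ i, a l i • (Pi.framing p).frame l i x)
          + ∑ l, ((Pi.weight p l * ((z p).dlog x v).re
              + ((Pi.framing p).kappa l).re * ((z p).dlog x v).im : ℝ) : ℂ) •
            ∑ i, a l i • (Pi.framing p).frame l i x)
        ≤ δ * ((|((z p).dlog x v).re| + |((z p).dlog x v).im|)
              / |Real.log ‖(z p).coord x‖| ^ ε)
          * H.length x (∑ l, ∑ i, a l i • (Pi.framing p).frame l i x)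

/-- `H` is strongly tamed by the parabolic structure. -/
def StronglyTamed [MeasurableSpace X] (Pi : ParabolicStructure nabla z) (g : SurfaceMetric (punctured P))
    (H : HermitianMetric F E) : Prop :=
  Pi.CondA g H ∧ Pi.CondB H ∧ Pi.CondC H ∧ Pi.CondD H

end ParabolicStructure

/-- `Δ u = f` holds in the sense of distributions on the closed surface `X` with the metric `gbar`,
for functions `u`, `f` defined away from the finite set `P`. -/
def DistribLaplaceEq [MeasurableSpace X] (gbar : SurfaceMetric X) (u f : punctured P → ℝ) : Prop :=
  ∀ χ : X → ℝ, ContMDiff 𝓘(ℝ, ℂ) 𝓘(ℝ, ℝ) ∞ χ →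
    ∫ x : punctured P, u x * laplaceBeltrami gbar χ x
        ∂(Measure.comap (fun x : punctured P => (x : X)) (surfaceVolume gbar))
      = ∫ x : punctured P, f x * χ x
        ∂(Measure.comap (fun x : punctured P => (x : X)) (surfaceVolume gbar))

end Parabolic

end

set_option linter.unusedSectionVars false

noncomputable section

/-! ## Maximum principles in the plane -/

/-! Let h be the endomorphism with H₁(h s, t) = H₂(s, t). Since h is a ratio of metrics, tr h
controls the ratio of lengths, and the aim is to show that tr h is constant, then that h is
parallel, then that h is scalar.

Comparing the definitions of Ψ₁ and Ψ₂ gives ∇h = 2D with D = hΨ₂ - Ψ₁h (`nabla_transition`). In a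
chart where the metric has conformal factor ρ, the two Poisson equations turn the divergence of this
into Δ tr h = 4ρ(c₁ - c₂) tr h + 4(Q_x + Q_y), where Q_a is the squared H₂-length of (Ψ₁ - Ψ₂)(∂_a)
summed over an H₁-orthonormal basis (`planeLap_transitionTrace`, `IsInnerForm.exists_energy`). The
constants need not agree: exchanging the metrics one may take c₂ ≤ c₁. Cauchy-Schwarz gives (∂_a tr
h)² ≤ 4 Q_a tr h, so log tr h is subharmonic (`planeLap_log_transitionTrace_nonneg`). Subharmonicity
is conformally invariant, so the flat Laplacian of a chart suffices.

At a puncture, condition (D) says that sections with coefficients c r^{w_ℓ} in the temporal frame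
have nearly constant length along rays: the squared length changes by at most r^{±2δ} for every δ >
0. This holds for both rescaled metrics, and the common factor e^{-u} drops out of their ratio, so
log tr h = o(log(1/r)) from above (`log_transitionTrace_add_le`). A subharmonic function of such
growth does not see the punctures; it attains its maximum, and the strong maximum principle on the
connected surface makes it constant (`eq_of_planeLap_nonneg_of_growth`).

With tr h constant the Q_a vanish, so Ψ₁ = Ψ₂, h commutes with them, and ∇h = 0
(`isParallelEnd_transition`). If h were not scalar at some point, a real polynomial in h would be a
nontrivial parallel idempotent, splitting E into two flat subbundles S and S'. Their degrees add up
to at least deg E (`ParabolicStructure.degree_le_subDegree_add`), while stability makes both slopes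
strictly smaller than that of E: a contradiction
(`ParabolicStructure.IsSlopeStable.eq_zero_or_eq_one`). -/

/-- The second derivative of `φ` at `z` in the direction `a`. -/
def secondDirDeriv (φ : ℂ → ℝ) (a z : ℂ) : ℝ :=
  fderiv ℝ (fun w => fderiv ℝ φ w a) z a

/-- The flat Laplacian `∂²/∂x² + ∂²/∂y²`. -/
def planeLap (φ : ℂ → ℝ) (z : ℂ) : ℝ :=
  secondDirDeriv φ 1 z + secondDirDeriv φ Complex.I z

lemma ContDiffAt.differentiableAt_fderiv_apply {φ : ℂ → ℝ} {z : ℂ} (h : ContDiffAt ℝ 2 φ z)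
    (a : ℂ) : DifferentiableAt ℝ (fun w => fderiv ℝ φ w a) z := by
  have h1 : ContDiffAt ℝ 1 (fderiv ℝ φ) z := h.fderiv_right (by norm_num)
  exact (h1.differentiableAt (by norm_num)).clm_apply (differentiableAt_const a)

lemma ContDiffAt.eventually_differentiableAt {φ : ℂ → ℝ} {z : ℂ} (h : ContDiffAt ℝ 2 φ z) :
    ∀ᶠ w in 𝓝 z, DifferentiableAt ℝ φ w := by
  filter_upwards [h.eventually (by simp)] with w hw
  exact hw.differentiableAt (by norm_num)

lemma secondDirDeriv_add_mul {φ ψ : ℂ → ℝ} {z : ℂ} (hφ : ContDiffAt ℝ 2 φ z)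
    (hψ : ContDiffAt ℝ 2 ψ z) (c : ℝ) (a : ℂ) :
    secondDirDeriv (fun w => φ w + c * ψ w) a z
      = secondDirDeriv φ a z + c * secondDirDeriv ψ a z := by
  unfold secondDirDeriv
  have : (fun w => fderiv ℝ (fun w => φ w + c * ψ w) w a)
      =ᶠ[𝓝 z] fun w => fderiv ℝ φ w a + c * fderiv ℝ ψ w a := by
    filter_upwards [hφ.eventually_differentiableAt, hψ.eventually_differentiableAt] with w h1 h2
    rw [fderiv_fun_add h1 (h2.const_mul c), fderiv_const_mul h2]
    simp
  rw [this.fderiv_eq, fderiv_fun_add (hφ.differentiableAt_fderiv_apply a)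
    ((hψ.differentiableAt_fderiv_apply a).const_mul c),
    fderiv_const_mul (hψ.differentiableAt_fderiv_apply a)]
  simp

lemma planeLap_add_mul {φ ψ : ℂ → ℝ} {z : ℂ} (hφ : ContDiffAt ℝ 2 φ z)
    (hψ : ContDiffAt ℝ 2 ψ z) (c : ℝ) :
    planeLap (fun w => φ w + c * ψ w) z = planeLap φ z + c * planeLap ψ z := by
  simp only [planeLap, secondDirDeriv_add_mul hφ hψ]
  ring

/-- Were it positive, the second derivative test along the line z + t a would make the maximum a
local minimum too; the function would be constant on the line near z, with second derivative zero.
-/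
lemma secondDirDeriv_nonpos_of_isLocalMax {φ : ℂ → ℝ} {z : ℂ} (hφ : ContDiffAt ℝ 2 φ z)
    (hm : IsLocalMax φ z) (a : ℂ) : secondDirDeriv φ a z ≤ 0 := by
  by_contra hpos
  push Not at hpos
  set ℓ : ℝ → ℂ := fun t => z + t • a with hℓ
  have hℓd : ∀ t, HasDerivAt ℓ a t := fun t => by
    simpa [hℓ] using ((hasDerivAt_id t).smul_const a).const_add z
  have hℓ0 : ℓ 0 = z := by simp [hℓ]
  have hcont : Filter.Tendsto ℓ (𝓝 0) (𝓝 z) := by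
    have := (hℓd 0).continuousAt
    rwa [ContinuousAt, hℓ0] at this
  have hd1 : ∀ᶠ t in 𝓝 (0 : ℝ), deriv (φ ∘ ℓ) t = fderiv ℝ φ (ℓ t) a := by
    filter_upwards [hcont.eventually hφ.eventually_differentiableAt] with t ht
    exact (ht.hasFDerivAt.comp_hasDerivAt t (hℓd t)).deriv
  have hd2 : deriv (deriv (φ ∘ ℓ)) 0 = secondDirDeriv φ a z := by
    rw [Filter.EventuallyEq.deriv_eq hd1]
    have h1 : HasFDerivAt (fun w => fderiv ℝ φ w a) (fderiv ℝ (fun w => fderiv ℝ φ w a) z)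
        (ℓ 0) := by rw [hℓ0]; exact (hφ.differentiableAt_fderiv_apply a).hasFDerivAt
    exact (h1.comp_hasDerivAt (0 : ℝ) (hℓd 0)).deriv
  have hmax : IsLocalMax (φ ∘ ℓ) 0 := by
    have := hcont.eventually hm
    filter_upwards [this] with t ht
    simpa [hℓ0] using ht
  have hc : ContinuousAt (φ ∘ ℓ) 0 := by
    refine ContinuousAt.comp ?_ (hℓd 0).continuousAt
    rw [hℓ0]; exact hφ.continuousAt
  have hmin := isLocalMin_of_deriv_deriv_pos (f := φ ∘ ℓ) (x₀ := 0) (by rw [hd2]; exact hpos)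
    hmax.deriv_eq_zero hc
  have hconst : (φ ∘ ℓ) =ᶠ[𝓝 0] fun _ => (φ ∘ ℓ) 0 := by
    filter_upwards [hmax, hmin] with t h1 h2
    exact le_antisymm h1 h2
  have : deriv (deriv (φ ∘ ℓ)) 0 = 0 := by
    have h2 : deriv (φ ∘ ℓ) =ᶠ[𝓝 0] fun _ => 0 := by
      filter_upwards [hconst.eventuallyEq_nhds] with t ht
      rw [ht.deriv_eq]; simp
    rw [h2.deriv_eq]; simp
  rw [hd2] at this
  exact hpos.ne' this

lemma planeLap_nonpos_of_isLocalMax {φ : ℂ → ℝ} {z : ℂ} (hφ : ContDiffAt ℝ 2 φ z)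
    (hm : IsLocalMax φ z) : planeLap φ z ≤ 0 :=
  add_nonpos (secondDirDeriv_nonpos_of_isLocalMax hφ hm _)
    (secondDirDeriv_nonpos_of_isLocalMax hφ hm _)

/-! ### Comparison functions: |z|² with positive Laplacian, log |z| harmonic off 0. -/

lemma hasFDerivAt_complex_normSq (z : ℂ) :
    HasFDerivAt (fun w : ℂ => Complex.normSq w)
      ((2 * z.re) • Complex.reCLM + (2 * z.im) • Complex.imCLM) z := by
  have h1 := (Complex.reCLM.hasFDerivAt (x := z)).mul (Complex.reCLM.hasFDerivAt (x := z))
  have h2 := (Complex.imCLM.hasFDerivAt (x := z)).mul (Complex.imCLM.hasFDerivAt (x := z))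
  refine ((h1.add h2).congr_fderiv ?_).congr_of_eventuallyEq (.of_forall fun w => ?_)
  · ext
    simp
    ring
  · simp [Complex.normSq_apply]

lemma contDiff_complex_normSq : ContDiff ℝ 2 (fun w : ℂ => Complex.normSq w) := by
  simp only [Complex.normSq_apply]
  have h1 : ContDiff ℝ 2 fun w : ℂ => w.re := Complex.reCLM.contDiff
  have h2 : ContDiff ℝ 2 fun w : ℂ => w.im := Complex.imCLM.contDiff
  fun_prop

lemma planeLap_normSq (z : ℂ) : planeLap (fun w => Complex.normSq w) z = 4 := by
  have h : ∀ a : ℂ, (fun w => fderiv ℝ (fun w : ℂ => Complex.normSq w) w a)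
      = fun w => (2 * a.re) * Complex.reCLM w + (2 * a.im) * Complex.imCLM w := by
    intro a; ext w
    rw [(hasFDerivAt_complex_normSq w).fderiv]
    simp; ring
  have h2 : ∀ a : ℂ, secondDirDeriv (fun w => Complex.normSq w) a z
      = 2 * a.re * a.re + 2 * a.im * a.im := by
    intro a
    unfold secondDirDeriv
    rw [h a]
    have h3 : HasFDerivAt (fun w : ℂ => (2 * a.re) * Complex.reCLM w + (2 * a.im) * Complex.imCLM w)
        ((2 * a.re) • Complex.reCLM + (2 * a.im) • Complex.imCLM) z :=
      ((Complex.reCLM.hasFDerivAt (x := z)).const_mul _).add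
        ((Complex.imCLM.hasFDerivAt (x := z)).const_mul _)
    rw [h3.fderiv]
    simp
  simp only [planeLap, h2]
  norm_num

lemma log_norm_eq_half_log_normSq (w : ℂ) :
    Real.log ‖w‖ = 1 / 2 * Real.log (Complex.normSq w) := by
  rw [Complex.normSq_eq_norm_sq, Real.log_pow]; push_cast; ring

lemma hasFDerivAt_log_norm {z : ℂ} (hz : z ≠ 0) :
    HasFDerivAt (fun w : ℂ => Real.log ‖w‖)
      ((1 / 2 : ℝ) • ((Complex.normSq z)⁻¹ •
        ((2 * z.re) • Complex.reCLM + (2 * z.im) • Complex.imCLM))) z := by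
  have h := ((hasFDerivAt_complex_normSq z).log (by simpa using hz)).const_mul (1 / 2 : ℝ)
  exact h.congr_of_eventuallyEq (.of_forall fun w => log_norm_eq_half_log_normSq w)

lemma contDiffAt_log_norm {z : ℂ} (hz : z ≠ 0) : ContDiffAt ℝ 2 (fun w : ℂ => Real.log ‖w‖) z := by
  have h := (contDiff_complex_normSq.contDiffAt (x := z)).log (by simpa using hz)
  exact (h.const_smul (1 / 2 : ℝ)).congr_of_eventuallyEq
    (.of_forall fun w => by simpa using log_norm_eq_half_log_normSq w)

lemma fderiv_log_norm {z : ℂ} (hz : z ≠ 0) (a : ℂ) :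
    fderiv ℝ (fun w : ℂ => Real.log ‖w‖) z a = (a * z⁻¹).re := by
  rw [(hasFDerivAt_log_norm hz).fderiv]
  simp only [smul_apply, add_apply, Complex.reCLM_apply,
    Complex.imCLM_apply, smul_eq_mul, Complex.mul_re, Complex.inv_re, Complex.inv_im]
  field_simp
  ring

/-- The derivative in the direction a is Re(a / z), so the second one is Re(-a² / z²); the values
for a = 1 and a = i cancel because i² = -1. -/
lemma planeLap_log_norm {z : ℂ} (hz : z ≠ 0) : planeLap (fun w => Real.log ‖w‖) z = 0 := by
  have h2 : ∀ a : ℂ, secondDirDeriv (fun w => Real.log ‖w‖) a z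
      = (-(a * a) * (z ^ 2)⁻¹).re := by
    intro a
    unfold secondDirDeriv
    have h : (fun w => fderiv ℝ (fun w : ℂ => Real.log ‖w‖) w a) =ᶠ[𝓝 z]
        fun w => Complex.reCLM (a * w⁻¹) := by
      filter_upwards [isOpen_ne.mem_nhds hz] with w hw
      rw [fderiv_log_norm hw]; simp
    rw [h.fderiv_eq]
    have h3 : HasFDerivAt (fun w : ℂ => a * w⁻¹)
        ((a * (-(z ^ 2)⁻¹)) • (1 : ℂ →L[ℂ] ℂ)) z := by
      have := ((hasDerivAt_inv hz).const_mul a).hasFDerivAt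
      refine this.congr_fderiv ?_
      ext; simp
    have h4 := (Complex.reCLM.hasFDerivAt).comp z (h3.restrictScalars ℝ)
    rw [show (fun w : ℂ => Complex.reCLM (a * w⁻¹)) = Complex.reCLM ∘ (fun w => a * w⁻¹) from rfl,
      h4.fderiv]
    simp only [ContinuousLinearMap.comp_apply, Complex.reCLM_apply]
    congr 1
    simp
    ring
  simp only [planeLap, h2]
  rw [← Complex.add_re]
  simp

/-! ### Weak, punctured and strong maximum principles. -/

/-- The weak maximum principle for subharmonic functions. -/
theorem le_of_planeLap_nonneg {φ : ℂ → ℝ} {K Ω : Set ℂ} (hK : IsCompact K) (hΩ : IsOpen Ω)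
    (hΩK : Ω ⊆ K) (hc : ContinuousOn φ K) (hs : ∀ z ∈ Ω, ContDiffAt ℝ 2 φ z)
    (hl : ∀ z ∈ Ω, 0 ≤ planeLap φ z) {m : ℝ} (hm : ∀ z ∈ K, z ∉ Ω → φ z ≤ m) :
    ∀ z ∈ K, φ z ≤ m := by
  intro z hz
  obtain ⟨R, hR⟩ := (hK.image Complex.continuous_normSq).isBounded.subset_closedBall 0
  have hR' : ∀ w ∈ K, Complex.normSq w ≤ R := fun w hw => by
    have := hR (Set.mem_image_of_mem _ hw)
    rw [mem_closedBall_zero_iff] at this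
    exact (le_abs_self _).trans this
  -- Adding η |w|² raises the Laplacian by 4η, which makes it strictly positive and excludes a
  -- maximum inside Ω. The perturbation disappears as η → 0.
  have key : ∀ η : ℝ, 0 < η → φ z ≤ m + η * R := by
    intro η hη
    obtain ⟨y, hy, hmax⟩ := hK.exists_isMaxOn ⟨z, hz⟩
      (hc.add (continuousOn_const.mul Complex.continuous_normSq.continuousOn) :
        ContinuousOn (fun w => φ w + η * Complex.normSq w) K)
    have hyΩ : y ∉ Ω := by
      intro hyΩ
      have h1 := planeLap_nonpos_of_isLocalMax
        ((hs y hyΩ).add (contDiffAt_const.mul contDiff_complex_normSq.contDiffAt))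
        (hmax.isLocalMax (Filter.mem_of_superset (hΩ.mem_nhds hyΩ) hΩK))
      have h2 := planeLap_add_mul (hs y hyΩ) (contDiff_complex_normSq.contDiffAt (x := y)) η
      have h3 := hl y hyΩ
      rw [planeLap_normSq] at h2
      change planeLap (fun w => φ w + η * Complex.normSq w) y ≤ 0 at h1
      linarith
    have h1 : φ z + η * Complex.normSq z ≤ φ y + η * Complex.normSq y := hmax hz
    have h2 := hm y hy hyΩ
    have h3 := mul_le_mul_of_nonneg_left (hR' y hy) hη.le
    have h4 := mul_nonneg hη.le (Complex.normSq_nonneg z)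
    linarith
  have hlim : Filter.Tendsto (fun η : ℝ => m + η * R) (𝓝[>] 0) (𝓝 m) := by
    have : Filter.Tendsto (fun η : ℝ => m + η * R) (𝓝 0) (𝓝 (m + 0 * R)) :=
      (continuous_const.add (continuous_id.mul continuous_const)).tendsto _
    simp only [zero_mul, add_zero] at this
    exact this.mono_left nhdsWithin_le_nhds
  exact ge_of_tendsto hlim (Filter.eventually_of_mem self_mem_nhdsWithin fun η hη => key η hη)

/-- A subharmonic function on a punctured disc which grows more slowly than `log (1 / |z|)` is
bounded by its values on the boundary circle. -/
theorem le_of_planeLap_nonneg_punctured {φ : ℂ → ℝ} {R : ℝ}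
    (hs : ∀ z, z ≠ 0 → ‖z‖ ≤ R → ContDiffAt ℝ 2 φ z)
    (hl : ∀ z, z ≠ 0 → ‖z‖ ≤ R → 0 ≤ planeLap φ z)
    (hg : ∀ η : ℝ, 0 < η → ∀ B : ℝ, ∀ᶠ z in 𝓝[≠] (0 : ℂ), φ z + η * Real.log ‖z‖ ≤ B)
    {m : ℝ} (hm : ∀ z, ‖z‖ = R → φ z ≤ m) :
    ∀ z, z ≠ 0 → ‖z‖ ≤ R → φ z ≤ m := by
  intro z hz hzR
  have key : ∀ η : ℝ, 0 < η → φ z + η * Real.log ‖z‖ ≤ m + η * Real.log R := by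
    intro η hη
    have h1 := hg η hη (m + η * Real.log R)
    rw [eventually_nhdsWithin_iff, Metric.eventually_nhds_iff] at h1
    obtain ⟨ε, hε, h1⟩ := h1
    -- The inner radius is below ε, so the growth hypothesis bounds the harmonic perturbation of φ
    -- on the inner circle, and at most ‖z‖, so that z lies in the annulus.
    set ρ := min (ε / 2) (‖z‖) with hρ
    have hρ0 : 0 < ρ := lt_min (by linarith) (norm_pos_iff.mpr hz)
    have hne : ∀ w : ℂ, ρ ≤ ‖w‖ → w ≠ 0 := fun w hw => norm_pos_iff.mp (hρ0.trans_le hw)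
    have hcd : ∀ w : ℂ, ρ ≤ ‖w‖ → ‖w‖ ≤ R →
        ContDiffAt ℝ 2 (fun w => φ w + η * Real.log ‖w‖) w := fun w h2 h3 =>
      (hs w (hne w h2) h3).add (contDiffAt_const.mul (contDiffAt_log_norm (hne w h2)))
    refine le_of_planeLap_nonneg (φ := fun w => φ w + η * Real.log ‖w‖)
      (K := {w | ρ ≤ ‖w‖ ∧ ‖w‖ ≤ R}) (Ω := {w | ρ < ‖w‖ ∧ ‖w‖ < R}) ?_ ?_ ?_ ?_ ?_ ?_ ?_ z ?_
    · refine (isCompact_closedBall (0 : ℂ) R).of_isClosed_subset ?_ ?_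
      · exact (isClosed_le continuous_const continuous_norm).inter
          (isClosed_le continuous_norm continuous_const)
      · intro w hw; simpa using hw.2
    · exact (isOpen_lt continuous_const continuous_norm).inter
          (isOpen_lt continuous_norm continuous_const)
    · exact fun w hw => ⟨hw.1.le, hw.2.le⟩
    · exact fun w hw => (hcd w hw.1 hw.2).continuousAt.continuousWithinAt
    · exact fun w hw => hcd w hw.1.le hw.2.le
    · intro w hw
      rw [planeLap_add_mul (hs w (hne w hw.1.le) hw.2.le) (contDiffAt_log_norm (hne w hw.1.le)),
        planeLap_log_norm (hne w hw.1.le)]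
      have := hl w (hne w hw.1.le) hw.2.le
      linarith
    · intro w hw hw2
      rcases hw.1.eq_or_lt with h | h
      · refine h1 ?_ (hne w hw.1)
        rw [dist_zero_right, ← h]
        exact (min_le_left _ _).trans_lt (by linarith)
      · have h3 : ‖w‖ = R := le_antisymm hw.2 (not_lt.mp fun h4 => hw2 ⟨h, h4⟩)
        have := hm w h3
        simp only [h3]; linarith
    · exact ⟨min_le_right _ _, hzR⟩
  have hlim : Filter.Tendsto (fun η : ℝ => m + η * (Real.log R - Real.log ‖z‖)) (𝓝[>] 0) (𝓝 m) := by
    have : Filter.Tendsto (fun η : ℝ => m + η * (Real.log R - Real.log ‖z‖)) (𝓝 0)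
        (𝓝 (m + 0 * (Real.log R - Real.log ‖z‖))) :=
      (continuous_const.add (continuous_id.mul continuous_const)).tendsto _
    simp only [zero_mul, add_zero] at this
    exact this.mono_left nhdsWithin_le_nhds
  refine ge_of_tendsto hlim (Filter.eventually_of_mem self_mem_nhdsWithin fun η hη => ?_)
  have := key η hη
  linarith

/-- The strong maximum principle for subharmonic functions, in local form. -/
theorem eq_of_planeLap_nonneg_of_isMaxOn {φ : ℂ → ℝ} {a : ℂ} {ρ : ℝ}
    (hs : ∀ z ∈ Metric.ball a ρ, ContDiffAt ℝ 2 φ z)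
    (hl : ∀ z ∈ Metric.ball a ρ, 0 ≤ planeLap φ z)
    (hmax : ∀ z ∈ Metric.ball a ρ, φ z ≤ φ a) :
    ∀ z ∈ Metric.ball a (ρ / 2), φ z = φ a := by
  intro b hb
  by_contra hne
  have hab : dist a b < ρ / 2 := by rw [dist_comm]; exact hb
  -- This is why the conclusion is restricted to half the radius: the disc about b through a must
  -- stay in the domain.
  have hsub : Metric.closedBall b (dist a b) ⊆ Metric.ball a ρ := by
    intro w hw
    have h1 : dist w b ≤ dist a b := hw
    have h2 := dist_triangle w b a
    rw [dist_comm b a] at h2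
    exact Metric.mem_ball.mpr (by linarith)
  have hcb : ContinuousOn φ (Metric.closedBall b (dist a b)) := fun w hw =>
    (hs w (hsub hw)).continuousAt.continuousWithinAt
  -- Hopf's argument: y is a point of the maximal level set closest to b, so φ is strictly below its
  -- maximum on the open disc about b that touches y.
  obtain ⟨y, ⟨hyb, hyφ⟩, hymin⟩ := IsCompact.exists_isMinOn
    (s := Metric.closedBall b (dist a b) ∩ φ ⁻¹' {φ a}) (f := fun w => dist w b)
    ((isCompact_closedBall b _).of_isClosed_subset
      (hcb.preimage_isClosed_of_isClosed Metric.isClosed_closedBall isClosed_singleton)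
      Set.inter_subset_left)
    ⟨a, by simp, rfl⟩ (continuous_id.dist continuous_const).continuousOn
  have hyφ : φ y = φ a := hyφ
  set d := dist y b with hd
  have hyb' : d ≤ dist a b := hyb
  have hd0 : 0 < d := dist_pos.mpr (by rintro rfl; exact hne hyφ)
  have hball : ∀ w, dist w b ≤ d → w ∈ Metric.ball a ρ := fun w hw =>
    hsub (Metric.mem_closedBall.mpr (hw.trans hyb'))
  have hlt : ∀ w, dist w b < d → φ w < φ a := by
    intro w hw
    refine lt_of_le_of_ne (hmax w (hball w hw.le)) fun h => ?_
    have : d ≤ dist w b := hymin ⟨Metric.mem_closedBall.mpr (hw.le.trans hyb'), h⟩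
    linarith
  obtain ⟨x, hx, hxmax⟩ := (isCompact_closedBall b (d / 2)).exists_isMaxOn
    ⟨b, by simp; positivity⟩ (hcb.mono (Metric.closedBall_subset_closedBall (by linarith)))
  have hx' : φ x < φ a := hlt x (lt_of_le_of_lt (Metric.mem_closedBall.mp hx) (by linarith))
  -- Chosen so that φ a + ε log(|w - b| / d) equals φ x, the largest value of φ on the closed disc
  -- of radius d/2, when |w - b| = d/2.
  set ε := (φ a - φ x) / Real.log 2 with hεdef
  have hlog2 : 0 < Real.log 2 := Real.log_pos (by norm_num)
  have hε : 0 < ε := div_pos (by linarith) hlog2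
  have hεlog : ε * Real.log 2 = φ a - φ x := by rw [hεdef]; field_simp
  -- the barrier
  set β : ℂ → ℝ := fun w => Real.log ‖w - b‖ with hβ
  have hβs : ∀ w, w ≠ b → ContDiffAt ℝ 2 β w := fun w hw => by
    have h1 : ContDiffAt ℝ 2 (fun w : ℂ => Real.log ‖w‖) (w - b) :=
      contDiffAt_log_norm (sub_ne_zero.mpr hw)
    exact h1.comp w (contDiffAt_id.sub contDiffAt_const)
  have hβl : ∀ w, w ≠ b → planeLap β w = 0 := fun w hw => by
    rw [← planeLap_log_norm (sub_ne_zero.mpr hw)]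
    have h1 : ∀ (f : ℂ → ℝ) (u : ℂ), fderiv ℝ (fun w => f (w - b)) u = fderiv ℝ f (u - b) :=
      fun f u => fderiv_comp_sub ..
    simp only [planeLap, secondDirDeriv, hβ, h1 (fun w => Real.log ‖w‖),
      h1 (fun w => fderiv ℝ (fun w : ℂ => Real.log ‖w‖) w 1),
      h1 (fun w => fderiv ℝ (fun w : ℂ => Real.log ‖w‖) w Complex.I)]
  have hann : ∀ w, d / 2 ≤ dist w b → dist w b ≤ d →
      φ w + (-ε) * β w ≤ φ a + (-ε) * Real.log d := by
    intro w hw1 hw2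
    have hneb : ∀ w, d / 2 ≤ dist w b → w ≠ b := fun w hw => by
      rintro rfl; simp at hw; linarith
    refine le_of_planeLap_nonneg (φ := fun w => φ w + (-ε) * β w)
      (K := {w | d / 2 ≤ dist w b ∧ dist w b ≤ d}) (Ω := {w | d / 2 < dist w b ∧ dist w b < d})
      ?_ ?_ ?_ ?_ ?_ ?_ ?_ w ⟨hw1, hw2⟩
    · refine (isCompact_closedBall b d).of_isClosed_subset ?_ fun w hw => hw.2
      exact (isClosed_le continuous_const (continuous_id.dist continuous_const)).inter
        (isClosed_le (continuous_id.dist continuous_const) continuous_const)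
    · exact (isOpen_lt continuous_const (continuous_id.dist continuous_const)).inter
        (isOpen_lt (continuous_id.dist continuous_const) continuous_const)
    · exact fun w hw => ⟨hw.1.le, hw.2.le⟩
    · intro w hw
      exact ((hs w (hball w hw.2)).add (contDiffAt_const.mul
        (hβs w (hneb w hw.1)))).continuousAt.continuousWithinAt
    · intro w hw
      exact (hs w (hball w hw.2.le)).add (contDiffAt_const.mul (hβs w (hneb w hw.1.le)))
    · intro w hw
      rw [planeLap_add_mul (hs w (hball w hw.2.le)) (hβs w (hneb w hw.1.le)),
        hβl w (hneb w hw.1.le)]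
      have := hl w (hball w hw.2.le)
      linarith
    · intro w hw hw'
      simp only [hβ, ← dist_eq_norm]
      rcases hw.1.eq_or_lt with h | h
      · have h1 : φ w ≤ φ x := hxmax (Metric.mem_closedBall.mpr h.symm.le)
        rw [← h, Real.log_div hd0.ne' two_ne_zero]
        linarith
      · have h3 : dist w b = d := le_antisymm hw.2 (not_lt.mp fun h4 => hw' ⟨h, h4⟩)
        rw [h3]
        have := hmax w (hball w hw.2)
        linarith
  -- the derivative of `φ` along the radius at `y` vanishes
  have hya : y ∈ Metric.ball a ρ := hball y le_rfl
  have hymax : IsLocalMax φ y := by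
    filter_upwards [Metric.isOpen_ball.mem_nhds hya] with w hw
    rw [hyφ]; exact hmax w hw
  set ℓ : ℝ → ℂ := fun s => y - s • (y - b) with hℓ
  have hℓd : HasDerivAt ℓ (-(y - b)) 0 := by
    simpa [hℓ] using ((hasDerivAt_id (0 : ℝ)).smul_const (y - b)).const_sub y
  have hℓ0 : ℓ 0 = y := by simp [hℓ]
  have hder : HasDerivAt (φ ∘ ℓ) 0 0 := by
    have h1 : HasFDerivAt φ (0 : ℂ →L[ℝ] ℝ) (ℓ 0) := by
      rw [hℓ0, ← hymax.fderiv_eq_zero]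
      exact ((hs y hya).differentiableAt (by norm_num)).hasFDerivAt
    simpa using h1.comp_hasDerivAt (0 : ℝ) hℓd
  have hlogd : HasDerivAt (fun s : ℝ => φ a + ε * Real.log (1 - s)) (-ε) 0 := by
    have h1 : HasDerivAt (fun s : ℝ => 1 - s) (-1) 0 := by
      simpa using (hasDerivAt_id (0 : ℝ)).const_sub 1
    have h2 := ((h1.log (by norm_num)).const_mul ε).const_add (φ a)
    simpa using h2
  have hcomp : ∀ s : ℝ, 0 < s → s < 1 / 2 → (φ ∘ ℓ) s ≤ φ a + ε * Real.log (1 - s) := by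
    intro s hs0 hs1
    have h1 : ℓ s - b = (1 - s) • (y - b) := by simp only [hℓ]; module
    have h2 : dist (ℓ s) b = (1 - s) * d := by
      rw [dist_eq_norm, h1, norm_smul, hd, dist_eq_norm, Real.norm_of_nonneg (by linarith)]
    have h3 := hann (ℓ s) (by rw [h2]; nlinarith) (by rw [h2]; nlinarith)
    have h4 : β (ℓ s) = Real.log (1 - s) + Real.log d := by
      simp only [hβ]
      rw [← dist_eq_norm, h2, Real.log_mul (by linarith) hd0.ne']
    rw [h4] at h3
    simp only [Function.comp]
    linarith
  have hsub2 : HasDerivAt (fun s => (φ a + ε * Real.log (1 - s)) - (φ ∘ ℓ) s) (-ε - 0) 0 :=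
    hlogd.sub hder
  have hpos : ∀ᶠ s in 𝓝[>] (0 : ℝ), 0 ≤ (φ a + ε * Real.log (1 - s)) - (φ ∘ ℓ) s := by
    filter_upwards [Ioo_mem_nhdsGT (show (0 : ℝ) < 1 / 2 by norm_num)] with s hs'
    have := hcomp s hs'.1 hs'.2
    linarith
  have hslope := (hasDerivWithinAt_iff_tendsto_slope' (s := Set.Ioi (0 : ℝ)) (by simp)).mp
    hsub2.hasDerivWithinAt
  -- The barrier lies above φ along the radius and touches it at y. Its slope there is -ε and that
  -- of φ is 0, so the one-sided derivative of the difference has the wrong sign.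
  have : (0 : ℝ) ≤ -ε - 0 := by
    refine ge_of_tendsto hslope ?_
    filter_upwards [hpos, self_mem_nhdsWithin] with s h1 h2
    rw [slope_def_field]
    have h3 : (φ a + ε * Real.log (1 - 0)) - (φ ∘ ℓ) 0 = 0 := by
      simp [hℓ0, hyφ]
    rw [h3]
    have h4 : (0 : ℝ) < s := h2
    simp only [sub_zero]
    exact div_nonneg h1 h4.le
  linarith

/-! ## Hermitian forms on a finite dimensional space -/

section HermitianForms

variable {V : Type*} [AddCommGroup V] [Module ℂ V]

/-- A positive definite hermitian form. -/
structure IsInnerForm (B : V →ₗ[ℂ] V →ₗ⋆[ℂ] ℂ) : Prop where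
  conj_symm : ∀ s t, B s t = (starRingEnd ℂ) (B t s)
  pos : ∀ s, s ≠ 0 → 0 < (B s s).re

namespace IsInnerForm

variable {B B₁ B₂ : V →ₗ[ℂ] V →ₗ⋆[ℂ] ℂ}

lemma self_im (hB : IsInnerForm B) (s : V) : (B s s).im = 0 := by
  have := congrArg Complex.im (hB.conj_symm s s)
  rw [Complex.conj_im] at this
  linarith

lemma self_eq_re (hB : IsInnerForm B) (s : V) : B s s = ((B s s).re : ℂ) :=
  Complex.ext rfl (by simpa using hB.self_im s)

lemma self_nonneg (hB : IsInnerForm B) (s : V) : 0 ≤ (B s s).re := by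
  by_cases h : s = 0
  · simp [h]
  · exact (hB.pos s h).le

lemma eq_zero_of_self (hB : IsInnerForm B) {s : V} (h : (B s s).re = 0) : s = 0 := by
  by_contra hs
  exact (hB.pos s hs).ne' h

lemma eq_of_forall (hB : IsInnerForm B) {s s' : V} (h : ∀ t, B s t = B s' t) : s = s' := by
  have h1 : B (s - s') (s - s') = 0 := by
    rw [LinearMap.map_sub₂, h, sub_self]
  exact sub_eq_zero.mp (hB.eq_zero_of_self (by rw [h1]; rfl))

/-- The inner product space structure of a positive definite hermitian form. -/
@[reducible] def core (hB : IsInnerForm B) : InnerProductSpace.Core ℂ V where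
  -- The arguments are exchanged because `B` is conjugate linear in its second variable and `inner`
  -- in its first.
  inner x y := B y x
  conj_inner_symm x y := (hB.conj_symm _ _).symm
  re_inner_nonneg x := hB.self_nonneg x
  add_left x y z := by simp
  smul_left x y r := by simp
  definite x hx := hB.eq_zero_of_self (by rw [hx]; rfl)

lemma exists_orthonormal_basis [FiniteDimensional ℂ V] (hB : IsInnerForm B) :
    ∃ b : Module.Basis (Fin (Module.finrank ℂ V)) ℂ V,
      ∀ i j, B (b i) (b j) = if i = j then 1 else 0 := by
  let : NormedAddCommGroup V := @InnerProductSpace.Core.toNormedAddCommGroup ℂ V _ _ _ hB.core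
  let : InnerProductSpace ℂ V := InnerProductSpace.ofCore hB.core.toCore
  refine ⟨(stdOrthonormalBasis ℂ V).toBasis, fun i j => ?_⟩
  have := orthonormal_iff_ite.mp (stdOrthonormalBasis ℂ V).orthonormal j i
  simp only [OrthonormalBasis.coe_toBasis]
  rw [show B (stdOrthonormalBasis ℂ V i) (stdOrthonormalBasis ℂ V j)
    = inner ℂ (stdOrthonormalBasis ℂ V j) (stdOrthonormalBasis ℂ V i) from rfl, this]
  simp [eq_comm]

/-- A self-adjoint operator has a basis of eigenvectors with real eigenvalues. -/
lemma exists_eigenbasis [FiniteDimensional ℂ V] (hB : IsInnerForm B) {L : Module.End ℂ V}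
    (hL : ∀ s t, B (L s) t = B s (L t)) :
    ∃ (b : Module.Basis (Fin (Module.finrank ℂ V)) ℂ V) (μ : Fin (Module.finrank ℂ V) → ℝ),
      (∀ i j, B (b i) (b j) = if i = j then 1 else 0) ∧ ∀ i, L (b i) = (μ i : ℂ) • b i := by
  let : NormedAddCommGroup V := @InnerProductSpace.Core.toNormedAddCommGroup ℂ V _ _ _ hB.core
  let : InnerProductSpace ℂ V := InnerProductSpace.ofCore hB.core.toCore
  have hs : LinearMap.IsSymmetric L := fun x y => (hL y x).symm
  refine ⟨(hs.eigenvectorBasis rfl).toBasis, hs.eigenvalues rfl, fun i j => ?_, fun i => by simp⟩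
  have := orthonormal_iff_ite.mp (hs.eigenvectorBasis rfl).orthonormal j i
  simp only [OrthonormalBasis.coe_toBasis]
  rw [show B (hs.eigenvectorBasis rfl i) (hs.eigenvectorBasis rfl j)
    = inner ℂ (hs.eigenvectorBasis rfl j) (hs.eigenvectorBasis rfl i) from rfl, this]
  simp [eq_comm]

section Basis

variable {n : ℕ} {b : Module.Basis (Fin n) ℂ V}

lemma repr_eq (hb : ∀ i j, B (b i) (b j) = if i = j then 1 else 0) (s : V) (i : Fin n) :
    b.repr s i = B s (b i) := by
  conv_rhs => rw [← b.sum_repr s]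
  simp only [map_sum, map_smul, LinearMap.sum_apply, LinearMap.smul_apply, hb, smul_eq_mul]
  simp

lemma trace_eq_sum (hb : ∀ i j, B (b i) (b j) = if i = j then 1 else 0) (L : Module.End ℂ V) :
    LinearMap.trace ℂ V L = ∑ i, B (L (b i)) (b i) := by
  rw [LinearMap.trace_eq_matrix_trace ℂ b, Matrix.trace]
  simp [LinearMap.toMatrix_apply, repr_eq hb]

end Basis

/-- Riesz representation in a B₁-orthonormal basis: L s = ∑ B₂(s, bᵢ) bᵢ. -/
lemma exists_transition [FiniteDimensional ℂ V] (hB₁ : IsInnerForm B₁)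
    (B₂ : V →ₗ[ℂ] V →ₗ⋆[ℂ] ℂ) :
    ∃ L : Module.End ℂ V, ∀ s t, B₁ (L s) t = B₂ s t := by
  obtain ⟨b, hb⟩ := hB₁.exists_orthonormal_basis
  refine ⟨∑ i, (B₂.flip (b i)).smulRight (b i), fun s t => ?_⟩
  conv_rhs => rw [← b.sum_repr t]
  simp only [LinearMap.sum_apply, LinearMap.smulRight_apply, map_sum, map_smul,
    LinearMap.smul_apply, LinearMap.flip_apply, LinearMap.map_smulₛₗ, smul_eq_mul]
  refine Finset.sum_congr rfl fun i _ => ?_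
  rw [repr_eq hb, hB₁.conj_symm t, Complex.conj_conj, mul_comm]


lemma transition_isSelfAdjoint (hB₁ : IsInnerForm B₁) (hB₂ : IsInnerForm B₂) {L : Module.End ℂ V}
    (hL : ∀ s t, B₁ (L s) t = B₂ s t) (s t : V) : B₁ (L s) t = B₁ s (L t) := by
  rw [hL, hB₂.conj_symm, ← hL, ← hB₁.conj_symm]

/-- Real coefficients are essential here: in the conjugate linear variable a scalar comes out
conjugated. -/
lemma aeval_isSelfAdjoint {L : Module.End ℂ V} (hL : ∀ s t, B (L s) t = B s (L t)) (p : Polynomial ℝ) (s t : V) :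
    B (Polynomial.aeval L (p.map Complex.ofRealHom) s) t
      = B s (Polynomial.aeval L (p.map Complex.ofRealHom) t) := by
  induction p using Polynomial.induction_on' generalizing s t with
  | add p q hp hq => simp only [Polynomial.map_add, map_add, LinearMap.add_apply, hp, hq]
  | monomial n a =>
    have hpow : ∀ (n : ℕ) (s t : V), B ((L ^ n) s) t = B s ((L ^ n) t) := by
      intro n
      induction n with
      | zero => simp
      | succ n ih => intro s t; rw [pow_succ, Module.End.mul_apply, ih, hL,
          ← Module.End.mul_apply, ← pow_succ', pow_succ]
    simp only [Polynomial.map_monomial, Polynomial.aeval_monomial, Module.End.mul_apply,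
      Module.algebraMap_end_apply, map_smul, LinearMap.smul_apply, LinearMap.map_smulₛₗ, hpow]
    simp

variable [FiniteDimensional ℂ V] {L : Module.End ℂ V}

lemma trace_transition_re (hB₁ : IsInnerForm B₁) (hB₂ : IsInnerForm B₂)
    (hL : ∀ s t, B₁ (L s) t = B₂ s t) :
    LinearMap.trace ℂ V L = ((LinearMap.trace ℂ V L).re : ℂ) := by
  obtain ⟨b, hb⟩ := hB₁.exists_orthonormal_basis
  refine Complex.ext rfl ?_
  rw [trace_eq_sum hb, Complex.im_sum, Complex.ofReal_im]
  exact Finset.sum_eq_zero fun i _ => by rw [hL, hB₂.self_im]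

lemma trace_transition_pos [Nontrivial V] (hB₁ : IsInnerForm B₁) (hB₂ : IsInnerForm B₂)
    (hL : ∀ s t, B₁ (L s) t = B₂ s t) : 0 < (LinearMap.trace ℂ V L).re := by
  obtain ⟨b, hb⟩ := hB₁.exists_orthonormal_basis
  rw [trace_eq_sum hb, Complex.re_sum]
  refine Finset.sum_pos (fun i _ => by rw [hL]; exact hB₂.pos _ (b.ne_zero i)) ?_
  exact ⟨⟨0, Module.finrank_pos⟩, Finset.mem_univ _⟩

/-- In a B₁-orthonormal basis the trace is ∑ B₂(bᵢ, bᵢ). With `le_trace_transition_mul` this makes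
the trace equivalent to the best constant in B₂ ≤ C B₁, up to the factor dim V. -/
lemma trace_transition_le (hB₁ : IsInnerForm B₁) (hL : ∀ s t, B₁ (L s) t = B₂ s t) {C : ℝ}
    (hC : ∀ s, (B₂ s s).re ≤ C * (B₁ s s).re) :
    (LinearMap.trace ℂ V L).re ≤ Module.finrank ℂ V * C := by
  obtain ⟨b, hb⟩ := hB₁.exists_orthonormal_basis
  rw [trace_eq_sum hb, Complex.re_sum]
  calc ∑ i, (B₁ (L (b i)) (b i)).re ≤ ∑ _i : Fin (Module.finrank ℂ V), C :=
        Finset.sum_le_sum fun i _ => by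
          rw [hL]; refine (hC _).trans ?_; rw [hb]; simp
    _ = _ := by simp

/-- The eigenvalues of L are non-negative, so each of them, in particular the largest, is at most
their sum. -/
lemma le_trace_transition_mul (hB₁ : IsInnerForm B₁) (hB₂ : IsInnerForm B₂)
    (hL : ∀ s t, B₁ (L s) t = B₂ s t) (s : V) :
    (B₂ s s).re ≤ (LinearMap.trace ℂ V L).re * (B₁ s s).re := by
  obtain ⟨b, μ, hb, hμ⟩ := hB₁.exists_eigenbasis (hB₁.transition_isSelfAdjoint hB₂ hL)
  have hμ0 : ∀ i, 0 ≤ μ i := fun i => by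
    have h1 := hL (b i) (b i)
    rw [hμ, LinearMap.map_smul₂, hb] at h1
    have h2 := hB₂.self_nonneg (b i)
    rw [← h1] at h2
    simpa using h2
  have htr : (LinearMap.trace ℂ V L).re = ∑ i, μ i := by
    rw [trace_eq_sum hb, Complex.re_sum]
    exact Finset.sum_congr rfl fun i _ => by rw [hμ, LinearMap.map_smul₂, hb]; simp
  have h1 : ∀ M : Module.End ℂ V, B₁ (M s) s = ∑ i, b.repr s i * B₁ (M (b i)) s := fun M => by
    have h : B₁ (M (∑ i, b.repr s i • b i)) s = ∑ i, b.repr s i * B₁ (M (b i)) s := by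
      rw [map_sum, map_sum, LinearMap.sum_apply]
      exact Finset.sum_congr rfl fun i _ => by
        rw [map_smul, LinearMap.map_smul₂, smul_eq_mul]
    rwa [b.sum_repr] at h
  have h2 : ∀ i, B₁ (b i) s = (starRingEnd ℂ) (b.repr s i) := fun i => by
    rw [repr_eq hb, ← hB₁.conj_symm]
  have h3 : (B₁ s s).re = ∑ i, Complex.normSq (b.repr s i) := by
    have := h1 1
    simp only [Module.End.one_apply] at this
    rw [this, Complex.re_sum]
    exact Finset.sum_congr rfl fun i _ => by rw [h2, Complex.mul_conj, Complex.ofReal_re]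
  have h4 : (B₂ s s).re = ∑ i, μ i * Complex.normSq (b.repr s i) := by
    rw [← hL, h1 L, Complex.re_sum]
    refine Finset.sum_congr rfl fun i _ => ?_
    rw [hμ, LinearMap.map_smul₂, h2, smul_eq_mul, mul_left_comm, Complex.mul_conj,
      ← Complex.ofReal_mul, Complex.ofReal_re]
  rw [h4, htr, h3, Finset.sum_mul]
  refine Finset.sum_le_sum fun i _ => mul_le_mul_of_nonneg_left ?_ (hμ0 i)
  exact Finset.single_le_sum (f := fun i => Complex.normSq (b.repr s i))
    (fun j _ => Complex.normSq_nonneg _) (Finset.mem_univ i)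

/-- The algebra behind the subharmonicity of `log Tr h`: here `A₁`, `A₂` stand for the values of
`Ψ(H₁)`, `Ψ(H₂)` on a vector, and `L` for `h`. -/
lemma exists_energy (hB₁ : IsInnerForm B₁) (hB₂ : IsInnerForm B₂)
    (hL : ∀ s t, B₁ (L s) t = B₂ s t) {A₁ A₂ : Module.End ℂ V}
    (hA₁ : ∀ s t, B₁ (A₁ s) t = B₁ s (A₁ t)) (hA₂ : ∀ s t, B₂ (A₂ s) t = B₂ s (A₂ t)) :
    ∃ Q : ℝ, 0 ≤ Q ∧ (Q = 0 → A₁ = A₂) ∧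
      LinearMap.trace ℂ V ((L * A₂ - A₁ * L) * A₂ - A₁ * (L * A₂ - A₁ * L)) = Q ∧
      (LinearMap.trace ℂ V (L * A₂ - A₁ * L)).re ^ 2 ≤ Q * (LinearMap.trace ℂ V L).re := by
  obtain ⟨b, hb⟩ := hB₁.exists_orthonormal_basis
  set N := A₁ - A₂ with hN
  -- The energy is the squared Hilbert-Schmidt norm of A₁ - A₂, with B₁ measuring the source and B₂
  -- the target.
  refine ⟨∑ j, (B₂ (N (b j)) (N (b j))).re, Finset.sum_nonneg fun j _ => hB₂.self_nonneg _,
    fun h0 => ?_, ?_, ?_⟩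
  · rw [Finset.sum_eq_zero_iff_of_nonneg fun j _ => hB₂.self_nonneg _] at h0
    refine b.ext fun j => ?_
    have := hB₂.eq_zero_of_self (h0 j (Finset.mem_univ j))
    rwa [hN, LinearMap.sub_apply, sub_eq_zero] at this
  -- By cyclicity of the trace the expression is tr((A₁L - LA₂)N). Moving A₁ across B₁ and A₂ across
  -- B₂ leaves B₂(N b, A₁ b - A₂ b) in each diagonal entry.
  · have h1 : LinearMap.trace ℂ V (A₁ * L * N - L * A₂ * N)
        = ((∑ j, (B₂ (N (b j)) (N (b j))).re : ℝ) : ℂ) := by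
      rw [trace_eq_sum hb, Complex.ofReal_sum]
      refine Finset.sum_congr rfl fun j _ => ?_
      rw [← hB₂.self_eq_re]
      simp only [LinearMap.sub_apply, Module.End.mul_apply, LinearMap.map_sub₂]
      rw [hA₁, hL, hL, hA₂, ← map_sub, ← LinearMap.sub_apply]
    rw [← h1, hN]
    have e1 : LinearMap.trace ℂ V (A₁ * A₁ * L) = LinearMap.trace ℂ V (A₁ * L * A₁) := by
      rw [mul_assoc, LinearMap.trace_mul_comm]
    have e2 : LinearMap.trace ℂ V (A₁ * L * A₂) = LinearMap.trace ℂ V (L * A₂ * A₁) := by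
      rw [mul_assoc, LinearMap.trace_mul_comm]
    simp only [mul_sub, sub_mul, map_sub, ← mul_assoc, e1, e2]
    ring
  · have h1 : (LinearMap.trace ℂ V (L * A₂ - A₁ * L)).re
        = -∑ j, (B₂ (N (b j)) (b j)).re := by
      have e1 : LinearMap.trace ℂ V (L * A₂ - A₁ * L) = -LinearMap.trace ℂ V (L * N) := by
        rw [map_sub, LinearMap.trace_mul_comm ℂ A₁ L, hN, mul_sub, map_sub]; ring
      rw [e1, trace_eq_sum hb, Complex.neg_re, Complex.re_sum]
      simp only [Module.End.mul_apply, hL]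
    have h2 : (LinearMap.trace ℂ V L).re = ∑ j, (B₂ (b j) (b j)).re := by
      rw [trace_eq_sum hb, Complex.re_sum]
      simp only [hL]
    -- Cauchy-Schwarz in the sum over the basis: the quadratic polynomial t ↦ ∑ |N bⱼ + t bⱼ|² is
    -- non-negative, so its discriminant is not positive.
    have h3 : ∀ t : ℝ, 0 ≤ (∑ j, (B₂ (b j) (b j)).re) * (t * t)
        + (2 * ∑ j, (B₂ (N (b j)) (b j)).re) * t + ∑ j, (B₂ (N (b j)) (N (b j))).re := by
      intro t
      have : 0 ≤ ∑ j, (B₂ (N (b j) + (t : ℂ) • b j) (N (b j) + (t : ℂ) • b j)).re :=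
        Finset.sum_nonneg fun j _ => hB₂.self_nonneg _
      refine this.trans (le_of_eq ?_)
      rw [Finset.mul_sum, Finset.sum_mul, Finset.sum_mul, ← Finset.sum_add_distrib,
        ← Finset.sum_add_distrib]
      refine Finset.sum_congr rfl fun j _ => ?_
      have h5 : (B₂ (b j) (N (b j))).re = (B₂ (N (b j)) (b j)).re := by
        rw [hB₂.conj_symm, Complex.conj_re]
      simp only [map_add, LinearMap.add_apply, map_smul, LinearMap.smul_apply, LinearMap.map_smulₛₗ,
        smul_eq_mul, Complex.add_re, Complex.conj_ofReal, Complex.re_ofReal_mul,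
        h5]
      ring
    have h4 := discrim_le_zero h3
    rw [discrim] at h4
    rw [h1, h2]
    nlinarith

/-- For self-adjoint L, tr(L²) = ∑ |L bⱼ|². A single scalar thus detects vanishing, and for parallel
L that scalar is constant on the surface. -/
lemma eq_zero_of_trace_mul_self (hB : IsInnerForm B)
    (hL : ∀ s t, B (L s) t = B s (L t)) (h0 : LinearMap.trace ℂ V (L * L) = 0) : L = 0 := by
  obtain ⟨b, hb⟩ := hB.exists_orthonormal_basis
  rw [trace_eq_sum hb] at h0
  have h1 := congrArg Complex.re h0
  simp only [Module.End.mul_apply, hL (L _), Complex.re_sum, Complex.zero_re] at h1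
  rw [Finset.sum_eq_zero_iff_of_nonneg fun j _ => hB.self_nonneg _] at h1
  refine b.ext fun j => ?_
  simpa using hB.eq_zero_of_self (h1 j (Finset.mem_univ j))

/-- A self-adjoint operator which is not a multiple of the identity has a spectral projection
which is neither `0` nor `1`. -/
lemma exists_idempotent_aeval (hB : IsInnerForm B) (hL : ∀ s t, B (L s) t = B s (L t))
    (hns : ∀ c : ℂ, L ≠ c • 1) :
    ∃ p : Polynomial ℝ, IsIdempotentElem (Polynomial.aeval L (p.map Complex.ofRealHom)) ∧
      Polynomial.aeval L (p.map Complex.ofRealHom) ≠ 0 ∧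
      Polynomial.aeval L (p.map Complex.ofRealHom) ≠ 1 := by
  obtain ⟨b, μ, -, hμ⟩ := hB.exists_eigenbasis hL
  obtain ⟨i, j, hij⟩ : ∃ i j, μ i ≠ μ j := by
    by_contra! h
    by_cases hn : Nonempty (Fin (Module.finrank ℂ V))
    · obtain ⟨i⟩ := hn
      exact hns (μ i) (b.ext fun j => by rw [hμ, h j i]; simp)
    · exact hns 0 (b.ext fun j => (hn ⟨j⟩).elim)
  -- The polynomial is 1 at the eigenvalue μ i and 0 at all others, so p(L) is the spectral
  -- projection of that eigenvalue. The nodes are the image of μ, which removes multiplicities.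
  set p : Polynomial ℝ := Lagrange.interpolate (Finset.univ.image μ) id
    (fun x => if x = μ i then 1 else 0) with hp
  have hpe : ∀ k, p.eval (μ k) = if μ k = μ i then 1 else 0 := fun k => by
    rw [hp]
    exact Lagrange.eval_interpolate_at_node _ (Function.injective_id.injOn)
      (Finset.mem_image_of_mem _ (Finset.mem_univ k))
  have hpb : ∀ k, Polynomial.aeval L (p.map Complex.ofRealHom) (b k)
      = (if μ k = μ i then 1 else 0 : ℂ) • b k := fun k => by
    rw [Module.End.aeval_apply_of_hasEigenvector (μ := (μ k : ℂ))
      ⟨Module.End.mem_eigenspace_iff.mpr (hμ k), b.ne_zero k⟩]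
    congr 1
    rw [show ((μ k : ℝ) : ℂ) = Complex.ofRealHom (μ k) from rfl, Polynomial.eval_map_apply, hpe]
    split_ifs <;> simp
  refine ⟨p, b.ext fun k => ?_, fun h => ?_, fun h => ?_⟩
  · rw [Module.End.mul_apply, hpb, map_smul, hpb, smul_smul]
    split_ifs <;> simp
  · have := hpb i
    rw [h, if_pos rfl, one_smul, LinearMap.zero_apply] at this
    exact b.ne_zero i this.symm
  · have := hpb j
    rw [h, if_neg hij.symm, zero_smul, Module.End.one_apply] at this
    exact b.ne_zero j this

end IsInnerForm

end HermitianForms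

/-! ## Coordinate vector fields -/

section CoordVec

variable {Y : Type*} [TopologicalSpace Y] [ChartedSpace ℂ Y] [IsManifold 𝓘(ℂ) ω Y]

lemma contDiffGroupoid_complex_le_real :
    contDiffGroupoid ω 𝓘(ℂ) ≤ contDiffGroupoid ∞ 𝓘(ℝ, ℂ) := by
  rw [contDiffGroupoid, contDiffGroupoid]
  refine groupoid_of_pregroupoid_le _ _ fun f s h => ?_
  simp only [contDiffPregroupoid] at h ⊢
  have h2 := (ContDiffOn.restrict_scalars ℝ h).of_le (m := ∞) le_top
  simpa using! h2

lemma maximalAtlas_complex_subset_real {Y : Type*} [TopologicalSpace Y] [ChartedSpace ℂ Y] :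
    IsManifold.maximalAtlas 𝓘(ℂ) ω Y ⊆ IsManifold.maximalAtlas 𝓘(ℝ, ℂ) ∞ Y :=
  StructureGroupoid.maximalAtlas_mono contDiffGroupoid_complex_le_real

variable {e : OpenPartialHomeomorph Y ℂ} (he : e ∈ IsManifold.maximalAtlas 𝓘(ℂ) ω Y)

include he

lemma contMDiffOn_of_mem_complexAtlas : ContMDiffOn 𝓘(ℝ, ℂ) 𝓘(ℝ, ℂ) ∞ e e.source :=
  contMDiffOn_of_mem_maximalAtlas (maximalAtlas_complex_subset_real he)

lemma contMDiffOn_symm_of_mem_complexAtlas :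
    ContMDiffOn 𝓘(ℝ, ℂ) 𝓘(ℝ, ℂ) ∞ e.symm e.target :=
  contMDiffOn_symm_of_mem_maximalAtlas (maximalAtlas_complex_subset_real he)

lemma mdifferentiable_of_mem_complexAtlas : e.MDifferentiable 𝓘(ℝ, ℂ) 𝓘(ℝ, ℂ) :=
  ⟨(contMDiffOn_of_mem_complexAtlas he).mdifferentiableOn (by simp),
    (contMDiffOn_symm_of_mem_complexAtlas he).mdifferentiableOn (by simp)⟩

lemma coordVec_eq {y : Y} (hy : y ∈ e.source) (a : ℂ) :
    coordVec e a y = mfderiv 𝓘(ℝ, ℂ) 𝓘(ℝ, ℂ) e.symm (e y) a := by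
  have hd := mdifferentiable_of_mem_complexAtlas he
  have h : mvfderiv 𝓘(ℝ, ℂ) e y
      = ((hd.mfderiv hy).trans (NormedSpace.fromTangentSpace (e y)) :
        TangentSpace 𝓘(ℝ, ℂ) y ≃L[ℝ] ℂ) := rfl
  rw [coordVec, h, ContinuousLinearMap.inverse_equiv]
  rfl

lemma mvfderiv_coordVec_self {y : Y} (hy : y ∈ e.source) (a : ℂ) :
    mvfderiv 𝓘(ℝ, ℂ) e y (coordVec e a y) = a := by
  have hd := mdifferentiable_of_mem_complexAtlas he
  have h : mvfderiv 𝓘(ℝ, ℂ) e y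
      = ((hd.mfderiv hy).trans (NormedSpace.fromTangentSpace (e y)) :
        TangentSpace 𝓘(ℝ, ℂ) y ≃L[ℝ] ℂ) := rfl
  rw [coordVec, h, ContinuousLinearMap.inverse_equiv]
  exact ContinuousLinearEquiv.apply_symm_apply _ _

lemma coordVec_mvfderiv {y : Y} (hy : y ∈ e.source) (v : TangentSpace 𝓘(ℝ, ℂ) y) :
    coordVec e (mvfderiv 𝓘(ℝ, ℂ) e y v) y = v := by
  have hd := mdifferentiable_of_mem_complexAtlas he
  have h : mvfderiv 𝓘(ℝ, ℂ) e y
      = ((hd.mfderiv hy).trans (NormedSpace.fromTangentSpace (e y)) :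
        TangentSpace 𝓘(ℝ, ℂ) y ≃L[ℝ] ℂ) := rfl
  rw [coordVec, h, ContinuousLinearMap.inverse_equiv]
  exact ContinuousLinearEquiv.symm_apply_apply _ _

/-- The bridge between calculus on the surface and in the plane: differentiation along a coordinate
field becomes a partial derivative of the coordinate expression. -/
lemma mvfderiv_coordVec {G : Type*} [NormedAddCommGroup G] [NormedSpace ℝ G] {f : Y → G} {y : Y}
    (hy : y ∈ e.source) (hf : MDifferentiableAt 𝓘(ℝ, ℂ) 𝓘(ℝ, G) f y) (a : ℂ) :
    mvfderiv 𝓘(ℝ, ℂ) f y (coordVec e a y) = fderiv ℝ (fun w => f (e.symm w)) (e y) a := by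
  have hd := mdifferentiable_of_mem_complexAtlas he
  rw [coordVec_eq he hy]
  have h1 := hd.mdifferentiableAt_symm (e.map_source hy)
  have h2 : MDifferentiableAt 𝓘(ℝ, ℂ) 𝓘(ℝ, G) f (e.symm (e y)) := by rwa [e.left_inv hy]
  have h3 := mfderiv_comp (e y) h2 h1
  rw [e.left_inv hy] at h3
  have h4 : fderiv ℝ (fun w => f (e.symm w)) (e y)
      = mfderiv 𝓘(ℝ, ℂ) 𝓘(ℝ, G) (f ∘ e.symm) (e y) := mfderiv_eq_fderiv.symm
  rw [h4, h3]
  rfl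

lemma contMDiffOn_coordVec (a : ℂ) :
    ContMDiffOn 𝓘(ℝ, ℂ) 𝓘(ℝ, ℂ).tangent ∞
      (fun y => (Bundle.TotalSpace.mk' ℂ y (coordVec e a y) : TangentBundle 𝓘(ℝ, ℂ) Y))
      e.source := by
  have h1 := (contMDiffOn_symm_of_mem_complexAtlas he).contMDiffOn_tangentMapWithin
    (m := ∞) (by simp) e.open_target.uniqueMDiffOn
  have h2 : ContMDiffOn 𝓘(ℝ, ℂ) 𝓘(ℝ, ℂ).tangent ∞
      (fun y => (Bundle.TotalSpace.mk' ℂ (e y) a : TangentBundle 𝓘(ℝ, ℂ) ℂ)) e.source := by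
    have h3 : ContMDiff 𝓘(ℝ, ℂ) 𝓘(ℝ, ℂ).tangent ∞
        (fun w : ℂ => (Bundle.TotalSpace.mk' ℂ w a : TangentBundle 𝓘(ℝ, ℂ) ℂ)) :=
      contMDiff_vectorSpace_iff_contDiff.mpr contDiff_const
    exact h3.comp_contMDiffOn (contMDiffOn_of_mem_complexAtlas he)
  refine (h1.comp h2 fun y hy => e.map_source hy).congr fun y hy => ?_
  rw [coordVec_eq he hy]
  simp only [Function.comp, tangentMapWithin]
  have h5 : mfderivWithin 𝓘(ℝ, ℂ) 𝓘(ℝ, ℂ) e.symm e.target (e y)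
      = mfderiv 𝓘(ℝ, ℂ) 𝓘(ℝ, ℂ) e.symm (e y) :=
    mfderivWithin_of_isOpen e.open_target (e.map_source hy)
  change _ = (Bundle.TotalSpace.mk' ℂ (e.symm (e y))
    (mfderivWithin 𝓘(ℝ, ℂ) 𝓘(ℝ, ℂ) e.symm e.target (e y) a) : TangentBundle 𝓘(ℝ, ℂ) Y)
  rw [h5]
  -- The fibre depends on the base point, so the equality of `e.symm (e y)` and `y` must be
  -- transported through the total space.
  have h6 : ∀ (y' : Y) (w : ℂ), y' = y →
      (Bundle.TotalSpace.mk' ℂ y w : TangentBundle 𝓘(ℝ, ℂ) Y) = Bundle.TotalSpace.mk' ℂ y' w := by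
    rintro _ _ rfl; rfl
  exact h6 _ _ (e.left_inv hy)

lemma contMDiffOn_mvfderiv_coordVec {G : Type*} [NormedAddCommGroup G] [NormedSpace ℝ G]
    {f : Y → G} {U : Set Y} (hU : IsOpen U) (hUe : U ⊆ e.source)
    (hf : ContMDiffOn 𝓘(ℝ, ℂ) 𝓘(ℝ, G) ∞ f U) (a : ℂ) :
    ContMDiffOn 𝓘(ℝ, ℂ) 𝓘(ℝ, G) ∞ (fun y => mvfderiv 𝓘(ℝ, ℂ) f y (coordVec e a y)) U := by
  have hV : IsOpen (e.target ∩ e.symm ⁻¹' U) := e.isOpen_inter_preimage_symm hU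
  have h1 : ContDiffOn ℝ ∞ (fun w => f (e.symm w)) (e.target ∩ e.symm ⁻¹' U) := by
    rw [← contMDiffOn_iff_contDiffOn]
    exact hf.comp ((contMDiffOn_symm_of_mem_complexAtlas he).mono Set.inter_subset_left)
      fun w hw => hw.2
  have h2 : ContDiffOn ℝ ∞ (fun w => fderiv ℝ (fun w => f (e.symm w)) w a)
      (e.target ∩ e.symm ⁻¹' U) :=
    ((h1.fderiv_of_isOpen hV (by simp)).clm_apply contDiffOn_const)
  refine ((contMDiffOn_iff_contDiffOn.mpr h2).comp
    ((contMDiffOn_of_mem_complexAtlas he).mono hUe) fun y hy => ?_).congr fun y hy => ?_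
  · exact ⟨e.map_source (hUe hy), by simpa [e.left_inv (hUe hy)] using hy⟩
  · exact mvfderiv_coordVec he (hUe hy)
      (((hf y hy).contMDiffAt (hU.mem_nhds hy)).mdifferentiableAt (by simp)) a

end CoordVec

/-! ## Local frames and smooth sections -/

section Frames

variable {Y : Type*} [TopologicalSpace Y] [ChartedSpace ℂ Y]
  {F : Type*} [NormedAddCommGroup F] [NormedSpace ℂ F]
  {E : Y → Type*} [TopologicalSpace (Bundle.TotalSpace F E)]
  [∀ y, AddCommGroup (E y)] [∀ y, Module ℂ (E y)] [∀ y, TopologicalSpace (E y)]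
  [FiberBundle F E]

variable (F E) in
/-- A smooth complex frame of `E` over `U`, together with its coordinate functions. -/
structure SmoothFrame (U : Set Y) (n : ℕ) where
  sec : Fin n → ∀ y, E y
  coord : Fin n → ∀ y, E y →ₗ[ℂ] ℂ
  coord_sec : ∀ y ∈ U, ∀ i j, coord i y (sec j y) = if i = j then 1 else 0
  sum_coord : ∀ y ∈ U, ∀ s, ∑ i, coord i y s • sec i y = s
  smooth_iff : ∀ V ⊆ U, IsOpen V → ∀ σ : ∀ y, E y, SmoothSectionOn F σ V ↔
    ∀ i, ContMDiffOn 𝓘(ℝ, ℂ) 𝓘(ℝ, ℂ) ∞ (fun y => coord i y (σ y)) V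

namespace SmoothFrame

variable {U : Set Y} {n : ℕ}

/-- Restriction of a frame to a smaller set. -/
def restrict (s : SmoothFrame F E U n) {V : Set Y} (h : V ⊆ U) : SmoothFrame F E V n where
  sec := s.sec
  coord := s.coord
  coord_sec y hy := s.coord_sec y (h hy)
  sum_coord y hy := s.sum_coord y (h hy)
  smooth_iff W hW := s.smooth_iff W (hW.trans h)

lemma smooth_sec (s : SmoothFrame F E U n) (hU : IsOpen U) (i : Fin n) :
    SmoothSectionOn F (s.sec i) U := by
  rw [s.smooth_iff U subset_rfl hU]
  intro j
  exact (contMDiffOn_const (c := if j = i then (1 : ℂ) else 0)).congr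
    fun y hy => s.coord_sec y hy j i

/-- The basis of the fibre given by a frame. -/
def basis (s : SmoothFrame F E U n) {y : Y} (hy : y ∈ U) : Module.Basis (Fin n) ℂ (E y) :=
  Module.Basis.ofEquivFun (LinearEquiv.ofLinearMap (LinearMap.pi fun i => s.coord i y)
    (Fintype.linearCombination ℂ fun i => s.sec i y)
    (by
      refine LinearMap.ext fun c => funext fun i => ?_
      simp [Fintype.linearCombination_apply, s.coord_sec y hy])
    (by
      refine LinearMap.ext fun v => ?_
      simpa [Fintype.linearCombination_apply] using s.sum_coord y hy v))

lemma basis_apply (s : SmoothFrame F E U n) {y : Y} (hy : y ∈ U) (i : Fin n) :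
    s.basis hy i = s.sec i y := by
  classical
  simp [basis, Module.Basis.coe_ofEquivFun, Fintype.linearCombination_apply, Pi.single_apply]

lemma basis_repr (s : SmoothFrame F E U n) {y : Y} (hy : y ∈ U) (v : E y) (i : Fin n) :
    (s.basis hy).repr v i = s.coord i y v := by
  simp [basis, Module.Basis.ofEquivFun_repr_apply]

lemma trace_eq (s : SmoothFrame F E U n) {y : Y} (hy : y ∈ U) (L : Module.End ℂ (E y)) :
    LinearMap.trace ℂ (E y) L = ∑ i, s.coord i y (L (s.sec i y)) := by
  rw [LinearMap.trace_eq_matrix_trace ℂ (s.basis hy), Matrix.trace]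
  simp [LinearMap.toMatrix_apply, basis_repr, basis_apply]

end SmoothFrame

section Existence

variable [FiniteDimensional ℂ F] [VectorBundle ℂ F E] [VectorBundle ℝ F E] [ContMDiffVectorBundle ∞ F E 𝓘(ℝ, ℂ)]

lemma contMDiffOn_iff_basis_coord {n : ℕ} (b : Module.Basis (Fin n) ℂ F) {f : Y → F} {V : Set Y} :
    ContMDiffOn 𝓘(ℝ, ℂ) 𝓘(ℝ, F) ∞ f V ↔
      ∀ i, ContMDiffOn 𝓘(ℝ, ℂ) 𝓘(ℝ, ℂ) ∞ (fun y => b.coord i (f y)) V := by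
  constructor
  · intro h i
    have : ContDiff ℝ ∞ fun w : F => b.coord i w :=
      ((LinearMap.toContinuousLinearMap (b.coord i)).restrictScalars ℝ).contDiff
    exact this.contMDiff.comp_contMDiffOn h
  · intro h
    have h1 : ∀ y ∈ V, f y = ∑ i, b.coord i (f y) • b i := fun y _ => (b.sum_repr (f y)).symm
    refine ContMDiffOn.congr (contMDiffOn_finsetSum (t := Finset.univ) fun i _ => ?_)
      fun y hy => (h1 y hy)
    have : ContDiff ℝ ∞ fun w : ℂ => w • b i :=
      ((ContinuousLinearMap.toSpanSingleton ℂ (b i)).restrictScalars ℝ).contDiff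
    exact this.contMDiff.comp_contMDiffOn (h i)

-- A complex basis of the model fibre is carried over by a trivialization. Complex linearity of the
-- trivialization makes the coordinates complex linear; the real bundle structure governs
-- smoothness.
variable (F E) in
lemma exists_smoothFrame (y₀ : Y) :
    ∃ U : Set Y, IsOpen U ∧ y₀ ∈ U ∧ Nonempty (SmoothFrame F E U (Module.finrank ℂ F)) := by
  let t := trivializationAt F E y₀
  let b := Module.finBasis ℂ F
  refine ⟨t.baseSet, t.open_baseSet, mem_baseSet_trivializationAt F E y₀, ⟨?_⟩⟩
  refine
    { sec := fun i y => t.symmₗ ℂ y (b i)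
      coord := fun i y => b.coord i ∘ₗ t.linearMapAt ℂ y
      coord_sec := fun y hy i j => ?_
      sum_coord := fun y hy s => ?_
      smooth_iff := fun V hV hVo σ => ?_ }
  · rw [LinearMap.comp_apply, t.linearMapAt_symmₗ hy]
    simp [Finsupp.single_apply, eq_comm]
  · simp only [LinearMap.comp_apply, Module.Basis.coord_apply]
    rw [← t.symmₗ_linearMapAt (R := ℂ) hy s]
    conv_rhs => rw [← b.sum_repr (t.linearMapAt ℂ y s), map_sum]
    simp only [map_smul, t.symmₗ_linearMapAt hy]
  · rw [SmoothSectionOn, t.contMDiffOn_section_iff hVo hV, contMDiffOn_iff_basis_coord b]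
    refine forall_congr' fun i => ?_
    have : ∀ y ∈ V, b.coord i (t ⟨y, σ y⟩).2 = (b.coord i ∘ₗ t.linearMapAt ℂ y) (σ y) :=
      fun y hy => by rw [LinearMap.comp_apply, t.coe_linearMapAt_of_mem (hV hy)]
    exact ⟨fun h => h.congr fun y hy => (this y hy).symm, fun h => h.congr fun y hy => this y hy⟩

variable (F)

include F

lemma finiteDimensional_fiber (y : Y) : FiniteDimensional ℂ (E y) := by
  obtain ⟨U, -, hy, ⟨s⟩⟩ := exists_smoothFrame F E y
  exact Module.Basis.finiteDimensional_of_finite (s.basis hy)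

lemma finrank_fiber (y : Y) : Module.finrank ℂ (E y) = Module.finrank ℂ F := by
  obtain ⟨U, -, hy, ⟨s⟩⟩ := exists_smoothFrame F E y
  rw [Module.finrank_eq_card_basis (s.basis hy), Fintype.card_fin]

end Existence

end Frames

/-! ## Calculus of sections -/

section Sections

variable {Y : Type*} [TopologicalSpace Y] [ChartedSpace ℂ Y]
  {F : Type*} [NormedAddCommGroup F] [NormedSpace ℂ F]
  {E : Y → Type*} [TopologicalSpace (Bundle.TotalSpace F E)]
  [∀ y, AddCommGroup (E y)] [∀ y, Module ℂ (E y)] [∀ y, TopologicalSpace (E y)]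
  [FiberBundle F E]

/-- A smooth function is differentiable. -/
lemma ContMDiffOn.mdifferentiableAt_of_isOpen {G : Type*} [NormedAddCommGroup G] [NormedSpace ℝ G]
    {f : Y → G} {U : Set Y} (hf : ContMDiffOn 𝓘(ℝ, ℂ) 𝓘(ℝ, G) ∞ f U) (hU : IsOpen U) {y : Y}
    (hy : y ∈ U) : MDifferentiableAt 𝓘(ℝ, ℂ) 𝓘(ℝ, G) f y :=
  ((hf y hy).contMDiffAt (hU.mem_nhds hy)).mdifferentiableAt (by simp)

lemma ContMDiffOn.complex_mul {f g : Y → ℂ} {U : Set Y}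
    (hf : ContMDiffOn 𝓘(ℝ, ℂ) 𝓘(ℝ, ℂ) ∞ f U) (hg : ContMDiffOn 𝓘(ℝ, ℂ) 𝓘(ℝ, ℂ) ∞ g U) :
    ContMDiffOn 𝓘(ℝ, ℂ) 𝓘(ℝ, ℂ) ∞ (fun y => f y * g y) U :=
  (contDiff_mul (𝕜 := ℝ) (𝔸 := ℂ)).contMDiff.comp_contMDiffOn (hf.prodMk_space hg)

namespace SmoothSectionOn

variable {U V : Set Y} {σ τ : ∀ y, E y}

lemma mono (h : SmoothSectionOn F σ U) (hVU : V ⊆ U) : SmoothSectionOn F σ V :=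
  ContMDiffOn.mono h hVU

lemma congr (h : SmoothSectionOn F σ U) (hst : ∀ y ∈ U, τ y = σ y) : SmoothSectionOn F τ U :=
  ContMDiffOn.congr h fun y hy => by rw [hst y hy]

lemma of_locally (h : ∀ y ∈ U, ∃ V, IsOpen V ∧ y ∈ V ∧ SmoothSectionOn F σ (U ∩ V)) :
    SmoothSectionOn F σ U :=
  contMDiffOn_of_locally_contMDiffOn fun y hy => by
    obtain ⟨V, hV, hyV, hs⟩ := h y hy
    exact ⟨V, hV, hyV, hs⟩

lemma mdifferentiableAt (h : SmoothSectionOn F σ U) (hU : IsOpen U) {y : Y} (hy : y ∈ U) :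
    MDifferentiableAt 𝓘(ℝ, ℂ) (𝓘(ℝ, ℂ).prod 𝓘(ℝ, F))
      (fun x => Bundle.TotalSpace.mk' F x (σ x)) y :=
  (ContMDiffOn.contMDiffAt h (hU.mem_nhds hy)).mdifferentiableAt (by simp)

variable [FiniteDimensional ℂ F] [VectorBundle ℂ F E] [VectorBundle ℝ F E]
  [ContMDiffVectorBundle ∞ F E 𝓘(ℝ, ℂ)]

lemma of_frames (hU : IsOpen U)
    (h : ∀ (V : Set Y), IsOpen V → V ⊆ U → ∀ s : SmoothFrame F E V (Module.finrank ℂ F),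
      ∀ i, ContMDiffOn 𝓘(ℝ, ℂ) 𝓘(ℝ, ℂ) ∞ (fun y => s.coord i y (σ y)) V) :
    SmoothSectionOn F σ U := by
  refine of_locally fun y hy => ?_
  obtain ⟨V, hV, hyV, ⟨s⟩⟩ := exists_smoothFrame F E y
  refine ⟨V, hV, hyV, ?_⟩
  let s' := s.restrict (V := U ∩ V) Set.inter_subset_right
  rw [s'.smooth_iff _ subset_rfl (hU.inter hV)]
  exact fun i => h _ (hU.inter hV) Set.inter_subset_left s' i

lemma add (hU : IsOpen U) (hσ : SmoothSectionOn F σ U) (hτ : SmoothSectionOn F τ U) :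
    SmoothSectionOn F (fun y => σ y + τ y) U := by
  refine of_frames hU fun V hV hVU s i => ?_
  simp only [map_add]
  exact ((s.smooth_iff V subset_rfl hV σ).mp (hσ.mono hVU) i).add
    ((s.smooth_iff V subset_rfl hV τ).mp (hτ.mono hVU) i)

lemma smul (hU : IsOpen U) {f : Y → ℂ} (hf : ContMDiffOn 𝓘(ℝ, ℂ) 𝓘(ℝ, ℂ) ∞ f U)
    (hσ : SmoothSectionOn F σ U) : SmoothSectionOn F (fun y => f y • σ y) U := by
  refine of_frames hU fun V hV hVU s i => ?_
  simp only [map_smul]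
  exact (hf.mono hVU).complex_mul ((s.smooth_iff V subset_rfl hV σ).mp (hσ.mono hVU) i)

lemma const_smul (hU : IsOpen U) (c : ℂ) (hσ : SmoothSectionOn F σ U) :
    SmoothSectionOn F (fun y => c • σ y) U :=
  hσ.smul hU contMDiffOn_const

lemma zero (hU : IsOpen U) : SmoothSectionOn F (fun y => (0 : E y)) U :=
  of_frames hU fun V _ _ s i => by
    simp only [map_zero]
    exact contMDiffOn_const

lemma sum {ι : Type*} (hU : IsOpen U) (t : Finset ι) {σ : ι → ∀ y, E y}
    (hσ : ∀ i ∈ t, SmoothSectionOn F (σ i) U) :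
    SmoothSectionOn F (fun y => ∑ i ∈ t, σ i y) U := by
  classical
  induction t using Finset.induction_on with
  | empty => simpa using zero hU
  | insert a t ha ih =>
    refine (add hU (hσ a (Finset.mem_insert_self a t))
      (ih fun i hi => hσ i (Finset.mem_insert_of_mem hi))).congr fun y _ => ?_
    rw [Finset.sum_insert ha]

lemma sub (hU : IsOpen U) (hσ : SmoothSectionOn F σ U) (hτ : SmoothSectionOn F τ U) :
    SmoothSectionOn F (fun y => σ y - τ y) U :=
  (add hU hσ (const_smul hU (-1) hτ)).congr fun y _ => by
    rw [neg_one_smul, sub_eq_add_neg]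

/-- Every section over an open set can be extended to a global one near a given point. -/
lemma exists_global [T2Space Y] [IsManifold 𝓘(ℂ) ω Y] (hU : IsOpen U) (hσ : SmoothSectionOn F σ U)
    {y : Y} (hy : y ∈ U) :
    ∃ (τ : ∀ y, E y) (V : Set Y), IsOpen V ∧ y ∈ V ∧ V ⊆ U ∧ SmoothSectionOn F τ Set.univ ∧
      ∀ x ∈ V, τ x = σ x := by
  obtain ⟨f, hf, -⟩ := (SmoothBumpFunction.nhds_basis_support (I := 𝓘(ℝ, ℂ))
    (hU.mem_nhds hy)).mem_iff.mp (hU.mem_nhds hy)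
  obtain ⟨V, hV1, hV, hyV⟩ := mem_nhds_iff.mp (Filter.inter_mem f.eventuallyEq_one
    (hU.mem_nhds hy))
  refine ⟨(f : Y → ℝ) • σ, V, hV, hyV, fun x hx => (hV1 hx).2, ?_, fun x hx => ?_⟩
  · exact (ContMDiffOn.smul_section_of_tsupport (n := ∞) f.contMDiff.contMDiffOn hU hf
      hσ).contMDiffOn
  · have : f x = 1 := (hV1 hx).1
    simp [this]

end SmoothSectionOn

end Sections

/-! ## Calculus of a flat connection -/

section Connection

variable {Y : Type*} [TopologicalSpace Y] [ChartedSpace ℂ Y] [IsManifold 𝓘(ℂ) ω Y]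
  {F : Type*} [NormedAddCommGroup F] [NormedSpace ℂ F]
  {E : Y → Type*} [TopologicalSpace (Bundle.TotalSpace F E)]
  [∀ y, AddCommGroup (E y)] [∀ y, Module ℂ (E y)] [∀ y, TopologicalSpace (E y)]
  [∀ y, IsTopologicalAddGroup (E y)] [∀ y, ContinuousSMul ℝ (E y)]
  [FiberBundle F E] [VectorBundle ℝ F E]

namespace CovariantDerivative

variable {nabla : CovariantDerivative 𝓘(ℝ, ℂ) F E} {U : Set Y} {σ τ : ∀ y, E y} {y : Y}

lemma apply_congr (hU : IsOpen U) (hσ : SmoothSectionOn F σ U) (h : ∀ x ∈ U, τ x = σ x)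
    (hy : y ∈ U) : nabla τ y = nabla σ y :=
  nabla.isCovariantDerivativeOnUniv.congr_of_eventuallyEq
    ((hσ.congr h).mdifferentiableAt hU hy) (hσ.mdifferentiableAt hU hy) Filter.univ_mem
    (Filter.eventually_of_mem (hU.mem_nhds hy) h)

lemma apply_add (hU : IsOpen U) (hσ : SmoothSectionOn F σ U) (hτ : SmoothSectionOn F τ U)
    (hy : y ∈ U) (v : TangentSpace 𝓘(ℝ, ℂ) y) :
    nabla (fun x => σ x + τ x) y v = nabla σ y v + nabla τ y v := by
  have := nabla.isCovariantDerivativeOnUniv.add (hσ.mdifferentiableAt hU hy)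
    (hτ.mdifferentiableAt hU hy)
  change nabla (σ + τ) y v = _
  rw [this]; rfl

variable [FiniteDimensional ℂ F] [VectorBundle ℂ F E] [ContMDiffVectorBundle ∞ F E 𝓘(ℝ, ℂ)]

/-- The connection satisfies the Leibniz rule for real functions and commutes with i, so f is split
into real and imaginary parts. -/
lemma apply_smul (hn : IsFlatConnection nabla) (hU : IsOpen U) {f : Y → ℂ}
    (hf : ContMDiffOn 𝓘(ℝ, ℂ) 𝓘(ℝ, ℂ) ∞ f U) (hσ : SmoothSectionOn F σ U) (hy : y ∈ U)
    (v : TangentSpace 𝓘(ℝ, ℂ) y) :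
    nabla (fun x => f x • σ x) y v
      = f y • nabla σ y v + mvfderiv 𝓘(ℝ, ℂ) f y v • σ y := by
  have hre : ContMDiffOn 𝓘(ℝ, ℂ) 𝓘(ℝ, ℝ) ∞ (fun x => (f x).re) U :=
    Complex.reCLM.contDiff.contMDiff.comp_contMDiffOn hf
  have him : ContMDiffOn 𝓘(ℝ, ℂ) 𝓘(ℝ, ℝ) ∞ (fun x => (f x).im) U :=
    Complex.imCLM.contDiff.contMDiff.comp_contMDiffOn hf
  have hreal : ∀ (g : Y → ℝ) (σ : ∀ y, E y), ContMDiffOn 𝓘(ℝ, ℂ) 𝓘(ℝ, ℝ) ∞ g U →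
      SmoothSectionOn F σ U → nabla (fun x => (g x : ℂ) • σ x) y v
        = (g y : ℂ) • nabla σ y v + (mvfderiv 𝓘(ℝ, ℂ) g y v : ℂ) • σ y := by
    intro g σ hg hσ
    have := nabla.isCovariantDerivativeOnUniv.leibniz (hσ.mdifferentiableAt hU hy)
      (hg.mdifferentiableAt_of_isOpen hU hy)
    have h2 : (fun x => (g x : ℂ) • σ x) = g • σ := by
      funext x; exact (Complex.coe_smul (g x) (σ x))
    rw [h2, this]
    simp [Complex.coe_smul]
  have hd : ∀ (L : ℂ →L[ℝ] ℝ), mvfderiv 𝓘(ℝ, ℂ) (fun x => L (f x)) y v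
      = L (mvfderiv 𝓘(ℝ, ℂ) f y v) := by
    intro L
    have h1 := mfderiv_comp y (I := 𝓘(ℝ, ℂ)) (I' := 𝓘(ℝ, ℂ)) (I'' := 𝓘(ℝ, ℝ)) (f := f)
      (g := L) L.differentiableAt.mdifferentiableAt (hf.mdifferentiableAt_of_isOpen hU hy)
    have h2 : mvfderiv 𝓘(ℝ, ℂ) (L ∘ f) y v = mfderiv 𝓘(ℝ, ℂ) 𝓘(ℝ, ℝ) L (f y)
      (mfderiv 𝓘(ℝ, ℂ) 𝓘(ℝ, ℂ) f y v) := by rw [mvfderiv, h1]; rfl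
    rw [mfderiv_eq_fderiv, L.fderiv] at h2
    exact h2
  have hdre : mvfderiv 𝓘(ℝ, ℂ) (fun x => (f x).re) y v = (mvfderiv 𝓘(ℝ, ℂ) f y v).re :=
    hd Complex.reCLM
  have hdim : mvfderiv 𝓘(ℝ, ℂ) (fun x => (f x).im) y v = (mvfderiv 𝓘(ℝ, ℂ) f y v).im :=
    hd Complex.imCLM
  have hIσ := hσ.const_smul hU Complex.I
  have hcre : ContMDiffOn 𝓘(ℝ, ℂ) 𝓘(ℝ, ℂ) ∞ (fun x => ((f x).re : ℂ)) U :=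
    Complex.ofRealCLM.contDiff.contMDiff.comp_contMDiffOn hre
  have hcim : ContMDiffOn 𝓘(ℝ, ℂ) 𝓘(ℝ, ℂ) ∞ (fun x => ((f x).im : ℂ)) U :=
    Complex.ofRealCLM.contDiff.contMDiff.comp_contMDiffOn him
  have hdec : (fun x => f x • σ x)
      = fun x => ((f x).re : ℂ) • σ x + ((f x).im : ℂ) • (Complex.I • σ x) := by
    funext x
    rw [smul_smul, ← add_smul, Complex.re_add_im]
  rw [hdec, apply_add hU (hσ.smul hU hcre) (hIσ.smul hU hcim) hy,
    hreal _ _ hre hσ, hreal _ _ him hIσ, hn.complex_linear U σ hU hσ y hy v,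
    hdre, hdim]
  conv_rhs => rw [← Complex.re_add_im (f y), ← Complex.re_add_im (mvfderiv 𝓘(ℝ, ℂ) f y v)]
  module

lemma apply_sum (hU : IsOpen U) {ι : Type*} (t : Finset ι) {σ : ι → ∀ y, E y}
    (hσ : ∀ i ∈ t, SmoothSectionOn F (σ i) U) (hy : y ∈ U) (v : TangentSpace 𝓘(ℝ, ℂ) y) :
    nabla (fun x => ∑ i ∈ t, σ i x) y v = ∑ i ∈ t, nabla (σ i) y v := by
  classical
  induction t using Finset.induction_on with
  | empty =>
    have : (fun x => ∑ i ∈ (∅ : Finset ι), σ i x) = 0 := by funext x; simp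
    rw [this, nabla.zero]; simp
  | insert a t ha ih =>
    have hd : (fun x => ∑ i ∈ insert a t, σ i x) = fun x => σ a x + ∑ i ∈ t, σ i x := by
      funext x; rw [Finset.sum_insert ha]
    have hσ' : ∀ i ∈ t, SmoothSectionOn F (σ i) U := fun i hi => hσ i (Finset.mem_insert_of_mem hi)
    rw [hd, apply_add hU (hσ a (Finset.mem_insert_self a t)) (SmoothSectionOn.sum hU t hσ') hy,
      ih hσ', Finset.sum_insert ha]

lemma apply_sub (hn : IsFlatConnection nabla) (hU : IsOpen U) (hσ : SmoothSectionOn F σ U)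
    (hτ : SmoothSectionOn F τ U) (hy : y ∈ U) (v : TangentSpace 𝓘(ℝ, ℂ) y) :
    nabla (fun x => σ x - τ x) y v = nabla σ y v - nabla τ y v := by
  have hd : (fun x => σ x - τ x) = fun x => σ x + (-1 : ℂ) • τ x := by
    funext x; rw [neg_one_smul, sub_eq_add_neg]
  rw [hd, apply_add hU hσ (hτ.const_smul hU (-1)) hy,
    apply_smul hn hU contMDiffOn_const hτ hy, mvfderiv_const]
  simp [sub_eq_add_neg]

/-- Smoothness of the connection is applied to global sections; a local section is first replaced
near each point by a global one, which by locality has the same covariant derivative there. -/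
lemma smooth_apply_coordVec [T2Space Y] (hn : IsFlatConnection nabla)
    {e : OpenPartialHomeomorph Y ℂ} (he : e ∈ IsManifold.maximalAtlas 𝓘(ℂ) ω Y) (hU : IsOpen U)
    (hUe : U ⊆ e.source) (hσ : SmoothSectionOn F σ U) (a : ℂ) :
    SmoothSectionOn F (fun x => nabla σ x (coordVec e a x)) U := by
  refine SmoothSectionOn.of_locally fun y hy => ?_
  obtain ⟨τ, V, hV, hyV, hVU, hτ, hτσ⟩ := hσ.exists_global hU hy
  refine ⟨V, hV, hyV, ?_⟩
  have h1 := hn.smooth.contMDiff.contMDiff (σ := τ) hτ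
  have h2 : SmoothSectionOn F (fun x => nabla τ x (coordVec e a x)) V :=
    ContMDiffOn.clm_bundle_apply (h1.mono (Set.subset_univ V))
      ((contMDiffOn_coordVec he a).mono (hVU.trans hUe))
  refine (h2.mono Set.inter_subset_right).congr fun x hx => ?_
  rw [apply_congr hV (hσ.mono hVU) hτσ hx.2]

end CovariantDerivative

end Connection

/-! ## Hermitian metrics, `Ψ`, and the endomorphism comparing two metrics -/

section Functions

variable {Y : Type*} [TopologicalSpace Y] [ChartedSpace ℂ Y]

lemma mvfderiv_clm_comp {G : Type*} [NormedAddCommGroup G] [NormedSpace ℝ G] (L : ℂ →L[ℝ] G)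
    {f : Y → ℂ} {y : Y} (hf : MDifferentiableAt 𝓘(ℝ, ℂ) 𝓘(ℝ, ℂ) f y)
    (v : TangentSpace 𝓘(ℝ, ℂ) y) :
    mvfderiv 𝓘(ℝ, ℂ) (fun x => L (f x)) y v = L (mvfderiv 𝓘(ℝ, ℂ) f y v) := by
  have h1 := mfderiv_comp y (I := 𝓘(ℝ, ℂ)) (I' := 𝓘(ℝ, ℂ)) (I'' := 𝓘(ℝ, G)) (f := f)
    (g := L) L.differentiableAt.mdifferentiableAt hf
  have h2 : mvfderiv 𝓘(ℝ, ℂ) (L ∘ f) y v = mfderiv 𝓘(ℝ, ℂ) 𝓘(ℝ, G) L (f y)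
    (mfderiv 𝓘(ℝ, ℂ) 𝓘(ℝ, ℂ) f y v) := by rw [mvfderiv, h1]; rfl
  rw [mfderiv_eq_fderiv, L.fderiv] at h2
  exact h2

lemma mvfderiv_congr_of_isOpen {G : Type*} [NormedAddCommGroup G] [NormedSpace ℝ G] {f f' : Y → G}
    {U : Set Y} (hU : IsOpen U) (h : ∀ x ∈ U, f x = f' x) {y : Y} (hy : y ∈ U) :
    mvfderiv 𝓘(ℝ, ℂ) f y = mvfderiv 𝓘(ℝ, ℂ) f' y := by
  have h1 : f =ᶠ[𝓝 y] f' := Filter.eventually_of_mem (hU.mem_nhds hy) h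
  ext v
  have := congrArg (fun L => L v) (h1.mfderiv_eq (I := 𝓘(ℝ, ℂ)) (I' := 𝓘(ℝ, G)))
  exact this

lemma mvfderiv_sum {ι : Type*} (t : Finset ι) {f : ι → Y → ℂ} {y : Y}
    (hf : ∀ i ∈ t, MDifferentiableAt 𝓘(ℝ, ℂ) 𝓘(ℝ, ℂ) (f i) y) :
    MDifferentiableAt 𝓘(ℝ, ℂ) 𝓘(ℝ, ℂ) (fun x => ∑ i ∈ t, f i x) y ∧
    ∀ v : TangentSpace 𝓘(ℝ, ℂ) y, mvfderiv 𝓘(ℝ, ℂ) (fun x => ∑ i ∈ t, f i x) y v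
      = ∑ i ∈ t, mvfderiv 𝓘(ℝ, ℂ) (f i) y v := by
  classical
  induction t using Finset.induction_on with
  | empty =>
    refine ⟨by simpa using mdifferentiableAt_const, fun v => ?_⟩
    simp only [Finset.sum_empty, mvfderiv_const]
    rfl
  | insert a t ha ih =>
    obtain ⟨h1, h2⟩ := ih fun i hi => hf i (Finset.mem_insert_of_mem hi)
    have ha' := hf a (Finset.mem_insert_self a t)
    have hd : (fun x => ∑ i ∈ insert a t, f i x) = f a + fun x => ∑ i ∈ t, f i x := by
      funext x; simp [Finset.sum_insert ha]
    refine ⟨by rw [hd]; exact ha'.add h1, fun v => ?_⟩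
    rw [hd, mvfderiv_add ha' h1, Finset.sum_insert ha, ← h2 v]
    rfl

lemma contMDiffOn_det {n : ℕ} {A : Y → Matrix (Fin n) (Fin n) ℂ} {U : Set Y}
    (hA : ∀ i j, ContMDiffOn 𝓘(ℝ, ℂ) 𝓘(ℝ, ℂ) ∞ (fun y => A y i j) U) :
    ContMDiffOn 𝓘(ℝ, ℂ) 𝓘(ℝ, ℂ) ∞ (fun y => (A y).det) U := by
  have hprod : ∀ (t : Finset (Fin n)) (f : Fin n → Y → ℂ),
      (∀ i, ContMDiffOn 𝓘(ℝ, ℂ) 𝓘(ℝ, ℂ) ∞ (f i) U) →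
      ContMDiffOn 𝓘(ℝ, ℂ) 𝓘(ℝ, ℂ) ∞ (fun y => ∏ i ∈ t, f i y) U := by
    intro t f hf
    induction t using Finset.induction_on with
    | empty => simpa using contMDiffOn_const
    | insert a t ha ih =>
      simp only [Finset.prod_insert ha]
      exact (hf a).complex_mul ih
  simp only [Matrix.det_apply']
  exact contMDiffOn_finsetSum fun τ _ => contMDiffOn_const.complex_mul
    (hprod _ (fun i y => A y (τ i) i) fun i => hA _ _)

lemma ContMDiffOn.complex_inv {f : Y → ℂ} {U : Set Y} (hf : ContMDiffOn 𝓘(ℝ, ℂ) 𝓘(ℝ, ℂ) ∞ f U)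
    (h0 : ∀ y ∈ U, f y ≠ 0) : ContMDiffOn 𝓘(ℝ, ℂ) 𝓘(ℝ, ℂ) ∞ (fun y => (f y)⁻¹) U :=
  fun y hy => (contDiffAt_inv ℝ (h0 y hy)).contMDiffAt.comp_contMDiffWithinAt y (hf y hy)

end Functions

/-! ### Smooth endomorphism fields, the transition endomorphism and traces. -/

section Metrics

variable {Y : Type*} [TopologicalSpace Y] [ChartedSpace ℂ Y] [IsManifold 𝓘(ℂ) ω Y]
  {F : Type*} [NormedAddCommGroup F] [NormedSpace ℂ F]
  {E : Y → Type*} [TopologicalSpace (Bundle.TotalSpace F E)]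
  [∀ y, AddCommGroup (E y)] [∀ y, Module ℂ (E y)] [∀ y, TopologicalSpace (E y)]
  [∀ y, IsTopologicalAddGroup (E y)] [∀ y, ContinuousSMul ℝ (E y)]
  [FiberBundle F E] [VectorBundle ℝ F E]

lemma HermitianMetric.isInnerForm (H : HermitianMetric F E) (y : Y) : IsInnerForm (H.inner y) :=
  ⟨H.conj_symm y, H.pos y⟩

variable (F) in
/-- A field of endomorphisms which maps smooth sections to smooth sections. -/
def IsSmoothEnd (B : ∀ y, Module.End ℂ (E y)) (U : Set Y) : Prop :=
  ∀ V ⊆ U, IsOpen V → ∀ σ : ∀ y, E y, SmoothSectionOn F σ V →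
    SmoothSectionOn F (fun y => B y (σ y)) V

lemma IsSmoothEnd.mono {B : ∀ y, Module.End ℂ (E y)} {U V : Set Y} (h : IsSmoothEnd F B U)
    (hVU : V ⊆ U) : IsSmoothEnd F B V :=
  fun W hW => h W (hW.trans hVU)

lemma IsSmoothEnd.mul {A B : ∀ y, Module.End ℂ (E y)} {U : Set Y} (hA : IsSmoothEnd F A U)
    (hB : IsSmoothEnd F B U) : IsSmoothEnd F (fun y => A y * B y) U :=
  fun V hV hVo σ hσ => hA V hV hVo _ (hB V hV hVo σ hσ)

variable [FiniteDimensional ℂ F] [VectorBundle ℂ F E] [ContMDiffVectorBundle ∞ F E 𝓘(ℝ, ℂ)]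

lemma IsSmoothEnd.sub {A B : ∀ y, Module.End ℂ (E y)} {U : Set Y} (hA : IsSmoothEnd F A U)
    (hB : IsSmoothEnd F B U) : IsSmoothEnd F (fun y => A y - B y) U :=
  fun V hV hVo σ hσ => (hA V hV hVo σ hσ).sub hVo (hB V hV hVo σ hσ)

variable (F) in
lemma exists_smoothSection_eq {y : Y} (s : E y) :
    ∃ (U : Set Y) (σ : ∀ y, E y), IsOpen U ∧ y ∈ U ∧ SmoothSectionOn F σ U ∧ σ y = s := by
  obtain ⟨U, hU, hy, ⟨f⟩⟩ := exists_smoothFrame F E y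
  exact ⟨U, fun x => ∑ i, f.coord i y s • f.sec i x, hU, hy,
    SmoothSectionOn.sum hU _ fun i _ => (f.smooth_sec hU i).const_smul hU _, f.sum_coord y hy s⟩

/-- A section whose products with all smooth sections are smooth is smooth. -/
lemma HermitianMetric.smoothSection_of_inner (H : HermitianMetric F E) {U : Set Y} (hU : IsOpen U)
    {ξ : ∀ y, E y} (h : ∀ V ⊆ U, IsOpen V → ∀ τ : ∀ y, E y, SmoothSectionOn F τ V →
      ContMDiffOn 𝓘(ℝ, ℂ) 𝓘(ℝ, ℂ) ∞ (fun y => H.inner y (ξ y) (τ y)) V) :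
    SmoothSectionOn F ξ U := by
  refine SmoothSectionOn.of_frames hU fun V hV hVU s i => ?_
  set A : Y → Matrix (Fin (Module.finrank ℂ F)) (Fin (Module.finrank ℂ F)) ℂ :=
    fun y => Matrix.of fun j i => H.inner y (s.sec i y) (s.sec j y) with hA
  set p : Y → Fin (Module.finrank ℂ F) → ℂ := fun y j => H.inner y (ξ y) (s.sec j y) with hp
  have hAs : ∀ i j, ContMDiffOn 𝓘(ℝ, ℂ) 𝓘(ℝ, ℂ) ∞ (fun y => A y i j) V := fun i j =>
    H.smooth V _ _ hV (s.smooth_sec hV j) (s.smooth_sec hV i)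
  have hps : ∀ j, ContMDiffOn 𝓘(ℝ, ℂ) 𝓘(ℝ, ℂ) ∞ (fun y => p y j) V := fun j =>
    h V hVU hV _ (s.smooth_sec hV j)
  have hmul : ∀ (y : Y) (c : Fin (Module.finrank ℂ F) → ℂ) j,
      (A y).mulVec c j = H.inner y (∑ i, c i • s.sec i y) (s.sec j y) := by
    intro y c j
    rw [map_sum, LinearMap.sum_apply]
    change ∑ i, A y j i * c i = _
    exact Finset.sum_congr rfl fun i _ => by
      rw [map_smul, LinearMap.smul_apply, smul_eq_mul, mul_comm]; rfl
  have hdet : ∀ y ∈ V, (A y).det ≠ 0 := by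
    intro y hy h0
    obtain ⟨c, hc, hc0⟩ := Matrix.exists_mulVec_eq_zero_iff.mpr h0
    have hz : ∑ i, c i • s.sec i y = 0 := by
      refine (H.isInnerForm y).eq_of_forall fun t => ?_
      rw [← s.sum_coord y hy t]
      rw [map_sum (H.inner y (∑ i, c i • s.sec i y)), map_zero, LinearMap.zero_apply]
      exact Finset.sum_eq_zero fun j _ => by
        rw [LinearMap.map_smulₛₗ, ← hmul, hc0, Pi.zero_apply, smul_zero]
    apply hc
    funext j
    have := congrArg (s.coord j y) hz
    simpa [s.coord_sec y hy] using this
  -- Cramer's rule for the Gram system: the coordinates of ξ are rational functions of the smooth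
  -- products of ξ and of the frame vectors with the frame.
  have hcoord : ∀ y ∈ V, s.coord i y (ξ y) = (A y).det⁻¹ * ((A y).updateCol i (p y)).det := by
    intro y hy
    have h1 : (A y).mulVec (fun i => s.coord i y (ξ y)) = p y := by
      funext j
      rw [hmul, s.sum_coord y hy]
    have h2 : (A y).det • (fun i => s.coord i y (ξ y)) = Matrix.cramer (A y) (p y) := by
      rw [← h1, Matrix.cramer_eq_adjugate_mulVec, Matrix.mulVec_mulVec, Matrix.adjugate_mul,
        Matrix.smul_mulVec, Matrix.one_mulVec]
    have h3 := congrFun h2 i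
    rw [Matrix.cramer_apply] at h3
    rw [← h3, Pi.smul_apply, smul_eq_mul, inv_mul_cancel_left₀ (hdet y hy)]
  refine ContMDiffOn.congr (((contMDiffOn_det hAs).complex_inv hdet).complex_mul
    (contMDiffOn_det fun j k => ?_)) hcoord
  by_cases hk : k = i
  · subst hk
    simpa using hps j
  · simpa [Matrix.updateCol_ne hk] using hAs j k

section Transition

variable (H₁ H₂ : HermitianMetric F E)

/-- The endomorphism `h` with `⟨h s, t⟩₁ = ⟨s, t⟩₂`. -/
def HermitianMetric.transition (y : Y) : Module.End ℂ (E y) :=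
  haveI := finiteDimensional_fiber F (E := E) y
  ((H₁.isInnerForm y).exists_transition (H₂.inner y)).choose

lemma HermitianMetric.inner_transition (y : Y) (s t : E y) :
    H₁.inner y (H₁.transition H₂ y s) t = H₂.inner y s t :=
  haveI := finiteDimensional_fiber F (E := E) y
  ((H₁.isInnerForm y).exists_transition (H₂.inner y)).choose_spec s t

lemma HermitianMetric.isSmoothEnd_transition : IsSmoothEnd F (H₁.transition H₂) Set.univ := by
  intro V _ hV σ hσ
  refine H₁.smoothSection_of_inner hV fun W hW hWo τ hτ => ?_
  simp only [H₁.inner_transition]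
  exact H₂.smooth W σ τ hWo (hσ.mono hW) hτ

end Transition

variable {nabla : CovariantDerivative 𝓘(ℝ, ℂ) F E} {H H₁ H₂ : HermitianMetric F E}
  {Ψ Ψ₁ Ψ₂ : ∀ y, TangentSpace 𝓘(ℝ, ℂ) y → E y →ₗ[ℂ] E y}

lemma metricVariation_conj {U : Set Y} (hU : IsOpen U) {σ τ : ∀ y, E y}
    (hσ : SmoothSectionOn F σ U) (hτ : SmoothSectionOn F τ U) {y : Y} (hy : y ∈ U)
    (v : TangentSpace 𝓘(ℝ, ℂ) y) :
    metricVariation nabla H σ τ y v = (starRingEnd ℂ) (metricVariation nabla H τ σ y v) := by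
  have h1 := mvfderiv_clm_comp (Complex.conjCLE : ℂ →L[ℝ] ℂ)
    ((H.smooth U τ σ hU hτ hσ).mdifferentiableAt_of_isOpen hU hy) v
  have h2 : (fun x => (Complex.conjCLE : ℂ →L[ℝ] ℂ) (H.inner x (τ x) (σ x)))
      = fun x => H.inner x (σ x) (τ x) := by
    funext x; exact (H.conj_symm x _ _).symm
  rw [h2] at h1
  simp only [metricVariation, map_mul, map_sub, h1, ← H.conj_symm]
  simp only [ContinuousLinearEquiv.coe_coe, Complex.conjCLE_apply, map_div₀, map_one, map_ofNat]
  ring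

/-- The metric variation is hermitian in (σ, τ), and every vector of a fibre is the value of a local
smooth section. -/
lemma IsPsi.isSelfAdjoint (hΨ : IsPsi nabla H Ψ) {y : Y} (v : TangentSpace 𝓘(ℝ, ℂ) y)
    (s t : E y) : H.inner y (Ψ y v s) t = H.inner y s (Ψ y v t) := by
  obtain ⟨U, σ, hU, hyU, hσ, rfl⟩ := exists_smoothSection_eq F s
  obtain ⟨V, τ, hV, hyV, hτ, rfl⟩ := exists_smoothSection_eq F t
  have hσ' := hσ.mono (Set.inter_subset_left (t := V))
  have hτ' := hτ.mono (Set.inter_subset_right (s := U))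
  rw [hΨ _ σ τ (hU.inter hV) hσ' hτ' y ⟨hyU, hyV⟩ v, H.conj_symm,
    hΨ _ τ σ (hU.inter hV) hτ' hσ' y ⟨hyU, hyV⟩ v,
    metricVariation_conj (hU.inter hV) hσ' hτ' ⟨hyU, hyV⟩]

/-- Ψ is prescribed only pointwise through its products with smooth sections; since these products
are smooth, Ψ maps smooth sections to smooth sections. -/
lemma IsPsi.isSmoothEnd [T2Space Y] (hn : IsFlatConnection nabla) (hΨ : IsPsi nabla H Ψ)
    {e : OpenPartialHomeomorph Y ℂ} (he : e ∈ IsManifold.maximalAtlas 𝓘(ℂ) ω Y) (a : ℂ) :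
    IsSmoothEnd F (fun y => Ψ y (coordVec e a y)) e.source := by
  intro V hVe hV σ hσ
  refine H.smoothSection_of_inner hV fun W hW hWo τ hτ => ?_
  have hσ' := hσ.mono hW
  refine ContMDiffOn.congr ?_ fun y hy => hΨ W σ τ hWo hσ' hτ y hy (coordVec e a y)
  have hWe := hW.trans hVe
  simp only [metricVariation]
  refine contMDiffOn_const.complex_mul (((contMDiffOn_mvfderiv_coordVec he hWo hWe
    (H.smooth W σ τ hWo hσ' hτ) a).sub
    (H.smooth W _ τ hWo (CovariantDerivative.smooth_apply_coordVec hn he hWo hWe hσ' a) hτ)).sub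
    (H.smooth W σ _ hWo hσ' (CovariantDerivative.smooth_apply_coordVec hn he hWo hWe hτ a)))

/-- The covariant derivative of the transition endomorphism is `2 (h Ψ₂ - Ψ₁ h)`. -/
lemma nabla_transition (hΨ₁ : IsPsi nabla H₁ Ψ₁) (hΨ₂ : IsPsi nabla H₂ Ψ₂) {U : Set Y}
    (hU : IsOpen U) {σ : ∀ y, E y} (hσ : SmoothSectionOn F σ U) {y : Y} (hy : y ∈ U)
    (v : TangentSpace 𝓘(ℝ, ℂ) y) :
    nabla (fun x => H₁.transition H₂ x (σ x)) y v - H₁.transition H₂ y (nabla σ y v)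
      = (2 : ℂ) • (H₁.transition H₂ y (Ψ₂ y v (σ y)) - Ψ₁ y v (H₁.transition H₂ y (σ y))) := by
  refine (H₁.isInnerForm y).eq_of_forall fun t => ?_
  obtain ⟨V, τ, hV, hyV, hτ, rfl⟩ := exists_smoothSection_eq F t
  have hσ' := hσ.mono (Set.inter_subset_left (t := V))
  have hτ' := hτ.mono (Set.inter_subset_right (s := U))
  -- The defining identity of Ψ₁ is applied to (hσ, τ) and that of Ψ₂ to (σ, τ). The differentiated
  -- function H₁(hσ, τ) = H₂(σ, τ) and the term with ∇τ are common to both and cancel.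
  have hhσ := H₁.isSmoothEnd_transition H₂ _ (Set.subset_univ _) (hU.inter hV) σ hσ'
  have h1 := hΨ₁ _ _ τ (hU.inter hV) hhσ hτ' y ⟨hy, hyV⟩ v
  have h2 := hΨ₂ _ σ τ (hU.inter hV) hσ' hτ' y ⟨hy, hyV⟩ v
  simp only [LinearMap.map_sub₂, map_smul, LinearMap.smul_apply, H₁.inner_transition, h1, h2,
    metricVariation, smul_eq_mul]
  ring

section Trace

variable {B : ∀ y, Module.End ℂ (E y)} {U : Set Y} {n : ℕ}

lemma IsSmoothEnd.contMDiffOn_trace_frame (hB : IsSmoothEnd F B U) (hU : IsOpen U)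
    (s : SmoothFrame F E U n) :
    ContMDiffOn 𝓘(ℝ, ℂ) 𝓘(ℝ, ℂ) ∞ (fun y => LinearMap.trace ℂ (E y) (B y)) U := by
  refine ContMDiffOn.congr (contMDiffOn_finsetSum (t := Finset.univ) fun i _ => ?_)
    fun y hy => s.trace_eq hy (B y)
  exact (s.smooth_iff U subset_rfl hU _).mp (hB U subset_rfl hU _ (s.smooth_sec hU i)) i

lemma IsSmoothEnd.contMDiffOn_trace (hB : IsSmoothEnd F B U) (hU : IsOpen U) :
    ContMDiffOn 𝓘(ℝ, ℂ) 𝓘(ℝ, ℂ) ∞ (fun y => LinearMap.trace ℂ (E y) (B y)) U := by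
  refine contMDiffOn_of_locally_contMDiffOn fun y hy => ?_
  obtain ⟨V, hV, hyV, ⟨s⟩⟩ := exists_smoothFrame F E y
  exact ⟨V, hV, hyV, (hB.mono Set.inter_subset_left).contMDiffOn_trace_frame (hU.inter hV)
    (s.restrict Set.inter_subset_right)⟩

/-- The derivative of the trace of an endomorphism field is the trace of its covariant
derivative. -/
lemma IsSmoothEnd.mvfderiv_trace (hB : IsSmoothEnd F B U) (hn : IsFlatConnection nabla)
    (hU : IsOpen U) (s : SmoothFrame F E U n) {y : Y} (hy : y ∈ U)
    (v : TangentSpace 𝓘(ℝ, ℂ) y) :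
    mvfderiv 𝓘(ℝ, ℂ) (fun x => LinearMap.trace ℂ (E x) (B x)) y v
      = ∑ i, s.coord i y
          (nabla (fun x => B x (s.sec i x)) y v - B y (nabla (s.sec i) y v)) := by
  set c : Fin n → Fin n → Y → ℂ := fun i j x => s.coord i x (B x (s.sec j x)) with hc
  have hcs : ∀ i j, ContMDiffOn 𝓘(ℝ, ℂ) 𝓘(ℝ, ℂ) ∞ (c i j) U := fun i j =>
    (s.smooth_iff U subset_rfl hU _).mp (hB U subset_rfl hU _ (s.smooth_sec hU j)) i
  have h1 : mvfderiv 𝓘(ℝ, ℂ) (fun x => LinearMap.trace ℂ (E x) (B x)) y v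
      = ∑ j, mvfderiv 𝓘(ℝ, ℂ) (c j j) y v := by
    rw [mvfderiv_congr_of_isOpen hU (fun x hx => s.trace_eq hx (B x)) hy]
    exact (mvfderiv_sum Finset.univ (f := fun j => c j j)
      fun j _ => (hcs j j).mdifferentiableAt_of_isOpen hU hy).2 v
  have h2 : ∀ j, nabla (fun x => B x (s.sec j x)) y v
      = ∑ i, (c i j y • nabla (s.sec i) y v + mvfderiv 𝓘(ℝ, ℂ) (c i j) y v • s.sec i y) := by
    intro j
    have hs : ∀ i ∈ Finset.univ, SmoothSectionOn F (fun x => c i j x • s.sec i x) U :=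
      fun i _ => (s.smooth_sec hU i).smul hU (hcs i j)
    rw [CovariantDerivative.apply_congr hU (SmoothSectionOn.sum hU Finset.univ hs)
      (fun x hx => (s.sum_coord x hx _).symm) hy,
      CovariantDerivative.apply_sum hU Finset.univ hs hy v]
    exact Finset.sum_congr rfl fun i _ =>
      CovariantDerivative.apply_smul hn hU (hcs i j) (s.smooth_sec hU i) hy v
  have h3 : ∀ j, s.coord j y (B y (nabla (s.sec j) y v))
      = ∑ k, s.coord k y (nabla (s.sec j) y v) * c j k y := by
    intro j
    conv_lhs => rw [← s.sum_coord y hy (nabla (s.sec j) y v)]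
    simp only [map_sum, map_smul, smul_eq_mul, hc]
  have h4 : ∀ j, s.coord j y (nabla (fun x => B x (s.sec j x)) y v)
      = ∑ i, c i j y * s.coord j y (nabla (s.sec i) y v) + mvfderiv 𝓘(ℝ, ℂ) (c j j) y v := by
    intro j
    rw [h2, map_sum]
    simp only [map_add, map_smul, smul_eq_mul, s.coord_sec y hy, Finset.sum_add_distrib]
    simp
  rw [h1]
  simp only [map_sub, h3, h4, Finset.sum_sub_distrib, Finset.sum_add_distrib]
  -- The terms containing the connection matrix form the trace of a commutator with the matrix of B,
  -- which is zero.
  have h5 : ∑ j, ∑ i, c i j y * s.coord j y (nabla (s.sec i) y v)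
      = ∑ j, ∑ k, s.coord k y (nabla (s.sec j) y v) * c j k y := by
    rw [Finset.sum_comm]
    exact Finset.sum_congr rfl fun i _ => Finset.sum_congr rfl fun j _ => mul_comm _ _
  rw [h5]
  ring

end Trace

end Metrics

/-! ## The Laplacian of the trace of the transition endomorphism of two Poisson metrics -/

lemma secondDirDeriv_log {φ : ℂ → ℝ} {z : ℂ} (hφ : ContDiffAt ℝ 2 φ z) (hpos : 0 < φ z) (a : ℂ) :
    secondDirDeriv (fun w => Real.log (φ w)) a z
      = secondDirDeriv φ a z / φ z - (fderiv ℝ φ z a) ^ 2 / φ z ^ 2 := by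
  have hev : (fun w => fderiv ℝ (fun w => Real.log (φ w)) w a)
      =ᶠ[𝓝 z] fun w => (φ w)⁻¹ * fderiv ℝ φ w a := by
    filter_upwards [hφ.eventually_differentiableAt,
      hφ.continuousAt.eventually (lt_mem_nhds hpos)] with w h1 h2
    rw [(h1.hasFDerivAt.log h2.ne').fderiv]
    simp
  have hd := (hφ.differentiableAt (by norm_num)).hasFDerivAt
  have hinv : HasFDerivAt (fun w => (φ w)⁻¹) (-((φ z ^ 2)⁻¹ • fderiv ℝ φ z)) z := by
    have := (hasDerivAt_inv hpos.ne').comp_hasFDerivAt z hd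
    simpa [neg_smul, Function.comp_def] using! this
  unfold secondDirDeriv
  rw [hev.fderiv_eq, (hinv.fun_mul (hφ.differentiableAt_fderiv_apply a).hasFDerivAt).fderiv]
  simp only [add_apply, smul_apply, neg_apply, smul_eq_mul]
  field_simp
  ring

section Surface

variable {Y : Type*} [TopologicalSpace Y] [ChartedSpace ℂ Y] [IsManifold 𝓘(ℂ) ω Y]

lemma confFactor_pos (g : SurfaceMetric Y) {e : OpenPartialHomeomorph Y ℂ}
    (he : e ∈ IsManifold.maximalAtlas 𝓘(ℂ) ω Y) {y : Y} (hy : y ∈ e.source) :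
    0 < confFactor g e y := by
  refine g.pos y _ fun h0 => ?_
  have h1 := mvfderiv_coordVec_self he hy 1
  rw [h0, map_zero] at h1
  exact zero_ne_one h1

variable {F : Type*} [NormedAddCommGroup F] [NormedSpace ℂ F]
  {E : Y → Type*} [TopologicalSpace (Bundle.TotalSpace F E)]
  [∀ y, AddCommGroup (E y)] [∀ y, Module ℂ (E y)] [∀ y, TopologicalSpace (E y)]
  [∀ y, IsTopologicalAddGroup (E y)] [∀ y, ContinuousSMul ℝ (E y)]
  [FiberBundle F E] [VectorBundle ℝ F E]
  [FiniteDimensional ℂ F] [VectorBundle ℂ F E] [ContMDiffVectorBundle ∞ F E 𝓘(ℝ, ℂ)]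
  {nabla : CovariantDerivative 𝓘(ℝ, ℂ) F E} {H₁ H₂ : HermitianMetric F E}
  {Ψ Ψ₁ Ψ₂ : ∀ y, TangentSpace 𝓘(ℝ, ℂ) y → E y →ₗ[ℂ] E y}
  {g : SurfaceMetric Y} {c c₁ c₂ : ℝ} {e : OpenPartialHomeomorph Y ℂ}

lemma IsCurvatureK.sum_nabla (hK : IsCurvatureK g nabla Ψ (fun _ => (c : ℂ) • LinearMap.id))
    (he : e ∈ IsManifold.maximalAtlas 𝓘(ℂ) ω Y) {U : Set Y} (hU : IsOpen U) (hUe : U ⊆ e.source)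
    {σ : ∀ y, E y} (hσ : SmoothSectionOn F σ U) {y : Y} (hy : y ∈ U) :
    ∑ a ∈ ({1, Complex.I} : Finset ℂ),
      (nabla (fun x => Ψ x (coordVec e a x) (σ x)) y (coordVec e a y)
        - Ψ y (coordVec e a y) (nabla σ y (coordVec e a y)))
      = ((-2 * confFactor g e y * c : ℝ) : ℂ) • σ y := by
  have h1 := hK e he U σ hU hUe hσ y hy
  have h2 := (confFactor_pos g he (hUe hy)).ne'
  set T := ∑ a ∈ ({1, Complex.I} : Finset ℂ),
      (nabla (fun x => Ψ x (coordVec e a x) (σ x)) y (coordVec e a y)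
        - Ψ y (coordVec e a y) (nabla σ y (coordVec e a y)))
  have h3 : ((-2 * confFactor g e y : ℝ) : ℂ) • ((c : ℂ) • σ y)
      = ((-2 * confFactor g e y : ℝ) : ℂ) •
        (((-1 / 2 * (confFactor g e y)⁻¹ : ℝ) : ℂ) • T) := congrArg _ h1
  rw [smul_smul, smul_smul, ← Complex.ofReal_mul, ← Complex.ofReal_mul] at h3
  rw [h3, show -2 * confFactor g e y * (-1 / 2 * (confFactor g e y)⁻¹) = 1 by field_simp,
    Complex.ofReal_one, one_smul]

variable (H₁ H₂) in
/-- The trace of the transition endomorphism, as a real function. -/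
def transitionTrace (y : Y) : ℝ := (LinearMap.trace ℂ (E y) (H₁.transition H₂ y)).re

variable (H₁ H₂ Ψ₁ Ψ₂) in
/-- Half the covariant derivative of the transition endomorphism. -/
def transitionVar (y : Y) (v : TangentSpace 𝓘(ℝ, ℂ) y) : Module.End ℂ (E y) :=
  H₁.transition H₂ y * Ψ₂ y v - Ψ₁ y v * H₁.transition H₂ y

lemma contMDiff_transitionTrace :
    ContMDiffOn 𝓘(ℝ, ℂ) 𝓘(ℝ, ℝ) ∞ (transitionTrace H₁ H₂) Set.univ :=
  Complex.reCLM.contDiff.contMDiff.comp_contMDiffOn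
    ((H₁.isSmoothEnd_transition H₂).contMDiffOn_trace isOpen_univ)

lemma transitionTrace_pos (hF : 0 < Module.finrank ℂ F) (y : Y) : 0 < transitionTrace H₁ H₂ y := by
  have := finiteDimensional_fiber F (E := E) y
  have : Nontrivial (E y) :=
    Module.nontrivial_of_finrank_pos (R := ℂ) (by rwa [finrank_fiber F y])
  exact (H₁.isInnerForm y).trace_transition_pos (H₂.isInnerForm y) (H₁.inner_transition H₂ y)

lemma mvfderiv_transitionTrace (hn : IsFlatConnection nabla) (hΨ₁ : IsPsi nabla H₁ Ψ₁)
    (hΨ₂ : IsPsi nabla H₂ Ψ₂) (y : Y) (v : TangentSpace 𝓘(ℝ, ℂ) y) :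
    mvfderiv 𝓘(ℝ, ℂ) (transitionTrace H₁ H₂) y v
      = 2 * (LinearMap.trace ℂ (E y) (transitionVar H₁ H₂ Ψ₁ Ψ₂ y v)).re := by
  obtain ⟨U, hU, hy, ⟨s⟩⟩ := exists_smoothFrame F E y
  have hs := (H₁.isSmoothEnd_transition H₂).mono (Set.subset_univ U)
  have h1 := mvfderiv_clm_comp Complex.reCLM
    ((hs.contMDiffOn_trace hU).mdifferentiableAt_of_isOpen hU hy) v
  refine h1.trans ?_
  rw [hs.mvfderiv_trace hn hU s hy]
  simp only [nabla_transition hΨ₁ hΨ₂ hU (s.smooth_sec hU _) hy v, map_smul, smul_eq_mul,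
    ← Finset.mul_sum]
  rw [s.trace_eq hy]
  simp [transitionVar]

variable [T2Space Y]

lemma IsPsi.isSmoothEnd_transitionVar (hn : IsFlatConnection nabla) (hΨ₁ : IsPsi nabla H₁ Ψ₁)
    (hΨ₂ : IsPsi nabla H₂ Ψ₂) (he : e ∈ IsManifold.maximalAtlas 𝓘(ℂ) ω Y) (a : ℂ) :
    IsSmoothEnd F (fun y => transitionVar H₁ H₂ Ψ₁ Ψ₂ y (coordVec e a y)) e.source :=
  (((H₁.isSmoothEnd_transition H₂).mono (Set.subset_univ _)).mul (hΨ₂.isSmoothEnd hn he a)).sub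
    ((hΨ₁.isSmoothEnd hn he a).mul ((H₁.isSmoothEnd_transition H₂).mono (Set.subset_univ _)))

/-- The divergence of `h Ψ₂ - Ψ₁ h`. -/
lemma sum_mvfderiv_trace_transitionVar (hn : IsFlatConnection nabla) (hΨ₁ : IsPsi nabla H₁ Ψ₁)
    (hΨ₂ : IsPsi nabla H₂ Ψ₂) (hK₁ : IsCurvatureK g nabla Ψ₁ (fun _ => (c₁ : ℂ) • LinearMap.id))
    (hK₂ : IsCurvatureK g nabla Ψ₂ (fun _ => (c₂ : ℂ) • LinearMap.id))
    (he : e ∈ IsManifold.maximalAtlas 𝓘(ℂ) ω Y) {y : Y} (hy : y ∈ e.source) :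
    ∑ a ∈ ({1, Complex.I} : Finset ℂ), mvfderiv 𝓘(ℝ, ℂ) (fun x => LinearMap.trace ℂ (E x)
        (transitionVar H₁ H₂ Ψ₁ Ψ₂ x (coordVec e a x))) y (coordVec e a y)
      = ((2 * confFactor g e y * (c₁ - c₂) : ℝ) : ℂ)
          * LinearMap.trace ℂ (E y) (H₁.transition H₂ y)
        + 2 * ∑ a ∈ ({1, Complex.I} : Finset ℂ), LinearMap.trace ℂ (E y)
          (transitionVar H₁ H₂ Ψ₁ Ψ₂ y (coordVec e a y) * Ψ₂ y (coordVec e a y)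
            - Ψ₁ y (coordVec e a y) * transitionVar H₁ H₂ Ψ₁ Ψ₂ y (coordVec e a y)) := by
  obtain ⟨U₀, hU₀, hy₀, ⟨s₀⟩⟩ := exists_smoothFrame F E y
  set U := e.source ∩ U₀ with hUdef
  have hU : IsOpen U := e.open_source.inter hU₀
  have hUe : U ⊆ e.source := Set.inter_subset_left
  have hyU : y ∈ U := ⟨hy, hy₀⟩
  set s := s₀.restrict (V := U) Set.inter_subset_right
  set h := H₁.transition H₂ with hh
  have hhs : IsSmoothEnd F h U := (H₁.isSmoothEnd_transition H₂).mono (Set.subset_univ _)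
  -- The Leibniz rule for D = hΨ₂ - Ψ₁h: differentiating Ψ₂ and Ψ₁ gives the first two terms, and
  -- each derivative of h contributes a factor 2D, from the right of Ψ₁ and the left of Ψ₂.
  have hkey : ∀ (σ : ∀ y, E y), SmoothSectionOn F σ U → ∀ a : ℂ,
      nabla (fun x => transitionVar H₁ H₂ Ψ₁ Ψ₂ x (coordVec e a x) (σ x)) y (coordVec e a y)
        - transitionVar H₁ H₂ Ψ₁ Ψ₂ y (coordVec e a y) (nabla σ y (coordVec e a y))
      = h y (nabla (fun x => Ψ₂ x (coordVec e a x) (σ x)) y (coordVec e a y)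
          - Ψ₂ y (coordVec e a y) (nabla σ y (coordVec e a y)))
        - (nabla (fun x => Ψ₁ x (coordVec e a x) (h x (σ x))) y (coordVec e a y)
          - Ψ₁ y (coordVec e a y) (nabla (fun x => h x (σ x)) y (coordVec e a y)))
        + (2 : ℂ) • ((transitionVar H₁ H₂ Ψ₁ Ψ₂ y (coordVec e a y) * Ψ₂ y (coordVec e a y)
            - Ψ₁ y (coordVec e a y) * transitionVar H₁ H₂ Ψ₁ Ψ₂ y (coordVec e a y)) (σ y)) := by
    intro σ hσ a
    have hσ₂ : SmoothSectionOn F (fun x => Ψ₂ x (coordVec e a x) (σ x)) U :=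
      hΨ₂.isSmoothEnd hn he a U hUe hU σ hσ
    have hhσ : SmoothSectionOn F (fun x => h x (σ x)) U := hhs U subset_rfl hU σ hσ
    have h1 := nabla_transition hΨ₁ hΨ₂ hU hσ₂ hyU (coordVec e a y)
    have h2 := nabla_transition hΨ₁ hΨ₂ hU hσ hyU (coordVec e a y)
    have h3 : nabla (fun x => transitionVar H₁ H₂ Ψ₁ Ψ₂ x (coordVec e a x) (σ x)) y
          (coordVec e a y)
        = nabla (fun x => h x (Ψ₂ x (coordVec e a x) (σ x))) y (coordVec e a y)
          - nabla (fun x => Ψ₁ x (coordVec e a x) (h x (σ x))) y (coordVec e a y) :=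
      CovariantDerivative.apply_sub hn hU (hhs U subset_rfl hU _ hσ₂)
        (hΨ₁.isSmoothEnd hn he a U hUe hU _ hhσ) hyU _
    rw [← hh] at h1 h2
    rw [h3, sub_eq_iff_eq_add.mp h1, sub_eq_iff_eq_add.mp h2]
    simp only [transitionVar, ← hh, LinearMap.sub_apply, Module.End.mul_apply, map_sub, map_add,
      map_smul]
    module
  have htr : ∀ a : ℂ, mvfderiv 𝓘(ℝ, ℂ) (fun x => LinearMap.trace ℂ (E x)
        (transitionVar H₁ H₂ Ψ₁ Ψ₂ x (coordVec e a x))) y (coordVec e a y)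
      = ∑ i, s.coord i y (nabla (fun x => transitionVar H₁ H₂ Ψ₁ Ψ₂ x (coordVec e a x)
          (s.sec i x)) y (coordVec e a y)
        - transitionVar H₁ H₂ Ψ₁ Ψ₂ y (coordVec e a y) (nabla (s.sec i) y (coordVec e a y))) :=
    fun a => ((hΨ₁.isSmoothEnd_transitionVar hn hΨ₂ he a).mono hUe).mvfderiv_trace hn hU s hyU _
  simp only [htr]
  rw [Finset.sum_comm]
  simp only [s.trace_eq hyU]
  rw [Finset.sum_comm (s := ({1, Complex.I} : Finset ℂ)), Finset.mul_sum, Finset.mul_sum,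
    ← Finset.sum_add_distrib]
  refine Finset.sum_congr rfl fun i _ => ?_
  have hi := s.smooth_sec hU i
  -- Each Poisson equation controls only the sum over the two coordinate directions. That of Ψ₂ is
  -- used on the frame section and then hit by h, that of Ψ₁ on its image under h; both yield
  -- multiples of h applied to the section.
  have e1 := hK₂.sum_nabla he hU hUe hi hyU
  have e2 := hK₁.sum_nabla he hU hUe (hhs U subset_rfl hU _ hi) hyU
  rw [← map_sum, Finset.sum_congr rfl fun a _ => hkey _ hi a, Finset.sum_add_distrib,
    Finset.sum_sub_distrib, ← map_sum, e1, e2, ← Finset.smul_sum, map_add, map_sub]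
  simp only [map_smul, map_sum, smul_eq_mul]
  push_cast
  ring

lemma fderiv_transitionTrace (hn : IsFlatConnection nabla) (hΨ₁ : IsPsi nabla H₁ Ψ₁)
    (hΨ₂ : IsPsi nabla H₂ Ψ₂) (he : e ∈ IsManifold.maximalAtlas 𝓘(ℂ) ω Y) {y : Y}
    (hy : y ∈ e.source) (a : ℂ) :
    fderiv ℝ (fun w => transitionTrace H₁ H₂ (e.symm w)) (e y) a
      = 2 * (LinearMap.trace ℂ (E y) (transitionVar H₁ H₂ Ψ₁ Ψ₂ y (coordVec e a y))).re := by
  rw [← mvfderiv_coordVec he hy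
    (contMDiff_transitionTrace.mdifferentiableAt_of_isOpen isOpen_univ trivial)]
  exact mvfderiv_transitionTrace hn hΨ₁ hΨ₂ y _

lemma contDiffAt_transitionTrace (he : e ∈ IsManifold.maximalAtlas 𝓘(ℂ) ω Y) {z : ℂ}
    (hz : z ∈ e.target) :
    ContDiffAt ℝ 2 (fun w => transitionTrace H₁ H₂ (e.symm w)) z := by
  have h1 : ContDiffOn ℝ ∞ (fun w => transitionTrace H₁ H₂ (e.symm w)) e.target := by
    rw [← contMDiffOn_iff_contDiffOn]
    exact contMDiff_transitionTrace.comp (contMDiffOn_symm_of_mem_complexAtlas he)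
      fun w _ => trivial
  exact (h1.contDiffAt (e.open_target.mem_nhds hz)).of_le (WithTop.coe_le_coe.mpr le_top)

/-- The first derivatives of tr h are 2 Re tr D_a, so the Laplacian is twice the real part of the
divergence of tr D. The conformal factor enters only through the Poisson equations. -/
lemma planeLap_transitionTrace (hn : IsFlatConnection nabla) (hΨ₁ : IsPsi nabla H₁ Ψ₁)
    (hΨ₂ : IsPsi nabla H₂ Ψ₂) (hK₁ : IsCurvatureK g nabla Ψ₁ (fun _ => (c₁ : ℂ) • LinearMap.id))
    (hK₂ : IsCurvatureK g nabla Ψ₂ (fun _ => (c₂ : ℂ) • LinearMap.id))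
    (he : e ∈ IsManifold.maximalAtlas 𝓘(ℂ) ω Y) {y : Y} (hy : y ∈ e.source) :
    planeLap (fun w => transitionTrace H₁ H₂ (e.symm w)) (e y)
      = 4 * confFactor g e y * (c₁ - c₂) * transitionTrace H₁ H₂ y
        + 4 * ∑ a ∈ ({1, Complex.I} : Finset ℂ), (LinearMap.trace ℂ (E y)
          (transitionVar H₁ H₂ Ψ₁ Ψ₂ y (coordVec e a y) * Ψ₂ y (coordVec e a y)
            - Ψ₁ y (coordVec e a y) * transitionVar H₁ H₂ Ψ₁ Ψ₂ y (coordVec e a y))).re := by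
  have h2 : ∀ a : ℂ, secondDirDeriv (fun w => transitionTrace H₁ H₂ (e.symm w)) a (e y)
      = 2 * (mvfderiv 𝓘(ℝ, ℂ) (fun x => LinearMap.trace ℂ (E x)
        (transitionVar H₁ H₂ Ψ₁ Ψ₂ x (coordVec e a x))) y (coordVec e a y)).re := by
    intro a
    have hs := (hΨ₁.isSmoothEnd_transitionVar hn hΨ₂ he a).contMDiffOn_trace e.open_source
    have hd := hs.mdifferentiableAt_of_isOpen e.open_source hy
    have hs' : ContMDiffOn 𝓘(ℝ, ℂ) 𝓘(ℝ, ℝ) ∞ (fun x => (2 • Complex.reCLM)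
        (LinearMap.trace ℂ (E x) (transitionVar H₁ H₂ Ψ₁ Ψ₂ x (coordVec e a x)))) e.source :=
      (2 • Complex.reCLM).contDiff.contMDiff.comp_contMDiffOn hs
    have h3 := mvfderiv_clm_comp (2 • Complex.reCLM) hd (coordVec e a y)
    rw [mvfderiv_coordVec he hy (hs'.mdifferentiableAt_of_isOpen e.open_source hy)] at h3
    unfold secondDirDeriv
    have hev : (fun w => fderiv ℝ (fun w => transitionTrace H₁ H₂ (e.symm w)) w a)
        =ᶠ[𝓝 (e y)] fun w => (2 • Complex.reCLM) (LinearMap.trace ℂ (E (e.symm w))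
          (transitionVar H₁ H₂ Ψ₁ Ψ₂ (e.symm w) (coordVec e a (e.symm w)))) := by
      filter_upwards [e.open_target.mem_nhds (e.map_source hy)] with w hw
      have := fderiv_transitionTrace hn hΨ₁ hΨ₂ he (e.map_target hw) a
      rw [e.right_inv hw] at this
      rw [this]
      simp
    rw [hev.fderiv_eq, h3]
    simp
  have hne : (1 : ℂ) ∉ ({Complex.I} : Finset ℂ) := by
    simp [Complex.ext_iff]
  have h4 := congrArg Complex.re (sum_mvfderiv_trace_transitionVar hn hΨ₁ hΨ₂ hK₁ hK₂ he hy)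
  rw [planeLap, h2, h2]
  simp only [Finset.sum_insert hne, Finset.sum_singleton, Complex.add_re, Complex.re_ofReal_mul,
    show ∀ w : ℂ, (2 * w).re = 2 * w.re from fun w => by simp] at h4 ⊢
  rw [transitionTrace]
  linear_combination 2 * h4

/-- The logarithm of the trace is subharmonic, if `c₂ ≤ c₁`. -/
theorem planeLap_log_transitionTrace_nonneg (hF : 0 < Module.finrank ℂ F)
    (hn : IsFlatConnection nabla) (hΨ₁ : IsPsi nabla H₁ Ψ₁)
    (hΨ₂ : IsPsi nabla H₂ Ψ₂) (hK₁ : IsCurvatureK g nabla Ψ₁ (fun _ => (c₁ : ℂ) • LinearMap.id))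
    (hK₂ : IsCurvatureK g nabla Ψ₂ (fun _ => (c₂ : ℂ) • LinearMap.id)) (hc : c₂ ≤ c₁)
    (he : e ∈ IsManifold.maximalAtlas 𝓘(ℂ) ω Y) {y : Y} (hy : y ∈ e.source) :
    0 ≤ planeLap (fun w => Real.log (transitionTrace H₁ H₂ (e.symm w))) (e y) := by
  have := finiteDimensional_fiber F (E := E) y
  have hw := transitionTrace_pos (H₁ := H₁) (H₂ := H₂) hF y
  -- This Cauchy-Schwarz bound lets the energy absorb the negative term |∇w|² / w² produced by the
  -- logarithm.
  have hQ : ∀ a : ℂ, (LinearMap.trace ℂ (E y) (transitionVar H₁ H₂ Ψ₁ Ψ₂ y (coordVec e a y))).re ^ 2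
      ≤ (LinearMap.trace ℂ (E y)
          (transitionVar H₁ H₂ Ψ₁ Ψ₂ y (coordVec e a y) * Ψ₂ y (coordVec e a y)
            - Ψ₁ y (coordVec e a y) * transitionVar H₁ H₂ Ψ₁ Ψ₂ y (coordVec e a y))).re
          * transitionTrace H₁ H₂ y := by
    intro a
    obtain ⟨Q, -, -, hQ, hQ2⟩ := (H₁.isInnerForm y).exists_energy (H₂.isInnerForm y)
      (H₁.inner_transition H₂ y) (hΨ₁.isSelfAdjoint (coordVec e a y))
      (hΨ₂.isSelfAdjoint (coordVec e a y))
    simp only [transitionVar, hQ, Complex.ofReal_re]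
    exact hQ2
  have hlap := planeLap_transitionTrace hn hΨ₁ hΨ₂ hK₁ hK₂ he hy
  have hcd := contDiffAt_transitionTrace (H₁ := H₁) (H₂ := H₂) he (e.map_source hy)
  have hpos : 0 < transitionTrace H₁ H₂ (e.symm (e y)) := by rwa [e.left_inv hy]
  have hne : (1 : ℂ) ∉ ({Complex.I} : Finset ℂ) := by
    simp [Complex.ext_iff]
  rw [planeLap, secondDirDeriv_log hcd hpos, secondDirDeriv_log hcd hpos,
    fderiv_transitionTrace hn hΨ₁ hΨ₂ he hy, fderiv_transitionTrace hn hΨ₁ hΨ₂ he hy,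
    e.left_inv hy]
  rw [planeLap, Finset.sum_insert hne, Finset.sum_singleton] at hlap
  have h1 := hQ 1
  have h2 := hQ Complex.I
  have hρ := confFactor_pos g he hy
  have h3 : 0 ≤ 4 * confFactor g e y * (c₁ - c₂) * transitionTrace H₁ H₂ y ^ 2 := by
    have := sub_nonneg.mpr hc
    positivity
  set w := transitionTrace H₁ H₂ y
  set A := secondDirDeriv (fun w => transitionTrace H₁ H₂ (e.symm w)) 1 (e y)
  set B := secondDirDeriv (fun w => transitionTrace H₁ H₂ (e.symm w)) Complex.I (e y)
  set p := (LinearMap.trace ℂ (E y) (transitionVar H₁ H₂ Ψ₁ Ψ₂ y (coordVec e 1 y))).re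
  set q := (LinearMap.trace ℂ (E y) (transitionVar H₁ H₂ Ψ₁ Ψ₂ y (coordVec e Complex.I y))).re
  have h4 : A / w - (2 * p) ^ 2 / w ^ 2 + (B / w - (2 * q) ^ 2 / w ^ 2)
      = ((A + B) * w - 4 * (p ^ 2 + q ^ 2)) / w ^ 2 := by
    field_simp
    ring
  rw [h4, hlap]
  refine div_nonneg ?_ (by positivity)
  nlinarith

/-- If the trace is constant near a point then `Ψ₁ = Ψ₂` there. -/
theorem psi_eq_of_transitionTrace_const (hF : 0 < Module.finrank ℂ F)
    (hn : IsFlatConnection nabla) (hΨ₁ : IsPsi nabla H₁ Ψ₁)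
    (hΨ₂ : IsPsi nabla H₂ Ψ₂) (hK₁ : IsCurvatureK g nabla Ψ₁ (fun _ => (c₁ : ℂ) • LinearMap.id))
    (hK₂ : IsCurvatureK g nabla Ψ₂ (fun _ => (c₂ : ℂ) • LinearMap.id)) (hc : c₂ ≤ c₁)
    (hconst : ∀ x y, transitionTrace H₁ H₂ x = transitionTrace H₁ H₂ y)
    (he : e ∈ IsManifold.maximalAtlas 𝓘(ℂ) ω Y) {y : Y} (hy : y ∈ e.source) {a : ℂ}
    (ha : a ∈ ({1, Complex.I} : Finset ℂ)) :
    Ψ₁ y (coordVec e a y) = Ψ₂ y (coordVec e a y) := by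
  have := finiteDimensional_fiber F (E := E) y
  have hw := transitionTrace_pos (H₁ := H₁) (H₂ := H₂) hF y
  have hlap := planeLap_transitionTrace hn hΨ₁ hΨ₂ hK₁ hK₂ he hy
  have hzero : planeLap (fun w => transitionTrace H₁ H₂ (e.symm w)) (e y) = 0 := by
    have : (fun w => transitionTrace H₁ H₂ (e.symm w)) = fun _ => transitionTrace H₁ H₂ y :=
      funext fun w => hconst _ _
    rw [this]
    simp [planeLap, secondDirDeriv]
  have hex : ∀ a : ℂ, _ := fun a => (H₁.isInnerForm y).exists_energy (H₂.isInnerForm y)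
      (H₁.inner_transition H₂ y) (hΨ₁.isSelfAdjoint (coordVec e a y))
      (hΨ₂.isSelfAdjoint (coordVec e a y))
  choose Q hQ0 hQ1 hQ2 _ using hex
  simp only [transitionVar, hQ2, Complex.ofReal_re] at hlap
  have hρ := confFactor_pos g he hy
  have h3 : 0 ≤ 4 * confFactor g e y * (c₁ - c₂) * transitionTrace H₁ H₂ y := by
    have := sub_nonneg.mpr hc
    positivity
  -- The Laplacian of a constant is a sum of two non-negative terms, so the energy term vanishes.
  have hs : ∑ a ∈ ({1, Complex.I} : Finset ℂ), Q a = 0 := by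
    have := Finset.sum_nonneg fun a (_ : a ∈ ({1, Complex.I} : Finset ℂ)) => hQ0 a
    linarith
  exact hQ1 a ((Finset.sum_eq_zero_iff_of_nonneg fun a _ => hQ0 a).mp hs a ha)

end Surface

/-! ## Growth of the transition endomorphism at the punctures -/

lemma IsInnerForm.norm_le {V : Type*} [AddCommGroup V] [Module ℂ V]
    {B : V →ₗ[ℂ] V →ₗ⋆[ℂ] ℂ} (hB : IsInnerForm B) (s t : V) :
    ‖B s t‖ ≤ √(B s s).re * √(B t t).re := by
  let : NormedAddCommGroup V := @InnerProductSpace.Core.toNormedAddCommGroup ℂ V _ _ _ hB.core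
  let : InnerProductSpace ℂ V := InnerProductSpace.ofCore hB.core.toCore
  have h1 := norm_inner_le_norm (𝕜 := ℂ) t s
  rw [mul_comm, @norm_eq_sqrt_re_inner ℂ V _ _ _ t, @norm_eq_sqrt_re_inner ℂ V _ _ _ s] at h1
  exact h1

/-- Exponential bounds for a solution of the differential inequality `|f'| ≤ k f`. -/
lemma exp_bounds_of_abs_deriv_le {f f' : ℝ → ℝ} {k s : ℝ} (hs : s ≤ 0)
    (hf : ∀ x ∈ Set.Icc s 0, HasDerivAt f (f' x) x)
    (hk : ∀ x ∈ Set.Icc s 0, |f' x| ≤ k * f x) :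
    f s ≤ Real.exp (-k * s) * f 0 ∧ f 0 ≤ Real.exp (-k * s) * f s := by
  have hd : ∀ c x : ℝ, x ∈ Set.Icc s 0 → HasDerivAt (fun x => f x * Real.exp (c * x))
      ((f' x + c * f x) * Real.exp (c * x)) x := by
    intro c x hx
    have h1 : HasDerivAt (fun x : ℝ => Real.exp (c * x)) (Real.exp (c * x) * c) x := by
      simpa using ((hasDerivAt_id x).const_mul c).exp
    exact ((hf x hx).mul h1).congr_deriv (by ring)
  have hI : ∀ x ∈ interior (Set.Icc s 0), x ∈ Set.Icc s 0 := fun x hx => interior_subset hx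
  have h0 : (0 : ℝ) ∈ Set.Icc s 0 := ⟨hs, le_rfl⟩
  have hs' : s ∈ Set.Icc s 0 := ⟨le_rfl, hs⟩
  have hexp : Real.exp (-k * s) * Real.exp (k * s) = 1 := by
    rw [← Real.exp_add]; simp
  constructor
  · have hm := monotoneOn_of_deriv_nonneg (convex_Icc s 0)
      (fun x hx => (hd k x hx).continuousAt.continuousWithinAt)
      (fun x hx => (hd k x (hI x hx)).differentiableAt.differentiableWithinAt)
      (fun x hx => by
        rw [(hd k x (hI x hx)).deriv]
        have := (abs_le.mp (hk x (hI x hx))).1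
        exact mul_nonneg (by linarith) (Real.exp_pos _).le)
    have h1 := hm hs' h0 hs
    simp only [mul_zero, Real.exp_zero, mul_one] at h1
    calc f s = Real.exp (-k * s) * (f s * Real.exp (k * s)) := by
          linear_combination -(f s) * hexp
      _ ≤ _ := mul_le_mul_of_nonneg_left h1 (Real.exp_pos _).le
  · have hm := antitoneOn_of_deriv_nonpos (convex_Icc s 0)
      (fun x hx => (hd (-k) x hx).continuousAt.continuousWithinAt)
      (fun x hx => (hd (-k) x (hI x hx)).differentiableAt.differentiableWithinAt)
      (fun x hx => by
        rw [(hd (-k) x (hI x hx)).deriv]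
        have := (abs_le.mp (hk x (hI x hx))).2
        exact mul_nonpos_of_nonpos_of_nonneg (by linarith) (Real.exp_pos _).le)
    have h1 := hm hs' h0 hs
    simp only [mul_zero, Real.exp_zero, mul_one] at h1
    rwa [mul_comm]

section

variable {Y : Type*} [TopologicalSpace Y] [ChartedSpace ℂ Y]

/-- The charts of an open subset are restrictions of charts of Y, and the groupoid of analytic maps
is closed under restriction. -/
lemma subtypeRestr_mem_complexAtlas {e : OpenPartialHomeomorph Y ℂ} [IsManifold 𝓘(ℂ) ω Y]
    (he : e ∈ IsManifold.maximalAtlas 𝓘(ℂ) ω Y) {s : TopologicalSpace.Opens Y} (hs : Nonempty s) :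
    e.subtypeRestr hs ∈ IsManifold.maximalAtlas 𝓘(ℂ) ω s := by
  have key : ∀ f f' : OpenPartialHomeomorph Y ℂ, f ∈ IsManifold.maximalAtlas 𝓘(ℂ) ω Y →
      f' ∈ IsManifold.maximalAtlas 𝓘(ℂ) ω Y →
      (f.subtypeRestr hs).symm.trans (f'.subtypeRestr hs) ∈ contDiffGroupoid ω 𝓘(ℂ) :=
    fun f f' hf hf' => StructureGroupoid.mem_of_eqOnSource _
      (closedUnderRestriction' (IsManifold.compatible_of_mem_maximalAtlas hf hf')
        (f.isOpen_inter_preimage_symm s.2)) (f.subtypeRestr_symm_trans_subtypeRestr hs f')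
  intro e' he'
  obtain ⟨x, rfl⟩ := TopologicalSpace.Opens.chart_eq hs he'
  have hx := IsManifold.chart_mem_maximalAtlas (I := 𝓘(ℂ)) (n := ω) (x : Y)
  exact ⟨key _ _ he hx, key _ _ hx he⟩

end

/-! ### Coordinates and weighted sections at a puncture. -/

section Puncture

variable {X : Type*} [TopologicalSpace X] [T2Space X] [ChartedSpace ℂ X] [IsManifold 𝓘(ℂ) ω X]
  {P : Finset X} {p : X}

namespace PunctureCoord

variable (z : PunctureCoord P p)

/-- The coordinate of a puncture as a chart of the punctured surface. -/
def puncturedChart : OpenPartialHomeomorph (punctured P) ℂ :=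
  z.chart.subtypeRestr ⟨z.basePoint⟩

lemma puncturedChart_mem : z.puncturedChart ∈ IsManifold.maximalAtlas 𝓘(ℂ) ω (punctured P) :=
  subtypeRestr_mem_complexAtlas z.mem_maximalAtlas _

lemma puncturedChart_apply (x : punctured P) : z.puncturedChart x = z.coord x := rfl

lemma mem_puncturedChart_source {x : punctured P} :
    x ∈ z.puncturedChart.source ↔ (x : X) ∈ z.chart.source := by
  rw [puncturedChart, OpenPartialHomeomorph.subtypeRestr_source]; rfl

/-- The disc contains no puncture other than its centre, so a nonzero coordinate of norm below the
radius comes from a point that was not removed. -/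
lemma mem_puncturedChart_target {w : ℂ} (hw : w ≠ 0) (hR : ‖w‖ < z.radius) :
    w ∈ z.puncturedChart.target := by
  have ht : w ∈ z.chart.target := z.ball_subset (by rwa [mem_ball_zero_iff])
  have hr := z.chart.right_inv ht
  have hP : z.chart.symm w ∉ P := fun hP => by
    have hp := z.isolated _ hP (z.chart.map_target ht) (by rwa [hr])
    rw [hp, z.map_center] at hr
    exact hw hr.symm
  have := z.chart.map_subtype_source (s := punctured P) ⟨z.basePoint⟩ (x := ⟨_, hP⟩)
    (z.chart.map_target ht)
  rwa [hr] at this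

lemma disc_eq : z.disc = z.puncturedChart.source ∩ z.puncturedChart ⁻¹' Metric.ball 0 z.radius := by
  ext x
  simp only [disc, Set.mem_ofPred_eq, Set.mem_inter_iff, mem_puncturedChart_source,
    Set.mem_preimage, mem_ball_zero_iff, puncturedChart_apply]

lemma isOpen_disc : IsOpen z.disc := by
  rw [disc_eq]
  exact z.puncturedChart.isOpen_inter_preimage Metric.isOpen_ball

lemma disc_subset : z.disc ⊆ z.puncturedChart.source := by
  rw [disc_eq]
  exact Set.inter_subset_left

lemma coord_symm {w : ℂ} (hw : w ≠ 0) (hR : ‖w‖ < z.radius) :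
    z.coord (z.puncturedChart.symm w) = w :=
  z.puncturedChart.right_inv (z.mem_puncturedChart_target hw hR)

lemma symm_mem_disc {w : ℂ} (hw : w ≠ 0) (hR : ‖w‖ < z.radius) :
    z.puncturedChart.symm w ∈ z.disc := by
  rw [disc_eq]
  refine ⟨z.puncturedChart.map_target (z.mem_puncturedChart_target hw hR), ?_⟩
  rw [Set.mem_preimage, puncturedChart_apply, z.coord_symm hw hR]
  rwa [mem_ball_zero_iff]

lemma coord_ne_zero (hp : p ∈ P) {x : punctured P} (hx : (x : X) ∈ z.chart.source) :
    z.coord x ≠ 0 := by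
  intro h0
  have := z.chart.injOn hx z.mem_source (by rw [z.map_center]; exact h0)
  exact x.2 (by rw [this]; exact hp)

lemma coe_symm {w : ℂ} (hw : w ≠ 0) (hR : ‖w‖ < z.radius) :
    (z.puncturedChart.symm w : X) = z.chart.symm w :=
  z.chart.subtypeRestr_symm_apply _ (z.mem_puncturedChart_target hw hR)

/-- Continuity of the inverse chart at 0 translates "near the puncture" into "on a small punctured
disc". -/
lemma eventually_symm {Q : punctured P → Prop} (h : ∀ᶠ x in nearPuncture P p, Q x) :
    ∃ r : ℝ, 0 < r ∧ r < z.radius ∧ ∀ w : ℂ, w ≠ 0 → ‖w‖ < r → Q (z.puncturedChart.symm w) := by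
  rw [nearPuncture, Filter.eventually_comap] at h
  have h0 : (0 : ℂ) ∈ z.chart.target := by
    rw [← z.map_center]; exact z.chart.map_source z.mem_source
  have hp : z.chart.symm 0 = p := by
    rw [← z.map_center]; exact z.chart.left_inv z.mem_source
  have hc := z.chart.continuousAt_symm h0
  rw [ContinuousAt, hp] at hc
  obtain ⟨r, hr, hball⟩ := Metric.eventually_nhds_iff.mp (hc.eventually h)
  have hR := z.radius_pos
  refine ⟨min r (z.radius / 2), by positivity, by
    exact (min_le_right _ _).trans_lt (by linarith), fun w hw hwr => ?_⟩
  have h1 : ‖w‖ < z.radius := by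
    have := hwr.trans_le (min_le_right _ _)
    linarith
  exact hball (by simpa using hwr.trans_le (min_le_left _ _)) _ (z.coe_symm hw h1)

/-- For a = z(x) the vector is r ∂_r, with dr/r equal to 1 and dθ equal to 0. This is the direction
in which condition (D) is evaluated. -/
lemma dlog_coordVec {x : punctured P} (hx : x ∈ z.puncturedChart.source) (a : ℂ) :
    z.dlog x (coordVec z.puncturedChart a x) = a / z.coord x := by
  rw [dlog, show z.coord = z.puncturedChart from rfl, mvfderiv_coordVec_self z.puncturedChart_mem hx]

/-- A smooth function of the coordinate, and its derivative in the direction of a coordinate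
vector. -/
lemma mvfderiv_comp_coord {φ : ℂ → ℂ} {x : punctured P} (hx : x ∈ z.puncturedChart.source)
    (hφ : DifferentiableAt ℝ φ (z.coord x)) (a : ℂ) :
    mvfderiv 𝓘(ℝ, ℂ) (fun x => φ (z.coord x)) x (coordVec z.puncturedChart a x)
      = fderiv ℝ φ (z.coord x) a := by
  have hm : MDifferentiableAt 𝓘(ℝ, ℂ) 𝓘(ℝ, ℂ) (fun x => φ (z.coord x)) x :=
    MDifferentiableAt.comp x hφ.mdifferentiableAt
      ((contMDiffOn_of_mem_complexAtlas z.puncturedChart_mem).mdifferentiableAt_of_isOpen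
        z.puncturedChart.open_source hx)
  rw [mvfderiv_coordVec z.puncturedChart_mem hx hm]
  have : (fun w => φ (z.coord (z.puncturedChart.symm w))) =ᶠ[𝓝 (z.puncturedChart x)] φ := by
    filter_upwards [z.puncturedChart.open_target.mem_nhds (z.puncturedChart.map_source hx)]
      with w hw
    exact congrArg φ (z.puncturedChart.right_inv hw)
  rw [this.fderiv_eq]
  rfl

end PunctureCoord

/-- `|z|^w`, as a complex valued function. -/
def normPow (w : ℝ) (ζ : ℂ) : ℂ := ((Real.exp (w * Real.log ‖ζ‖) : ℝ) : ℂ)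

lemma normPow_ne_zero (w : ℝ) (ζ : ℂ) : normPow w ζ ≠ 0 :=
  Complex.ofReal_ne_zero.mpr (Real.exp_pos _).ne'

lemma contDiffAt_normPow (w : ℝ) {ζ : ℂ} (hζ : ζ ≠ 0) : ContDiffAt ℝ ∞ (normPow w) ζ := by
  have h1 : ContDiffAt ℝ ∞ (fun ζ : ℂ => Real.exp (w * Real.log ‖ζ‖)) ζ :=
    (contDiffAt_const.mul ((contDiffAt_norm ℝ hζ).log (norm_ne_zero_iff.mpr hζ))).exp
  exact Complex.ofRealCLM.contDiff.contDiffAt.comp ζ h1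

/-- Euler's identity for a function homogeneous of degree w, obtained by differentiating along t ↦
e^t ζ. -/
lemma fderiv_normPow_self (w : ℝ) {ζ : ℂ} (hζ : ζ ≠ 0) :
    fderiv ℝ (normPow w) ζ ζ = w * normPow w ζ := by
  have h1 : HasDerivAt (fun t : ℝ => normPow w (Real.exp t • ζ)) (fderiv ℝ (normPow w) ζ ζ) 0 := by
    have h2 : HasDerivAt (fun t : ℝ => Real.exp t • ζ) ζ 0 := by
      simpa using (Real.hasDerivAt_exp 0).smul_const ζ
    have h3 : HasFDerivAt (normPow w) (fderiv ℝ (normPow w) ζ) (Real.exp 0 • ζ) := by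
      rw [Real.exp_zero, one_smul]
      exact ((contDiffAt_normPow w hζ).differentiableAt (by simp)).hasFDerivAt
    exact h3.comp_hasDerivAt (0 : ℝ) h2
  have h4 : (fun t : ℝ => normPow w (Real.exp t • ζ))
      = fun t : ℝ => ((Real.exp (w * (t + Real.log ‖ζ‖)) : ℝ) : ℂ) := by
    funext t
    rw [normPow, norm_smul, Real.norm_of_nonneg (Real.exp_pos t).le,
      Real.log_mul (Real.exp_pos t).ne' (norm_ne_zero_iff.mpr hζ), Real.log_exp]
  have h5 : HasDerivAt (fun t : ℝ => ((Real.exp (w * (t + Real.log ‖ζ‖)) : ℝ) : ℂ))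
      ((Real.exp (w * (0 + Real.log ‖ζ‖)) * (w * 1) : ℝ) : ℂ) 0 :=
    ((((hasDerivAt_id (0 : ℝ)).add_const _).const_mul w).exp).ofReal_comp
  rw [h4] at h1
  rw [h1.unique h5, normPow, zero_add]
  push_cast
  ring

variable {F : Type*} [NormedAddCommGroup F] [NormedSpace ℂ F]
  {E : punctured P → Type*} [TopologicalSpace (Bundle.TotalSpace F E)]
  [∀ y, AddCommGroup (E y)] [∀ y, Module ℂ (E y)] [∀ y, TopologicalSpace (E y)]
  [∀ y, IsTopologicalAddGroup (E y)] [∀ y, ContinuousSMul ℝ (E y)]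
  [FiberBundle F E] [VectorBundle ℝ F E]
  {nabla : CovariantDerivative 𝓘(ℝ, ℂ) F E}

namespace TemporalFraming

variable {z : PunctureCoord P p} (T : TemporalFraming nabla z)

/-- The section with coefficients `c |z|^w` in the temporal framing. -/
def weightedSection (w : Fin T.blocks → ℝ) (c : ∀ l, Fin (T.size l) → ℂ) (x : punctured P) : E x :=
  ∑ l, ∑ i, (c l i * normPow (w l) (z.coord x)) • T.frame l i x

lemma exists_weightedSection_eq (w : Fin T.blocks → ℝ) {x : punctured P} (hx : x ∈ z.disc)
    (s : E x) : ∃ c, T.weightedSection w c x = s := by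
  have hs : s ∈ Submodule.span ℂ
      (Set.range fun j : Σ l, Fin (T.size l) => T.frame j.1 j.2 x) := by
    rw [T.span_eq_top x hx]; trivial
  obtain ⟨a, ha⟩ := (Submodule.mem_span_range_iff_exists_fun ℂ).mp hs
  refine ⟨fun l i => a ⟨l, i⟩ * (normPow (w l) (z.coord x))⁻¹, ?_⟩
  rw [← ha, weightedSection, Fintype.sum_sigma]
  refine Finset.sum_congr rfl fun l _ => Finset.sum_congr rfl fun i _ => ?_
  rw [inv_mul_cancel_right₀ (normPow_ne_zero _ _)]

variable [FiniteDimensional ℂ F] [VectorBundle ℂ F E] [ContMDiffVectorBundle ∞ F E 𝓘(ℝ, ℂ)]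

lemma contMDiffOn_normPow_coord (hp : p ∈ P) (w : ℝ) (c : ℂ) :
    ContMDiffOn 𝓘(ℝ, ℂ) 𝓘(ℝ, ℂ) ∞ (fun x => c * normPow w (z.coord x)) z.disc := by
  refine contMDiffOn_const.complex_mul fun x hx => ?_
  exact (contDiffAt_normPow w (z.coord_ne_zero hp hx.1)).contMDiffAt.comp_contMDiffWithinAt x
    (((contMDiffOn_of_mem_complexAtlas z.puncturedChart_mem).mono z.disc_subset) x hx)

lemma smooth_weightedSection (hp : p ∈ P) (w : Fin T.blocks → ℝ) (c : ∀ l, Fin (T.size l) → ℂ) :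
    SmoothSectionOn F (T.weightedSection w c) z.disc :=
  SmoothSectionOn.sum z.isOpen_disc _ fun l _ => SmoothSectionOn.sum z.isOpen_disc _ fun i _ =>
    (T.smooth l i).smul z.isOpen_disc (contMDiffOn_normPow_coord hp _ _)

/-- The radial derivative of a weighted section. -/
lemma nabla_weightedSection (hn : IsFlatConnection nabla) (hp : p ∈ P) (w : Fin T.blocks → ℝ)
    (c : ∀ l, Fin (T.size l) → ℂ) {x : punctured P} (hx : x ∈ z.disc) :
    nabla (T.weightedSection w c) x (coordVec z.puncturedChart (z.coord x) x)
      = ∑ l, (w l : ℂ) • ∑ i, (c l i * normPow (w l) (z.coord x)) • T.frame l i x := by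
  have h0 := z.coord_ne_zero hp hx.1
  have hs : ∀ l i, SmoothSectionOn F
      (fun x => (c l i * normPow (w l) (z.coord x)) • T.frame l i x) z.disc := fun l i =>
    (T.smooth l i).smul z.isOpen_disc (contMDiffOn_normPow_coord hp _ _)
  have h1 : nabla (T.weightedSection w c) x (coordVec z.puncturedChart (z.coord x) x)
      = ∑ l, ∑ i, nabla (fun x => (c l i * normPow (w l) (z.coord x)) • T.frame l i x) x
        (coordVec z.puncturedChart (z.coord x) x) := by
    rw [show T.weightedSection w c = fun x => ∑ l, ∑ i,
      (c l i * normPow (w l) (z.coord x)) • T.frame l i x from rfl,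
      CovariantDerivative.apply_sum z.isOpen_disc Finset.univ (fun l _ =>
      SmoothSectionOn.sum z.isOpen_disc Finset.univ fun i _ => hs l i) hx]
    exact Finset.sum_congr rfl fun l _ =>
      CovariantDerivative.apply_sum z.isOpen_disc Finset.univ (fun i _ => hs l i) hx _
  rw [h1]
  refine Finset.sum_congr rfl fun l _ => ?_
  rw [Finset.smul_sum]
  refine Finset.sum_congr rfl fun i _ => ?_
  have hd := (contDiffAt_normPow (w l) h0).differentiableAt (by simp)
  -- In the direction r ∂_r the form dθ vanishes, so the frame is parallel there and only the
  -- coefficient r^w is differentiated.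
  rw [CovariantDerivative.apply_smul hn z.isOpen_disc (contMDiffOn_normPow_coord hp _ _)
    (T.smooth l i) hx, T.nabla_frame l i x hx, z.dlog_coordVec (z.disc_subset hx), div_self h0,
    z.mvfderiv_comp_coord (φ := fun ζ => c l i * normPow (w l) ζ) (z.disc_subset hx)
      (hd.const_mul _), fderiv_const_mul hd, smul_apply,
    fderiv_normPow_self _ h0, Complex.one_im, Complex.ofReal_zero, zero_smul, smul_zero, zero_add,
    smul_smul, smul_eq_mul]
  congr 1
  ring

end TemporalFraming

/-- The defining identity of Ψ with both sections equal to σ. It shows that |σ|² is almost constant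
wherever Ψσ + ∇σ is small. -/
lemma IsPsi.mvfderiv_inner_self [FiniteDimensional ℂ F] [VectorBundle ℂ F E]
    [ContMDiffVectorBundle ∞ F E 𝓘(ℝ, ℂ)] {H : HermitianMetric F E}
    {Ψ : ∀ y, TangentSpace 𝓘(ℝ, ℂ) y → E y →ₗ[ℂ] E y} (hΨ : IsPsi nabla H Ψ)
    {U : Set (punctured P)} (hU : IsOpen U) {σ : ∀ y, E y} (hσ : SmoothSectionOn F σ U)
    {y : punctured P} (hy : y ∈ U) (v : TangentSpace 𝓘(ℝ, ℂ) y) :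
    mvfderiv 𝓘(ℝ, ℂ) (fun x => (H.inner x (σ x) (σ x)).re) y v
      = 2 * (H.inner y (Ψ y v (σ y) + nabla σ y v) (σ y)).re := by
  have h1 := mvfderiv_clm_comp Complex.reCLM
    ((H.smooth U σ σ hU hσ hσ).mdifferentiableAt_of_isOpen hU hy) v
  refine h1.trans ?_
  have h2 := congrArg Complex.re (hΨ U σ σ hU hσ hσ y hy v)
  have h3 : (H.inner y (σ y) (nabla σ y v)).re = (H.inner y (nabla σ y v) (σ y)).re := by
    rw [H.conj_symm, Complex.conj_re]
  rw [metricVariation, show (1 / 2 : ℂ) = ((1 / 2 : ℝ) : ℂ) by norm_num, Complex.re_ofReal_mul,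
    Complex.sub_re, Complex.sub_re, h3] at h2
  rw [map_add, LinearMap.add_apply, Complex.add_re, Complex.reCLM_apply]
  linarith

end Puncture

/-! ### Radial growth estimates from condition (D). -/

section Growth

variable {X : Type*} [TopologicalSpace X] [T2Space X] [ChartedSpace ℂ X] [IsManifold 𝓘(ℂ) ω X]
  {P : Finset X}
  {F : Type*} [NormedAddCommGroup F] [NormedSpace ℂ F]
  {E : punctured P → Type*} [TopologicalSpace (Bundle.TotalSpace F E)]
  [∀ y, AddCommGroup (E y)] [∀ y, Module ℂ (E y)] [∀ y, TopologicalSpace (E y)]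
  [∀ y, IsTopologicalAddGroup (E y)] [∀ y, ContinuousSMul ℝ (E y)]
  [FiberBundle F E] [VectorBundle ℝ F E]
  [FiniteDimensional ℂ F] [VectorBundle ℂ F E] [ContMDiffVectorBundle ∞ F E 𝓘(ℝ, ℂ)]
  {nabla : CovariantDerivative 𝓘(ℝ, ℂ) F E} {z : ∀ p : P, PunctureCoord P (p : X)}
  {Pi : ParabolicStructure nabla z} {H H₁ H₂ : HermitianMetric F E}

namespace ParabolicStructure

variable (Pi H) in
/-- The square length of a weighted section near a puncture, in the coordinate. -/
def weightedNormSq (p : P) (c : ∀ l, Fin ((Pi.framing p).size l) → ℂ) (w : ℂ) : ℝ :=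
  (H.inner ((z p).puncturedChart.symm w)
    ((Pi.framing p).weightedSection (Pi.weight p) c ((z p).puncturedChart.symm w))
    ((Pi.framing p).weightedSection (Pi.weight p) c ((z p).puncturedChart.symm w))).re

/-- Along r ∂_r the leading part of Ψ multiplies V_ℓ by -w_ℓ, and the derivative of the coefficient
r^{w_ℓ} contributes +w_ℓ. What remains is the error of condition (D), so the logarithmic radial
derivative of |σ|² is at most 2δ in absolute value. The radius does not depend on the coefficients
c. -/
lemma CondD.weightedNormSq_bounds (hD : Pi.CondD H) (hn : IsFlatConnection nabla) (p : P) {δ : ℝ}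
    (hδ : 0 < δ) : ∃ r : ℝ, 0 < r ∧ r < (z p).radius ∧
      ∀ c, ∀ w : ℂ, w ≠ 0 → ‖w‖ < r → ∀ s : ℝ, s ≤ 0 →
        Pi.weightedNormSq H p c (Real.exp s • w)
          ≤ Real.exp (-(2 * δ) * s) * Pi.weightedNormSq H p c w ∧
        Pi.weightedNormSq H p c w
          ≤ Real.exp (-(2 * δ) * s) * Pi.weightedNormSq H p c (Real.exp s • w) := by
  obtain ⟨Ψ, hΨ, hD⟩ := hD
  obtain ⟨ε, hε, hD⟩ := hD p
  obtain ⟨r, hr, hrR, hbound⟩ := (z p).eventually_symm (hD δ hδ)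
  -- Below radius e⁻¹ one has |log r| ≥ 1, so dividing by |log r|^ε only helps and the error is at
  -- most δ.
  refine ⟨min r (Real.exp (-1)), by positivity, (min_le_left _ _).trans_lt hrR,
    fun c w hw hwr s hs => ?_⟩
  set e := (z p).puncturedChart with he
  have hem : e ∈ IsManifold.maximalAtlas 𝓘(ℂ) ω (punctured P) := (z p).puncturedChart_mem
  set σ := (Pi.framing p).weightedSection (Pi.weight p) c with hσdef
  have hσ : SmoothSectionOn F σ (z p).disc := (Pi.framing p).smooth_weightedSection p.2 _ c
  have hq : ContMDiffOn 𝓘(ℝ, ℂ) 𝓘(ℝ, ℝ) ∞ (fun x => (H.inner x (σ x) (σ x)).re) (z p).disc :=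
    Complex.reCLM.contDiff.contMDiff.comp_contMDiffOn
      (H.smooth _ σ σ (z p).isOpen_disc hσ hσ)
  have hpt : ∀ ζ : ℂ, ζ ≠ 0 → ‖ζ‖ < min r (Real.exp (-1)) →
      DifferentiableAt ℝ (Pi.weightedNormSq H p c) ζ ∧
      |fderiv ℝ (Pi.weightedNormSq H p c) ζ ζ| ≤ 2 * δ * Pi.weightedNormSq H p c ζ := by
    intro ζ hζ hζr
    have hζ1 := hζr.trans_le (min_le_left _ _)
    have hζR := hζ1.trans hrR
    set x := e.symm ζ with hx
    have hxd : x ∈ (z p).disc := (z p).symm_mem_disc hζ hζR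
    have hxs : x ∈ e.source := (z p).disc_subset hxd
    have hex : e x = ζ := (z p).coord_symm hζ hζR
    have hcx : (z p).coord x = ζ := hex
    have hmd := hq.mdifferentiableAt_of_isOpen (z p).isOpen_disc hxd
    constructor
    · have h1 : MDifferentiableAt 𝓘(ℝ, ℂ) 𝓘(ℝ, ℝ) (Pi.weightedNormSq H p c) ζ :=
        MDifferentiableAt.comp ζ (g := fun x => (H.inner x (σ x) (σ x)).re) hmd
          ((mdifferentiable_of_mem_complexAtlas hem).mdifferentiableAt_symm
            ((z p).mem_puncturedChart_target hζ hζR))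
      exact h1.differentiableAt
    · have h1 := mvfderiv_coordVec hem hxs hmd ζ
      rw [hΨ.mvfderiv_inner_self (z p).isOpen_disc hσ hxd, hex] at h1
      change _ = fderiv ℝ (Pi.weightedNormSq H p c) ζ ζ at h1
      rw [← h1]
      have h2 := (Pi.framing p).nabla_weightedSection hn p.2 (Pi.weight p) c hxd
      rw [hcx] at h2
      have h3 := hbound ζ hζ hζ1 (coordVec e ζ x)
        (fun l i => c l i * normPow (Pi.weight p l) ζ)
      rw [← hx, (z p).dlog_coordVec hxs, hcx, div_self hζ] at h3
      have h4 : ∑ l, ∑ i, (c l i * normPow (Pi.weight p l) ζ) • (Pi.framing p).frame l i x = σ x := by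
        rw [hσdef, TemporalFraming.weightedSection, hcx]
      simp only [Complex.one_re, Complex.one_im, mul_one, mul_zero, add_zero, abs_one,
        abs_zero] at h3
      rw [h4, ← h2] at h3
      have hlog : 1 ≤ |Real.log ‖ζ‖| ^ ε := by
        refine Real.one_le_rpow ?_ hε.le
        have : Real.log ‖ζ‖ ≤ -1 := by
          rw [Real.log_le_iff_le_exp (norm_pos_iff.mpr hζ)]
          exact (hζr.trans_le (min_le_right _ _)).le
        rw [le_abs]
        right; linarith
      have hlen : H.length x (σ x) * H.length x (σ x) = (H.inner x (σ x) (σ x)).re :=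
        Real.mul_self_sqrt ((H.isInnerForm x).self_nonneg _)
      have hlen0 : 0 ≤ H.length x (σ x) := Real.sqrt_nonneg _
      have h5 : H.length x (Ψ x (coordVec e ζ x) (σ x) + nabla σ x (coordVec e ζ x))
          ≤ δ * H.length x (σ x) := by
        refine h3.trans (mul_le_mul_of_nonneg_right ?_ hlen0)
        have : 1 / |Real.log ‖ζ‖| ^ ε ≤ 1 := (div_le_one (by linarith)).mpr hlog
        calc δ * (1 / |Real.log ‖ζ‖| ^ ε) ≤ δ * 1 := mul_le_mul_of_nonneg_left this hδ.le
          _ = δ := mul_one δ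
      have h6 := (H.isInnerForm x).norm_le
        (Ψ x (coordVec e ζ x) (σ x) + nabla σ x (coordVec e ζ x)) (σ x)
      have h7 := mul_le_mul_of_nonneg_right h5 hlen0
      have h8 := (Complex.abs_re_le_norm _).trans h6
      rw [abs_mul, abs_two]
      change _ ≤ 2 * δ * (H.inner x (σ x) (σ x)).re
      rw [← hlen]
      have h9 := h8.trans h7
      linarith
  have hball : ∀ t ∈ Set.Icc s 0, Real.exp t • w ≠ 0 ∧
      ‖Real.exp t • w‖ < min r (Real.exp (-1)) := by
    intro t ht
    refine ⟨smul_ne_zero (Real.exp_pos t).ne' hw, ?_⟩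
    rw [norm_smul, Real.norm_of_nonneg (Real.exp_pos t).le]
    have : Real.exp t ≤ 1 := Real.exp_le_one_iff.mpr ht.2
    nlinarith [norm_nonneg w]
  -- The ray through w is parametrized by s = log of the radial factor, which turns r ∂_r into d/ds.
  have hres := exp_bounds_of_abs_deriv_le (f := fun t => Pi.weightedNormSq H p c (Real.exp t • w))
    (f' := fun t => fderiv ℝ (Pi.weightedNormSq H p c) (Real.exp t • w) (Real.exp t • w))
    (k := 2 * δ) hs (fun t ht => by
      obtain ⟨h1, h2⟩ := hball t ht
      have h3 := (hpt _ h1 h2).1.hasFDerivAt.comp_hasDerivAt t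
        ((Real.hasDerivAt_exp t).smul_const w)
      exact h3)
    (fun t ht => by
      obtain ⟨h1, h2⟩ := hball t ht
      exact (hpt _ h1 h2).2)
  simpa using hres

end ParabolicStructure

lemma HermitianMetric.rescale_re (u : punctured P → ℝ) (hu : ContMDiff 𝓘(ℝ, ℂ) 𝓘(ℝ, ℝ) ∞ u)
    (x : punctured P) (s t : E x) :
    ((H.rescale u hu).inner x s t).re = Real.exp (-u x) * (H.inner x s t).re := by
  change (((Real.exp (-u x) : ℝ) : ℂ) * H.inner x s t).re = _
  rw [Complex.re_ofReal_mul]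

/-- The trace of the transition endomorphism of two tamed metrics grows slower than any power of
the coordinate at a puncture. -/
theorem log_transitionTrace_add_le (hF : 0 < Module.finrank ℂ F) (hn : IsFlatConnection nabla)
    {u : punctured P → ℝ} (hu : ContMDiff 𝓘(ℝ, ℂ) 𝓘(ℝ, ℝ) ∞ u)
    (h₁ : Pi.CondD (H₁.rescale u hu)) (h₂ : Pi.CondD (H₂.rescale u hu)) (p : P) {η : ℝ}
    (hη : 0 < η) (B : ℝ) :
    ∀ᶠ w in 𝓝[≠] (0 : ℂ), Real.log (transitionTrace H₁ H₂ ((z p).puncturedChart.symm w))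
      + η * Real.log ‖w‖ ≤ B := by
  -- With δ = η/8 each of the two metrics contributes a factor e^{-(η/4)s}. Together they cost η/2
  -- in the logarithm, which leaves η/2 to drive the sum to -∞.
  obtain ⟨r₁, hr₁, hrR₁, hb₁⟩ := h₁.weightedNormSq_bounds hn p (show 0 < η / 8 by positivity)
  obtain ⟨r₂, hr₂, hrR₂, hb₂⟩ := h₂.weightedNormSq_bounds hn p (show 0 < η / 8 by positivity)
  set e := (z p).puncturedChart with he
  set r := min r₁ r₂ / 2 with hr
  have hmin : 0 < min r₁ r₂ := lt_min hr₁ hr₂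
  have hr0 : 0 < r := by positivity
  have hrl₁ : r < r₁ := by have := min_le_left r₁ r₂; linarith
  have hrl₂ : r < r₂ := by have := min_le_right r₁ r₂; linarith
  have hrR : r < (z p).radius := hrl₁.trans hrR₁
  -- On a fixed circle the ratio of the metrics is bounded by compactness; the radial estimates
  -- carry this bound inward.
  obtain ⟨C, hC⟩ := (isCompact_sphere (0 : ℂ) r).exists_bound_of_continuousOn
    (f := fun w => transitionTrace H₁ H₂ (e.symm w)) fun w hw => by
      have hwn : ‖w‖ = r := by simpa using hw
      exact (contDiffAt_transitionTrace (z p).puncturedChart_mem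
        ((z p).mem_puncturedChart_target (norm_pos_iff.mp (hwn ▸ hr0))
          (hwn ▸ hrR))).continuousAt.continuousWithinAt
  have hCpos : 0 < C := by
    have h1 := hC (r : ℂ) (by simp [hr0.le])
    exact lt_of_lt_of_le (transitionTrace_pos hF _) ((le_abs_self _).trans h1)
  have hn0 : (0 : ℝ) < Module.finrank ℂ F := by exact_mod_cast hF
  have hlim : Filter.Tendsto (fun w : ℂ => Real.log ‖w‖) (𝓝[≠] 0) Filter.atBot :=
    Real.tendsto_log_nhdsGT_zero.comp tendsto_norm_nhdsNE_zero
  have hev := hlim.eventually (Filter.eventually_le_atBot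
    ((B - Real.log (Module.finrank ℂ F * C) - η / 2 * Real.log r) / (η / 2)))
  have hsmall : ∀ᶠ w in 𝓝[≠] (0 : ℂ), ‖w‖ < r :=
    nhdsWithin_le_nhds (by
      filter_upwards [Metric.ball_mem_nhds (0 : ℂ) hr0] with w hw
      simpa using hw)
  filter_upwards [hev, hsmall, self_mem_nhdsWithin] with w hw1 hwr hw0
  rw [Set.mem_compl_singleton_iff] at hw0
  have hwn : 0 < ‖w‖ := norm_pos_iff.mpr hw0
  set s := Real.log (‖w‖ / r) with hs
  have hs0 : s ≤ 0 := Real.log_nonpos (by positivity) ((div_le_one hr0).mpr hwr.le)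
  -- The point of that circle on the same ray as w, so that w = e^s w₀ with s ≤ 0.
  set w₀ : ℂ := (r / ‖w‖ : ℝ) • w with hw₀
  have hw₀0 : w₀ ≠ 0 := smul_ne_zero (by positivity) hw0
  have hw₀n : ‖w₀‖ = r := by
    rw [hw₀, norm_smul, Real.norm_of_nonneg (by positivity)]
    field_simp
  have hexp : Real.exp s • w₀ = w := by
    rw [hs, Real.exp_log (by positivity), hw₀, smul_smul]
    rw [show ‖w‖ / r * (r / ‖w‖) = 1 by field_simp, one_smul]
  have := finiteDimensional_fiber F (E := E)
  have hle : transitionTrace H₁ H₂ (e.symm w)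
      ≤ Module.finrank ℂ F * (Real.exp (-(2 * (η / 8)) * s) * (C * Real.exp (-(2 * (η / 8)) * s))) := by
    rw [← finrank_fiber F (E := E) (e.symm w)]
    refine (H₁.isInnerForm _).trace_transition_le (H₁.inner_transition H₂ _) fun v => ?_
    obtain ⟨c, rfl⟩ := (Pi.framing p).exists_weightedSection_eq (Pi.weight p)
      ((z p).symm_mem_disc hw0 (hwr.trans hrR)) v
    have e1 := (hb₂ c w₀ hw₀0 (hw₀n ▸ hrl₂) s hs0).1
    have e2 := (hb₁ c w₀ hw₀0 (hw₀n ▸ hrl₁) s hs0).2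
    rw [hexp] at e1 e2
    simp only [ParabolicStructure.weightedNormSq, HermitianMetric.rescale_re] at e1 e2
    have e3 := (H₁.isInnerForm _).le_trace_transition_mul (H₂.isInnerForm _)
      (H₁.inner_transition H₂ (e.symm w₀))
      ((Pi.framing p).weightedSection (Pi.weight p) c (e.symm w₀))
    have e4 := (le_abs_self _).trans (hC w₀ (by simpa using hw₀n))
    have e5 := (H₁.isInnerForm _).self_nonneg
      ((Pi.framing p).weightedSection (Pi.weight p) c (e.symm w₀))
    have e6 := e3.trans (mul_le_mul_of_nonneg_right e4 e5)
    have hu1 := Real.exp_pos (-u (e.symm w₀))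
    have hu2 := Real.exp_pos (-u (e.symm w))
    have hk := Real.exp_pos (-(2 * (η / 8)) * s)
    set k := Real.exp (-(2 * (η / 8)) * s)
    set q₁ := (H₁.inner (e.symm w) ((Pi.framing p).weightedSection (Pi.weight p) c (e.symm w))
      ((Pi.framing p).weightedSection (Pi.weight p) c (e.symm w))).re
    set q₂ := (H₂.inner (e.symm w) ((Pi.framing p).weightedSection (Pi.weight p) c (e.symm w))
      ((Pi.framing p).weightedSection (Pi.weight p) c (e.symm w))).re
    set Q₁ := (H₁.inner (e.symm w₀) ((Pi.framing p).weightedSection (Pi.weight p) c (e.symm w₀))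
      ((Pi.framing p).weightedSection (Pi.weight p) c (e.symm w₀))).re
    set Q₂ := (H₂.inner (e.symm w₀) ((Pi.framing p).weightedSection (Pi.weight p) c (e.symm w₀))
      ((Pi.framing p).weightedSection (Pi.weight p) c (e.symm w₀))).re
    -- The radial estimates concern e^{-u}H₁ and e^{-u}H₂. The factor at w₀ cancels in passing from
    -- H₂ to H₁, and the factor at w is common to both sides, so no bound on u is needed.
    refine le_of_mul_le_mul_left ?_ hu2
    calc Real.exp (-u (e.symm w)) * q₂ ≤ k * (Real.exp (-u (e.symm w₀)) * Q₂) := e1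
      _ ≤ k * (Real.exp (-u (e.symm w₀)) * (C * Q₁)) := by gcongr
      _ = k * C * (Real.exp (-u (e.symm w₀)) * Q₁) := by ring
      _ ≤ k * C * (k * (Real.exp (-u (e.symm w)) * q₁)) := by gcongr
      _ = Real.exp (-u (e.symm w)) * (k * (C * k) * q₁) := by ring
  have hlog := Real.log_le_log (transitionTrace_pos hF _) hle
  have hsplit : (Module.finrank ℂ F : ℝ)
      * (Real.exp (-(2 * (η / 8)) * s) * (C * Real.exp (-(2 * (η / 8)) * s)))
      = (Module.finrank ℂ F * C) * Real.exp (-(η / 2) * s) := by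
    rw [show -(η / 2) * s = -(2 * (η / 8)) * s + -(2 * (η / 8)) * s by ring, Real.exp_add]
    ring
  rw [hsplit, Real.log_mul (by positivity) (Real.exp_pos _).ne', Real.log_exp, hs,
    Real.log_div hwn.ne' hr0.ne'] at hlog
  rw [le_div_iff₀ (by positivity)] at hw1
  linarith

end Growth

/-! ## The maximum principle on a punctured surface -/

section MaximumPrinciple

/-- Polar coordinates present the set as a continuous image of a product of intervals. -/
lemma isPreconnected_puncturedBall (R : ℝ) : IsPreconnected {w : ℂ | w ≠ 0 ∧ ‖w‖ < R} := by
  have h1 : {w : ℂ | w ≠ 0 ∧ ‖w‖ < R}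
      = (fun q : ℝ × ℝ => (q.1 : ℂ) * Complex.exp (q.2 * Complex.I)) '' (Set.Ioo 0 R ×ˢ Set.univ) := by
    ext w
    constructor
    · rintro ⟨h0, hR⟩
      exact ⟨(‖w‖, Complex.arg w), ⟨⟨norm_pos_iff.mpr h0, hR⟩, trivial⟩,
        Complex.norm_mul_exp_arg_mul_I w⟩
    · rintro ⟨⟨r, θ⟩, ⟨⟨h0, hR⟩, -⟩, rfl⟩
      refine ⟨mul_ne_zero (Complex.ofReal_ne_zero.mpr h0.ne') (Complex.exp_ne_zero _), ?_⟩
      change ‖(r : ℂ) * Complex.exp (θ * Complex.I)‖ < R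
      rwa [norm_mul, Complex.norm_exp_ofReal_mul_I, mul_one, Complex.norm_real,
        Real.norm_of_nonneg h0.le]
  rw [h1]
  exact (isPreconnected_Ioo.prod isPreconnected_univ).image _ (by fun_prop)

variable {X : Type*} [TopologicalSpace X] [T2Space X] [ChartedSpace ℂ X] [IsManifold 𝓘(ℂ) ω X]
  {P : Finset X}

lemma PunctureCoord.basePoint_mem_disc {p : X} (z : PunctureCoord P p) : z.basePoint ∈ z.disc := by
  have hR := z.radius_pos
  have hn : ‖((z.radius / 2 : ℝ) : ℂ)‖ = z.radius / 2 := by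
    rw [Complex.norm_real, Real.norm_of_nonneg (by linarith)]
  have ht : ((z.radius / 2 : ℝ) : ℂ) ∈ z.chart.target :=
    z.ball_subset (by rw [mem_ball_zero_iff, hn]; linarith)
  refine ⟨z.chart.map_target ht, ?_⟩
  change ‖z.chart (z.chart.symm _)‖ < _
  rw [z.chart.right_inv ht, hn]
  linarith

lemma PunctureCoord.disc_eq_image {p : X} (hp : p ∈ P) (z : PunctureCoord P p) :
    z.disc = z.puncturedChart.symm '' {w : ℂ | w ≠ 0 ∧ ‖w‖ < z.radius} := by
  ext x
  constructor
  · intro hx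
    exact ⟨z.coord x, ⟨z.coord_ne_zero hp hx.1, hx.2⟩,
      z.puncturedChart.left_inv (z.disc_subset hx)⟩
  · rintro ⟨w, ⟨h0, hR⟩, rfl⟩
    exact z.symm_mem_disc h0 hR

lemma PunctureCoord.isPreconnected_disc {p : X} (hp : p ∈ P) (z : PunctureCoord P p) :
    IsPreconnected z.disc := by
  rw [z.disc_eq_image hp]
  exact (isPreconnected_puncturedBall _).image _ (z.puncturedChart.continuousOn_symm.mono
    fun w hw => z.mem_puncturedChart_target hw.1 hw.2)

/-- A connected surface stays connected when finitely many points are removed. -/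
lemma preconnectedSpace_punctured [ConnectedSpace X] (z : ∀ p : P, PunctureCoord P (p : X)) :
    PreconnectedSpace (punctured P) := by
  classical
  refine preconnectedSpace_of_forall_constant fun f hf => ?_
  -- A continuous two-valued function on the complement is constant on each connected punctured
  -- disc, so giving a puncture the value at its base point extends it continuously to X.
  set g : X → Bool := fun x => if h : x ∈ P then f (z ⟨x, h⟩).basePoint else f ⟨x, h⟩ with hg
  have hgM : ∀ x : punctured P, g x = f x := fun x => dif_neg x.2
  have hgc : Continuous g := by
    rw [continuous_iff_continuousAt]
    intro x
    by_cases hx : x ∈ P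
    · have hev : ∀ᶠ y in 𝓝 x, g y = g x := by
        have h0 : IsOpen ((z ⟨x, hx⟩).chart.source ∩
            (z ⟨x, hx⟩).chart ⁻¹' Metric.ball 0 (z ⟨x, hx⟩).radius) :=
          (z ⟨x, hx⟩).chart.isOpen_inter_preimage Metric.isOpen_ball
        filter_upwards [h0.mem_nhds ⟨(z ⟨x, hx⟩).mem_source, by
          rw [Set.mem_preimage, (z ⟨x, hx⟩).map_center]
          exact Metric.mem_ball_self (z ⟨x, hx⟩).radius_pos⟩] with y hy
        have hyR : ‖(z ⟨x, hx⟩).chart y‖ < (z ⟨x, hx⟩).radius := by simpa using hy.2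
        by_cases hyP : y ∈ P
        · rw [(z ⟨x, hx⟩).isolated y hyP hy.1 hyR]
        · rw [hg]
          simp only [hx, hyP, dif_pos, dif_neg, not_false_eq_true]
          exact ((z ⟨x, hx⟩).isPreconnected_disc hx).constant hf.continuousOn
            ⟨hy.1, hyR⟩ (z ⟨x, hx⟩).basePoint_mem_disc
      exact continuousAt_const.congr (hev.mono fun y hy => hy.symm)
    · have hop : Topology.IsOpenEmbedding (Subtype.val : punctured P → X) :=
        (punctured P).isOpenEmbedding'
      have := hop.continuousAt_iff (g := g) (x := ⟨x, hx⟩)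
      rw [← this]
      have h2 : g ∘ (Subtype.val : punctured P → X) = f := funext hgM
      rw [h2]
      exact hf.continuousAt
  intro x y
  rw [← hgM, ← hgM]
  exact PreconnectedSpace.constant inferInstance hgc

/-- A function on a punctured compact surface which is subharmonic and of slow growth at the
punctures is constant. -/
theorem eq_of_planeLap_nonneg_of_growth [CompactSpace X] [ConnectedSpace X]
    (z : ∀ p : P, PunctureCoord P (p : X)) {φ : punctured P → ℝ}
    (hs : ∀ e ∈ IsManifold.maximalAtlas 𝓘(ℂ) ω (punctured P), ∀ w ∈ e.target,
      ContDiffAt ℝ 2 (fun w => φ (e.symm w)) w)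
    (hl : ∀ e ∈ IsManifold.maximalAtlas 𝓘(ℂ) ω (punctured P), ∀ y ∈ e.source,
      0 ≤ planeLap (fun w => φ (e.symm w)) (e y))
    (hg : ∀ p, ∀ η > 0, ∀ B, ∀ᶠ w in 𝓝[≠] (0 : ℂ),
      φ ((z p).puncturedChart.symm w) + η * Real.log ‖w‖ ≤ B) (x y : punctured P) :
    φ x = φ y := by
  have hpre := preconnectedSpace_punctured z
  have hl' : ∀ e ∈ IsManifold.maximalAtlas 𝓘(ℂ) ω (punctured P), ∀ w ∈ e.target,
      0 ≤ planeLap (fun w => φ (e.symm w)) w := by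
    intro e he w hw
    have := hl e he _ (e.map_target hw)
    rwa [e.right_inv hw] at this
  have hcont : Continuous φ := by
    rw [continuous_iff_continuousAt]
    intro a
    have hc := (chartAt ℂ a).continuousAt (mem_chart_source ℂ a)
    have h1 := (hs _ (IsManifold.chart_mem_maximalAtlas (I := 𝓘(ℂ)) (n := ω) a) _
      (mem_chart_target ℂ a)).continuousAt
    refine (h1.comp hc).congr ?_
    filter_upwards [(chartAt ℂ a).open_source.mem_nhds (mem_chart_source ℂ a)] with b hb
    exact congrArg φ ((chartAt ℂ a).left_inv hb)
  -- the union of a compact part and of circles around the punctures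
  set W : P → Set X := fun p => (z p).chart.source ∩
    (z p).chart ⁻¹' Metric.ball 0 ((z p).radius / 2) with hW
  have hWo : ∀ p, IsOpen (W p) := fun p =>
    (z p).chart.isOpen_inter_preimage Metric.isOpen_ball
  -- Coordinate discs of different punctures may overlap, so a boundary circle need not lie in the
  -- complement of all half discs; the circles are therefore kept as separate compact sets.
  set S : P → Set (punctured P) := fun p =>
    (z p).puncturedChart.symm '' Metric.sphere 0 ((z p).radius / 2) with hS
  have hsph : ∀ p, ∀ w ∈ Metric.sphere (0 : ℂ) ((z p).radius / 2), w ≠ 0 ∧ ‖w‖ < (z p).radius := by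
    intro p w hw
    have hR := (z p).radius_pos
    have hn : ‖w‖ = (z p).radius / 2 := by simpa using hw
    exact ⟨norm_pos_iff.mp (by rw [hn]; linarith), by linarith⟩
  have hSc : ∀ p, IsCompact (S p) := fun p =>
    (isCompact_sphere _ _).image_of_continuousOn ((z p).puncturedChart.continuousOn_symm.mono
      fun w hw => (z p).mem_puncturedChart_target (hsph p w hw).1 (hsph p w hw).2)
  set K : Set (punctured P) := Subtype.val ⁻¹' (⋃ p, W p)ᶜ with hK
  have hKc : IsCompact K := by
    have hcl : IsCompact (⋃ p, W p)ᶜ := (isOpen_iUnion hWo).isClosed_compl.isCompact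
    refine ((punctured P).isOpenEmbedding'.toIsInducing.isCompact_preimage_iff ?_).mpr hcl
    intro a ha
    rw [Subtype.range_val]
    intro haP
    refine ha (Set.mem_iUnion.mpr ⟨⟨a, haP⟩, (z ⟨a, haP⟩).mem_source, ?_⟩)
    rw [Set.mem_preimage, (z ⟨a, haP⟩).map_center]
    exact Metric.mem_ball_self (by have := (z ⟨a, haP⟩).radius_pos; linarith)
  have hne : (K ∪ ⋃ p, S p).Nonempty := by
    by_cases hx : x ∈ K
    · exact ⟨x, Or.inl hx⟩
    · simp only [hK, Set.mem_preimage, Set.mem_compl_iff, not_not, Set.mem_iUnion] at hx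
      obtain ⟨p, -⟩ := hx
      have hR := (z p).radius_pos
      exact ⟨_, Or.inr (Set.mem_iUnion.mpr ⟨p, (((z p).radius / 2 : ℝ) : ℂ), by
        rw [mem_sphere_zero_iff_norm, Complex.norm_real, Real.norm_of_nonneg (by linarith)],
        rfl⟩)⟩
  obtain ⟨x₀, -, hx₀⟩ := (hKc.union (isCompact_iUnion hSc)).exists_isMaxOn hne hcont.continuousOn
  have hmax : ∀ a, φ a ≤ φ x₀ := by
    intro a
    by_cases ha : a ∈ K
    · exact hx₀ (Or.inl ha)
    · simp only [hK, Set.mem_preimage, Set.mem_compl_iff, not_not, Set.mem_iUnion] at ha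
      obtain ⟨p, hap, haR⟩ := ha
      have hR := (z p).radius_pos
      have haR' : ‖(z p).coord a‖ < (z p).radius / 2 := mem_ball_zero_iff.mp haR
      have htar : ∀ w : ℂ, w ≠ 0 → ‖w‖ ≤ (z p).radius / 2 → w ∈ (z p).puncturedChart.target :=
        fun w h0 hw => (z p).mem_puncturedChart_target h0 (by linarith)
      have := le_of_planeLap_nonneg_punctured (φ := fun w => φ ((z p).puncturedChart.symm w))
        (R := (z p).radius / 2) (m := φ x₀)
        (fun w h0 hw => hs _ (z p).puncturedChart_mem w (htar w h0 hw))
        (fun w h0 hw => hl' _ (z p).puncturedChart_mem w (htar w h0 hw)) (hg p)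
        (fun w hw => hx₀ (Or.inr (Set.mem_iUnion.mpr ⟨p, w, by simpa using hw, rfl⟩)))
        _ ((z p).coord_ne_zero p.2 hap) haR'.le
      rwa [← (z p).puncturedChart_apply,
        (z p).puncturedChart.left_inv ((z p).mem_puncturedChart_source.mpr hap)] at this
  -- The strong maximum principle in a chart makes the set where the global maximum is attained
  -- open.
  have hclopen : IsClopen {a | φ a = φ x₀} := by
    refine ⟨isClosed_eq hcont continuous_const, isOpen_iff_mem_nhds.mpr fun a ha => ?_⟩
    set e := chartAt ℂ a with he
    have hem := IsManifold.chart_mem_maximalAtlas (I := 𝓘(ℂ)) (n := ω) a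
    have has : a ∈ e.source := mem_chart_source ℂ a
    obtain ⟨ρ, hρ, hball⟩ := Metric.isOpen_iff.mp e.open_target (e a) (e.map_source has)
    have hea : φ (e.symm (e a)) = φ a := congrArg φ (e.left_inv has)
    have hconst := eq_of_planeLap_nonneg_of_isMaxOn (φ := fun w => φ (e.symm w)) (a := e a)
      (ρ := ρ) (fun w hw => hs e hem w (hball hw)) (fun w hw => hl' e hem w (hball hw))
      (fun w _ => by
        rw [hea, show φ a = φ x₀ from ha]
        exact hmax _)
    filter_upwards [e.open_source.mem_nhds has, (e.continuousAt has).preimage_mem_nhds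
      (Metric.ball_mem_nhds (e a) (half_pos hρ))] with b hb hb2
    have h3 := hconst (e b) hb2
    change φ (e.symm (e b)) = φ (e.symm (e a)) at h3
    rw [e.left_inv hb, hea] at h3
    exact h3.trans ha
  have huniv := hclopen.eq_univ ⟨x₀, rfl⟩
  have hx : x ∈ {a | φ a = φ x₀} := huniv ▸ trivial
  have hy : y ∈ {a | φ a = φ x₀} := huniv ▸ trivial
  exact hx.trans hy.symm

end MaximumPrinciple

/-! ## Parallel endomorphisms and the flat subbundles they define -/

section Parallel

variable {Y : Type*} [TopologicalSpace Y] [ChartedSpace ℂ Y] [IsManifold 𝓘(ℂ) ω Y]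

/-- A function with vanishing derivative on a connected surface is constant. -/
lemma eq_of_mvfderiv_eq_zero [PreconnectedSpace Y] {f : Y → ℂ}
    (hf : ContMDiffOn 𝓘(ℝ, ℂ) 𝓘(ℝ, ℂ) ∞ f Set.univ)
    (h0 : ∀ (y : Y) (v : TangentSpace 𝓘(ℝ, ℂ) y), mvfderiv 𝓘(ℝ, ℂ) f y v = 0) (x y : Y) :
    f x = f y := by
  have hmd : ∀ y, MDifferentiableAt 𝓘(ℝ, ℂ) 𝓘(ℝ, ℂ) f y := fun y =>
    hf.mdifferentiableAt_of_isOpen isOpen_univ trivial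
  have hclopen : IsClopen {a | f a = f y} := by
    refine ⟨isClosed_eq (continuousOn_univ.mp hf.continuousOn) continuous_const,
      isOpen_iff_mem_nhds.mpr fun a ha => ?_⟩
    set e := chartAt ℂ a with he
    have hem := IsManifold.chart_mem_maximalAtlas (I := 𝓘(ℂ)) (n := ω) a
    have has : a ∈ e.source := mem_chart_source ℂ a
    obtain ⟨ρ, hρ, hball⟩ := Metric.isOpen_iff.mp e.open_target (e a) (e.map_source has)
    have hd : DifferentiableOn ℝ (fun w => f (e.symm w)) (Metric.ball (e a) ρ) := by
      intro w hw
      have h1 : MDifferentiableAt 𝓘(ℝ, ℂ) 𝓘(ℝ, ℂ) (fun w => f (e.symm w)) w :=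
        MDifferentiableAt.comp w (hmd _)
          ((mdifferentiable_of_mem_complexAtlas hem).mdifferentiableAt_symm (hball hw))
      exact h1.differentiableAt.differentiableWithinAt
    have hz : Set.EqOn (fderiv ℝ (fun w => f (e.symm w))) 0 (Metric.ball (e a) ρ) := by
      intro w hw
      ext1 c
      have h2 := mvfderiv_coordVec hem (e.map_target (hball hw)) (hmd _) c
      rw [h0, e.right_inv (hball hw)] at h2
      exact h2.symm
    filter_upwards [e.open_source.mem_nhds has, (e.continuousAt has).preimage_mem_nhds
      (Metric.ball_mem_nhds (e a) hρ)] with b hb hb2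
    have h3 := Metric.isOpen_ball.is_const_of_fderiv_eq_zero
      (convex_ball (e a) ρ).isPreconnected hd hz hb2 (Metric.mem_ball_self hρ)
    rw [e.left_inv hb, e.left_inv has] at h3
    exact h3.trans ha
  have huniv := hclopen.eq_univ ⟨y, rfl⟩
  exact (huniv ▸ trivial : x ∈ {a | f a = f y})

variable {F : Type*} [NormedAddCommGroup F] [NormedSpace ℂ F]
  {E : Y → Type*} [TopologicalSpace (Bundle.TotalSpace F E)]
  [∀ y, AddCommGroup (E y)] [∀ y, Module ℂ (E y)] [∀ y, TopologicalSpace (E y)]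
  [∀ y, IsTopologicalAddGroup (E y)] [∀ y, ContinuousSMul ℝ (E y)]
  [FiberBundle F E] [VectorBundle ℝ F E]

/-- A smooth field of endomorphisms which commutes with the connection. -/
structure IsParallelEnd (nabla : CovariantDerivative 𝓘(ℝ, ℂ) F E)
    (A : ∀ y, Module.End ℂ (E y)) : Prop where
  smooth : IsSmoothEnd F A Set.univ
  comm : ∀ (U : Set Y) (σ : ∀ y, E y), IsOpen U → SmoothSectionOn F σ U → ∀ y ∈ U,
    ∀ v : TangentSpace 𝓘(ℝ, ℂ) y, nabla (fun x => A x (σ x)) y v = A y (nabla σ y v)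

variable [FiniteDimensional ℂ F] [VectorBundle ℂ F E] [ContMDiffVectorBundle ∞ F E 𝓘(ℝ, ℂ)]
  {nabla : CovariantDerivative 𝓘(ℝ, ℂ) F E} {A B : ∀ y, Module.End ℂ (E y)}

namespace IsParallelEnd

lemma smooth_apply (hA : IsParallelEnd nabla A) {U : Set Y} (hU : IsOpen U) {σ : ∀ y, E y}
    (hσ : SmoothSectionOn F σ U) : SmoothSectionOn F (fun y => A y (σ y)) U :=
  hA.smooth U (Set.subset_univ U) hU σ hσ

lemma one : IsParallelEnd nabla (fun _ => 1) :=
  ⟨fun _ _ _ _ hσ => hσ, fun _ _ _ _ _ _ _ => rfl⟩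

lemma mul (hA : IsParallelEnd nabla A) (hB : IsParallelEnd nabla B) :
    IsParallelEnd nabla (fun y => A y * B y) := by
  refine ⟨hA.smooth.mul hB.smooth, fun U σ hU hσ y hy v => ?_⟩
  have h1 := hA.comm U _ hU (hB.smooth_apply hU hσ) y hy v
  rw [hB.comm U σ hU hσ y hy v] at h1
  exact h1

lemma add (hA : IsParallelEnd nabla A) (hB : IsParallelEnd nabla B) :
    IsParallelEnd nabla (fun y => A y + B y) := by
  refine ⟨fun V _ hV σ hσ => (hA.smooth_apply hV hσ).add hV (hB.smooth_apply hV hσ),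
    fun U σ hU hσ y hy v => ?_⟩
  have h1 := CovariantDerivative.apply_add (nabla := nabla) hU (hA.smooth_apply hU hσ)
    (hB.smooth_apply hU hσ) hy v
  rw [hA.comm U σ hU hσ y hy v, hB.comm U σ hU hσ y hy v] at h1
  exact h1

lemma smul (hn : IsFlatConnection nabla) (c : ℂ) (hA : IsParallelEnd nabla A) :
    IsParallelEnd nabla (fun y => c • A y) := by
  refine ⟨fun V _ hV σ hσ => (hA.smooth_apply hV hσ).const_smul hV c,
    fun U σ hU hσ y hy v => ?_⟩
  have h1 := CovariantDerivative.apply_smul hn hU (f := fun _ => c) contMDiffOn_const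
    (hA.smooth_apply hU hσ) hy v
  rw [hA.comm U σ hU hσ y hy v, mvfderiv_const] at h1
  simpa using h1

lemma pow (hA : IsParallelEnd nabla A) (n : ℕ) : IsParallelEnd nabla (fun y => A y ^ n) := by
  induction n with
  | zero => simpa using one
  | succ n ih => simpa only [pow_succ] using ih.mul hA

lemma aeval (hn : IsFlatConnection nabla) (hA : IsParallelEnd nabla A) (p : Polynomial ℂ) :
    IsParallelEnd nabla (fun y => Polynomial.aeval (A y) p) := by
  induction p using Polynomial.induction_on' with
  | add p q hp hq => simpa only [map_add] using hp.add hq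
  | monomial n a =>
    simp only [Polynomial.aeval_monomial, ← Algebra.smul_def]
    exact (hA.pow n).smul hn a

/-- The derivative of the trace is the trace of the covariant derivative, which is zero. Applied to
polynomials in h, this transports algebraic identities from one point to all others. -/
lemma trace_eq [PreconnectedSpace Y] (hn : IsFlatConnection nabla) (hA : IsParallelEnd nabla A)
    (x y : Y) : LinearMap.trace ℂ (E x) (A x) = LinearMap.trace ℂ (E y) (A y) := by
  refine eq_of_mvfderiv_eq_zero (f := fun x => LinearMap.trace ℂ (E x) (A x))
    (hA.smooth.contMDiffOn_trace isOpen_univ) (fun y v => ?_) x y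
  obtain ⟨U, hU, hy, ⟨s⟩⟩ := exists_smoothFrame F E y
  rw [(hA.smooth.mono (Set.subset_univ U)).mvfderiv_trace hn hU s hy]
  refine Finset.sum_eq_zero fun i _ => ?_
  rw [hA.comm U _ hU (s.smooth_sec hU i) y hy v, sub_self, map_zero]

end IsParallelEnd

/-- Sections which are linearly independent at a point are so near the point. -/
lemma HermitianMetric.eventually_linearIndependent (H : HermitianMetric F E) {k : ℕ}
    {σ : Fin k → ∀ y, E y} {U : Set Y} (hU : IsOpen U) (hσ : ∀ i, SmoothSectionOn F (σ i) U)
    {y₀ : Y} (hy₀ : y₀ ∈ U) (hli : LinearIndependent ℂ fun i => σ i y₀) :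
    ∀ᶠ y in 𝓝 y₀, LinearIndependent ℂ fun i => σ i y := by
  set G : Y → Matrix (Fin k) (Fin k) ℂ :=
    fun y => Matrix.of fun i j => H.inner y (σ i y) (σ j y) with hG
  have hvec : ∀ y (c : Fin k → ℂ) j,
      Matrix.vecMul c (G y) j = H.inner y (∑ i, c i • σ i y) (σ j y) := by
    intro y c j
    rw [map_sum, LinearMap.sum_apply]
    change ∑ i, c i * G y i j = _
    exact Finset.sum_congr rfl fun i _ => by
      rw [map_smul, LinearMap.smul_apply, smul_eq_mul]; rfl
  -- Independence is non-vanishing of the Gram determinant, an open condition because that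
  -- determinant is continuous.
  have hdet : ∀ y, LinearIndependent ℂ (fun i => σ i y) ↔ (G y).det ≠ 0 := by
    intro y
    rw [Fintype.linearIndependent_iff]
    constructor
    · intro h h0
      obtain ⟨c, hc, hc0⟩ := Matrix.exists_vecMul_eq_zero_iff.mpr h0
      refine hc (funext (h c ?_))
      refine (H.isInnerForm y).eq_zero_of_self ?_
      rw [map_sum (H.inner y (∑ i, c i • σ i y)), Complex.re_sum]
      refine Finset.sum_eq_zero fun j _ => ?_
      rw [LinearMap.map_smulₛₗ, ← hvec, hc0, Pi.zero_apply, smul_zero, Complex.zero_re]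
    · intro h c hc i
      by_contra hi
      refine h (Matrix.exists_vecMul_eq_zero_iff.mp ⟨c, fun h0 => hi (congrFun h0 i), ?_⟩)
      funext j
      rw [hvec, hc, map_zero, LinearMap.zero_apply, Pi.zero_apply]
  have hc : ContinuousOn (fun y => (G y).det) U :=
    (contMDiffOn_det (A := G) fun i j => H.smooth U _ _ hU (hσ i) (hσ j)).continuousOn
  have h1 := (hc.continuousAt (hU.mem_nhds hy₀)).eventually_ne ((hdet y₀).mp hli)
  exact h1.mono fun y hy => (hdet y).mpr hy

/-- The image of a parallel idempotent is a flat subbundle. -/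
lemma IsParallelEnd.isFlatSubbundle_range [PreconnectedSpace Y] (H : HermitianMetric F E)
    (hn : IsFlatConnection nabla) (hA : IsParallelEnd nabla A)
    (hidem : ∀ y, IsIdempotentElem (A y)) (x₀ : Y) :
    IsFlatSubbundle nabla (Module.finrank ℂ (LinearMap.range (A x₀)))
      (fun y => LinearMap.range (A y)) := by
  have hfin := finiteDimensional_fiber F (E := E)
  -- The rank of an idempotent is its trace, and the trace of a parallel endomorphism is constant.
  have hrank : ∀ y, Module.finrank ℂ (LinearMap.range (A y))
      = Module.finrank ℂ (LinearMap.range (A x₀)) := by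
    intro y
    have h1 := hA.trace_eq hn y x₀
    have htr : ∀ y, LinearMap.trace ℂ (E y) (A y)
        = (Module.finrank ℂ (LinearMap.range (A y)) : ℂ) := fun y =>
      (LinearMap.IsIdempotentElem.isProj_range _ (hidem y)).trace
    rw [htr, htr] at h1
    exact_mod_cast h1
  have hfix : ∀ y (s : E y), s ∈ LinearMap.range (A y) → A y s = s := by
    rintro y _ ⟨t, rfl⟩
    exact congrArg (fun L => L t) (hidem y)
  refine ⟨fun y₀ => ?_, fun U σ hU hσ hmem y hy v => ?_⟩
  · set k := Module.finrank ℂ (LinearMap.range (A x₀)) with hk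
    set b := Module.finBasisOfFinrankEq ℂ (LinearMap.range (A y₀)) (hrank y₀) with hb
    -- A basis of the range at y₀ is extended to arbitrary local sections. Applying A pushes them
    -- into the range without changing their values at y₀, and constancy of the rank makes them span
    -- it nearby.
    choose U σ hU hyU hσ hσy using fun i => exists_smoothSection_eq F ((b i : E y₀))
    set W := ⋂ i, U i with hW
    have hWo : IsOpen W := isOpen_iInter_of_finite hU
    have hyW : y₀ ∈ W := Set.mem_iInter.mpr hyU
    have hσW : ∀ i, SmoothSectionOn F (fun y => A y (σ i y)) W := fun i =>
      hA.smooth_apply hWo ((hσ i).mono (Set.iInter_subset U i))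
    have hval : (fun i => A y₀ (σ i y₀)) = fun i => ((b i : E y₀)) := by
      funext i
      rw [hσy, hfix y₀ _ (b i).2]
    have hli : LinearIndependent ℂ fun i => A y₀ (σ i y₀) := by
      rw [hval]
      exact b.linearIndependent.map' (Submodule.subtype _) (Submodule.ker_subtype _)
    obtain ⟨V, hV, hVo, hyV⟩ := mem_nhds_iff.mp (Filter.inter_mem (hWo.mem_nhds hyW)
      (H.eventually_linearIndependent hWo hσW hyW hli))
    refine ⟨V, fun i y => A y (σ i y), hVo, hyV, fun i => (hσW i).mono fun y hy => (hV hy).1,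
      fun y hy => ⟨(hV hy).2, ?_⟩⟩
    refine Submodule.eq_of_le_of_finrank_eq ?_ ?_
    · rw [Submodule.span_le]
      rintro _ ⟨i, rfl⟩
      exact ⟨_, rfl⟩
    · rw [finrank_span_eq_card (hV hy).2, Fintype.card_fin, hrank]
  -- A section of the range satisfies σ = Aσ, hence ∇σ = A∇σ.
  · have h1 := CovariantDerivative.apply_congr (nabla := nabla) hU hσ
      (τ := fun x => A x (σ x)) (fun x hx => hfix x _ (hmem x hx)) hy
    rw [← h1, hA.comm U σ hU hσ y hy v]
    exact ⟨_, rfl⟩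

lemma coordVec_eq_re_im (e : OpenPartialHomeomorph Y ℂ) (a : ℂ) (y : Y) :
    coordVec e a y = a.re • coordVec e 1 y + a.im • coordVec e Complex.I y := by
  rw [coordVec, coordVec, coordVec, ← map_smul, ← map_smul, ← map_add]
  congr 1
  apply Complex.ext <;> simp

/-- If the forms `Ψ` of two metrics agree, then the transition endomorphism is parallel. -/
lemma isParallelEnd_transition {H₁ H₂ : HermitianMetric F E}
    {Ψ₁ Ψ₂ : ∀ y, TangentSpace 𝓘(ℝ, ℂ) y → E y →ₗ[ℂ] E y}
    (hΨ₁ : IsPsi nabla H₁ Ψ₁) (hΨ₂ : IsPsi nabla H₂ Ψ₂)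
    (h : ∀ e ∈ IsManifold.maximalAtlas 𝓘(ℂ) ω Y, ∀ y ∈ e.source,
      ∀ a ∈ ({1, Complex.I} : Finset ℂ), Ψ₁ y (coordVec e a y) = Ψ₂ y (coordVec e a y)) :
    IsParallelEnd nabla (H₁.transition H₂) := by
  refine ⟨H₁.isSmoothEnd_transition H₂, fun U σ hU hσ y hy v => ?_⟩
  have hem := IsManifold.chart_mem_maximalAtlas (I := 𝓘(ℂ)) (n := ω) y
  have hys := mem_chart_source ℂ y
  have key : ∀ a ∈ ({1, Complex.I} : Finset ℂ),
      nabla (fun x => H₁.transition H₂ x (σ x)) y (coordVec (chartAt ℂ y) a y)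
        = H₁.transition H₂ y (nabla σ y (coordVec (chartAt ℂ y) a y)) := by
    intro a ha
    rw [← sub_eq_zero, nabla_transition hΨ₁ hΨ₂ hU hσ hy, h _ hem y hys a ha]
    -- The common value of Ψ₁ and Ψ₂ is self-adjoint for both metrics, so it commutes with the
    -- endomorphism comparing them.
    have hcomm : H₁.transition H₂ y (Ψ₂ y (coordVec (chartAt ℂ y) a y) (σ y))
        = Ψ₂ y (coordVec (chartAt ℂ y) a y) (H₁.transition H₂ y (σ y)) := by
      refine (H₁.isInnerForm y).eq_of_forall fun t => ?_
      rw [H₁.inner_transition, hΨ₂.isSelfAdjoint, ← H₁.inner_transition H₂,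
        ← h _ hem y hys a ha, hΨ₁.isSelfAdjoint]
    rw [hcomm, sub_self, smul_zero]
  rw [← coordVec_mvfderiv hem hys v, coordVec_eq_re_im]
  simp only [map_add, map_smul, key 1 (by simp), key Complex.I (by simp)]
  rw [LinearMap.map_smul_of_tower, LinearMap.map_smul_of_tower]

end Parallel

/-! ## Degrees of complementary subbundles -/

/-- Summation by parts for a non-negative function of the finite sets of reals. -/
lemma sum_mul_sub_le {d : Finset ℝ → ℝ} (h0 : ∀ A, 0 ≤ d A) (he : d ∅ = 0) (T : Finset ℝ) :
    ∀ M : ℝ, (∀ β ∈ T, β ≤ M) →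
      ∑ β ∈ T, β * (d (T.filter (· ≤ β)) - d (T.filter (· < β))) ≤ M * d T := by
  induction T using Finset.induction_on_max with
  | empty => intro M _; simp [he]
  | insert a T ha ih =>
    intro M hM
    have hat : a ∉ T := fun h => lt_irrefl _ (ha a h)
    have h1 : ∀ β ∈ T, (insert a T).filter (· ≤ β) = T.filter (· ≤ β) := fun β hβ =>
      (Finset.filter_insert ..).trans (if_neg (not_le.mpr (ha β hβ)))
    have h2 : ∀ β ∈ T, (insert a T).filter (· < β) = T.filter (· < β) := fun β hβ =>
      (Finset.filter_insert ..).trans (if_neg (not_lt.mpr (ha β hβ).le))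
    have h3 : (insert a T).filter (· ≤ a) = insert a T := Finset.filter_true_of_mem fun β hβ => by
      rcases Finset.mem_insert.mp hβ with rfl | hβ
      · exact le_rfl
      · exact (ha β hβ).le
    have h4 : (insert a T).filter (· < a) = T := by
      rw [Finset.filter_insert, if_neg (lt_irrefl a)]
      exact Finset.filter_true_of_mem ha
    rw [Finset.sum_insert hat, h3, h4, Finset.sum_congr rfl fun β hβ => by rw [h1 β hβ, h2 β hβ]]
    -- The induction bound is taken at the new maximum a rather than M, so that a · d T cancels
    -- against the new summand.
    have h5 := ih a fun β hβ => (ha β hβ).le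
    have h6 := mul_le_mul_of_nonneg_right (hM a (Finset.mem_insert_self a T)) (h0 (insert a T))
    linarith

section LinearAlgebra

variable {V : Type*} [AddCommGroup V] [Module ℂ V] [FiniteDimensional ℂ V]

/-- The sum of the two intersections is direct and lies in W. It can be smaller than W, since a flag
member need not split along S and S'; hence only an inequality of degrees. -/
lemma finrank_inf_add_finrank_inf_le {S S' : Submodule ℂ V} (h : Disjoint S S')
    (W : Submodule ℂ V) :
    Module.finrank ℂ ↥(S ⊓ W) + Module.finrank ℂ ↥(S' ⊓ W) ≤ Module.finrank ℂ W := by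
  have h1 := Submodule.finrank_sup_add_finrank_inf_eq (S ⊓ W) (S' ⊓ W)
  have h2 : (S ⊓ W) ⊓ (S' ⊓ W) = ⊥ := (h.mono inf_le_left inf_le_left).eq_bot
  rw [h2, finrank_bot, add_zero] at h1
  rw [← h1]
  exact Submodule.finrank_mono (sup_le inf_le_right inf_le_right)

end LinearAlgebra

section Degree

variable {X : Type*} [TopologicalSpace X] [T2Space X] [ChartedSpace ℂ X] [IsManifold 𝓘(ℂ) ω X]
  {P : Finset X}
  {F : Type*} [NormedAddCommGroup F] [NormedSpace ℂ F]
  {E : punctured P → Type*} [TopologicalSpace (Bundle.TotalSpace F E)]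
  [∀ y, AddCommGroup (E y)] [∀ y, Module ℂ (E y)] [∀ y, TopologicalSpace (E y)]
  [∀ y, IsTopologicalAddGroup (E y)] [∀ y, ContinuousSMul ℝ (E y)]
  [FiberBundle F E] [VectorBundle ℝ F E]
  {nabla : CovariantDerivative 𝓘(ℝ, ℂ) F E} {z : ∀ p : P, PunctureCoord P (p : X)}

namespace ParabolicStructure

variable (Pi : ParabolicStructure nabla z)

open Classical in
lemma finrank_partialSum (p : P) (A : Fin (Pi.framing p).blocks → Prop) {x : punctured P}
    (hx : x ∈ (z p).disc) :
    Module.finrank ℂ (Pi.partialSum p A x)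
      = ∑ l ∈ Finset.univ.filter A, (Pi.framing p).size l := by
  have hli := ((Pi.framing p).linearIndependent x hx).comp
    (Subtype.val : {j : Σ l, Fin ((Pi.framing p).size l) // A j.1} → _) Subtype.val_injective
  have hspan : Pi.partialSum p A x = Submodule.span ℂ (Set.range
      ((fun j : Σ l, Fin ((Pi.framing p).size l) => (Pi.framing p).frame j.1 j.2 x) ∘
        (Subtype.val : {j : Σ l, Fin ((Pi.framing p).size l) // A j.1} → _))) := by
    rw [partialSum]
    congr 1
    ext s
    constructor
    · rintro ⟨l, hl, i, rfl⟩
      exact ⟨⟨⟨l, i⟩, hl⟩, rfl⟩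
    · rintro ⟨⟨⟨l, i⟩, hl⟩, rfl⟩
      exact ⟨l, hl, i, rfl⟩
  rw [hspan, finrank_span_eq_card hli, Fintype.card_subtype]
  have : (Finset.univ.filter fun j : Σ l, Fin ((Pi.framing p).size l) => A j.1)
      = (Finset.univ.filter A).sigma fun _ => Finset.univ := by
    ext ⟨l, i⟩
    simp
  rw [this, Finset.card_sigma]
  simp

/-- The degree of the whole bundle, written in terms of the flags. -/
lemma degree_eq_sum_finrank : Pi.degree = ∑ p, ∑ β ∈ Finset.univ.image (Pi.weight p), β *
    ((Module.finrank ℂ ↥(Pi.partialSum p (fun l => Pi.weight p l ≤ β) (z p).basePoint) : ℝ)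
      - (Module.finrank ℂ
          ↥(Pi.partialSum p (fun l => Pi.weight p l < β) (z p).basePoint) : ℝ)) := by
  classical
  refine Finset.sum_congr rfl fun p _ => ?_
  rw [← Finset.sum_fiberwise_of_maps_to (g := Pi.weight p)
    (t := Finset.univ.image (Pi.weight p)) fun l _ => Finset.mem_image_of_mem _ (Finset.mem_univ l)]
  refine Finset.sum_congr rfl fun β _ => ?_
  rw [Pi.finrank_partialSum p _ (z p).basePoint_mem_disc,
    Pi.finrank_partialSum p _ (z p).basePoint_mem_disc]
  have hsplit : (Finset.univ.filter fun l => Pi.weight p l ≤ β)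
      = (Finset.univ.filter fun l => Pi.weight p l < β)
        ∪ Finset.univ.filter fun l => Pi.weight p l = β := by
    ext l
    simp [le_iff_lt_or_eq]
  have hdisj : Disjoint (Finset.univ.filter fun l => Pi.weight p l < β)
      (Finset.univ.filter fun l => Pi.weight p l = β) :=
    Finset.disjoint_filter.mpr fun l _ h1 h2 => h1.ne h2
  rw [hsplit, Finset.sum_union hdisj]
  push_cast
  rw [add_sub_cancel_left, Finset.mul_sum]
  refine Finset.sum_congr rfl fun l hl => ?_
  rw [(Finset.mem_filter.mp hl).2]

/-- The degrees of two complementary subbundles add up to at least the degree of the bundle. -/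
lemma degree_le_subDegree_add [FiniteDimensional ℂ F] [VectorBundle ℂ F E]
    [ContMDiffVectorBundle ∞ F E 𝓘(ℝ, ℂ)]
    {S S' : ∀ x, Submodule ℂ (E x)} (hS : ∀ x, IsCompl (S x) (S' x)) :
    Pi.degree ≤ Pi.subDegree S + Pi.subDegree S' := by
  classical
  rw [degree_eq_sum_finrank, subDegree, subDegree, ← Finset.sum_add_distrib]
  refine Finset.sum_le_sum fun p _ => ?_
  have hfin := finiteDimensional_fiber F (E := E) (z p).basePoint
  have htop : Pi.partialSum p (fun l => Pi.weight p l ∈ Finset.univ.image (Pi.weight p))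
      (z p).basePoint = ⊤ := by
    rw [← (Pi.framing p).span_eq_top _ (z p).basePoint_mem_disc, partialSum]
    congr 1
    ext s
    constructor
    · rintro ⟨l, -, i, rfl⟩
      exact ⟨⟨l, i⟩, rfl⟩
    · rintro ⟨⟨l, i⟩, rfl⟩
      exact ⟨l, Finset.mem_image_of_mem _ (Finset.mem_univ l), i, rfl⟩
  -- D(W) measures how far W is from splitting along S and S'. It is non-negative and vanishes for W
  -- = 0 and for the whole fibre, so summation by parts gives the difference of degrees the right
  -- sign.
  set D : Submodule ℂ (E (z p).basePoint) → ℝ := fun W =>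
    (Module.finrank ℂ W : ℝ) - Module.finrank ℂ ↥(S (z p).basePoint ⊓ W)
      - Module.finrank ℂ ↥(S' (z p).basePoint ⊓ W) with hD
  set d : Finset ℝ → ℝ := fun A => D (Pi.partialSum p (fun l => Pi.weight p l ∈ A)
    (z p).basePoint) with hd
  have hd0 : ∀ A, 0 ≤ d A := by
    intro A
    have h1 := finrank_inf_add_finrank_inf_le (hS (z p).basePoint).disjoint
      (Pi.partialSum p (fun l => Pi.weight p l ∈ A) (z p).basePoint)
    have h2 : ((Module.finrank ℂ ↥(S (z p).basePoint ⊓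
        Pi.partialSum p (fun l => Pi.weight p l ∈ A) (z p).basePoint)
      + Module.finrank ℂ ↥(S' (z p).basePoint ⊓
        Pi.partialSum p (fun l => Pi.weight p l ∈ A) (z p).basePoint) : ℕ) : ℝ)
      ≤ Module.finrank ℂ ↥(Pi.partialSum p (fun l => Pi.weight p l ∈ A) (z p).basePoint) :=
      Nat.cast_le.mpr h1
    push_cast at h2
    simp only [hd, hD]
    linarith
  have hde : d ∅ = 0 := by
    have : Pi.partialSum p (fun l => Pi.weight p l ∈ (∅ : Finset ℝ)) (z p).basePoint = ⊥ := by
      simp [partialSum]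
    change D (Pi.partialSum p (fun l => Pi.weight p l ∈ (∅ : Finset ℝ)) (z p).basePoint) = 0
    rw [this]
    change (Module.finrank ℂ ↥(⊥ : Submodule ℂ (E (z p).basePoint)) : ℝ)
      - Module.finrank ℂ ↥(S (z p).basePoint ⊓ ⊥) - Module.finrank ℂ ↥(S' (z p).basePoint ⊓ ⊥) = 0
    rw [inf_bot_eq, inf_bot_eq, finrank_bot]
    simp
  have hdt : d (Finset.univ.image (Pi.weight p)) = 0 := by
    change D (Pi.partialSum p (fun l => Pi.weight p l ∈ Finset.univ.image (Pi.weight p))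
      (z p).basePoint) = 0
    rw [htop]
    change (Module.finrank ℂ ↥(⊤ : Submodule ℂ (E (z p).basePoint)) : ℝ)
      - Module.finrank ℂ ↥(S (z p).basePoint ⊓ ⊤) - Module.finrank ℂ ↥(S' (z p).basePoint ⊓ ⊤) = 0
    rw [inf_top_eq, inf_top_eq, finrank_top]
    have h1 := Submodule.finrank_add_eq_of_isCompl (hS (z p).basePoint)
    rw [← h1]
    push_cast
    ring
  set T := Finset.univ.image (Pi.weight p) with hT
  have hmem : ∀ l, Pi.weight p l ∈ T := fun l => Finset.mem_image_of_mem _ (Finset.mem_univ l)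
  obtain ⟨M, hM⟩ := T.bddAbove
  have hsum := sum_mul_sub_le hd0 hde T M fun β hβ => hM hβ
  rw [hdt, mul_zero] at hsum
  have hle : ∀ β, d (T.filter (· ≤ β))
      = D (Pi.partialSum p (fun l => Pi.weight p l ≤ β) (z p).basePoint) := by
    intro β
    simp only [hd, Finset.mem_filter, hmem, true_and]
  have hlt : ∀ β, d (T.filter (· < β))
      = D (Pi.partialSum p (fun l => Pi.weight p l < β) (z p).basePoint) := by
    intro β
    simp only [hd, Finset.mem_filter, hmem, true_and]
  simp only [hle, hlt, hD] at hsum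
  rw [← Finset.sum_add_distrib, ← sub_nonpos, ← Finset.sum_sub_distrib]
  refine le_of_eq_of_le (Finset.sum_congr rfl fun β _ => ?_) hsum
  ring

/-- A parallel idempotent of a stable bundle is trivial. -/
lemma IsSlopeStable.eq_zero_or_eq_one [ConnectedSpace X] [FiniteDimensional ℂ F]
    [VectorBundle ℂ F E] [ContMDiffVectorBundle ∞ F E 𝓘(ℝ, ℂ)] {Pi : ParabolicStructure nabla z}
    (hst : Pi.IsSlopeStable) (H : HermitianMetric F E) (hn : IsFlatConnection nabla)
    {A : ∀ y, Module.End ℂ (E y)} (hA : IsParallelEnd nabla A)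
    (hidem : ∀ y, IsIdempotentElem (A y)) (x : punctured P) : A x = 0 ∨ A x = 1 := by
  have hpre := preconnectedSpace_punctured z
  have hfin := finiteDimensional_fiber F (E := E) x
  by_contra! hne
  have hB : IsParallelEnd nabla (fun y => 1 + (-1 : ℂ) • A y) :=
    IsParallelEnd.one.add (hA.smul hn (-1))
  have hBeq : ∀ y, 1 + (-1 : ℂ) • A y = 1 - A y := fun y => by
    rw [neg_one_smul, sub_eq_add_neg]
  simp only [hBeq] at hB
  have hBi : ∀ y, IsIdempotentElem (1 - A y) := fun y => (hidem y).one_sub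
  have hS := hA.isFlatSubbundle_range H hn hidem x
  have hS' := hB.isFlatSubbundle_range H hn hBi x
  have hcompl : ∀ y, IsCompl (LinearMap.range (A y)) (LinearMap.range (1 - A y)) := by
    intro y
    rw [show (1 : Module.End ℂ (E y)) = LinearMap.id from rfl,
      ← LinearMap.IsIdempotentElem.ker_eq_range (hidem y)]
    exact LinearMap.IsIdempotentElem.isCompl (hidem y)
  have hadd := Submodule.finrank_add_eq_of_isCompl (hcompl x)
  rw [finrank_fiber F x] at hadd
  set k := Module.finrank ℂ (LinearMap.range (A x)) with hk
  set k' := Module.finrank ℂ (LinearMap.range (1 - A x)) with hk'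
  have hkpos : 0 < k := by
    rw [hk, Module.finrank_pos_iff, Submodule.nontrivial_iff_ne_bot, Ne, LinearMap.range_eq_bot]
    exact hne.1
  have hk'pos : 0 < k' := by
    rw [hk', Module.finrank_pos_iff, Submodule.nontrivial_iff_ne_bot, Ne, LinearMap.range_eq_bot,
      sub_eq_zero]
    exact fun h => hne.2 h.symm
  have h1 := hst k _ hS hkpos (by omega)
  have h2 := hst k' _ hS' hk'pos (by omega)
  have h3 := Pi.degree_le_subDegree_add hcompl
  have hkR : (0 : ℝ) < k := by exact_mod_cast hkpos
  have hk'R : (0 : ℝ) < k' := by exact_mod_cast hk'pos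
  have hnR : (Module.finrank ℂ F : ℝ) = k + k' := by rw [← hadd]; push_cast; rfl
  -- The two slope inequalities, cleared of denominators, add up to (deg S + deg S') n < n deg E,
  -- against the previous bound.
  rw [hnR, div_lt_div_iff₀ (by positivity) (by positivity)] at h1 h2
  nlinarith

end ParabolicStructure

end Degree

/-! ### From a parallel transition endomorphism to proportional metrics. -/

section Uniqueness

variable {X : Type*} [TopologicalSpace X] [T2Space X] [CompactSpace X] [ConnectedSpace X]
  [ChartedSpace ℂ X] [IsManifold 𝓘(ℂ) ω X]
  {P : Finset X} {z : ∀ p : P, PunctureCoord P (p : X)} {g : SurfaceMetric (punctured P)}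
  {F : Type*} [NormedAddCommGroup F] [NormedSpace ℂ F] [FiniteDimensional ℂ F]
  {E : punctured P → Type*} [TopologicalSpace (Bundle.TotalSpace F E)]
  [∀ y, AddCommGroup (E y)] [∀ y, Module ℂ (E y)] [∀ y, TopologicalSpace (E y)]
  [∀ y, IsTopologicalAddGroup (E y)] [∀ y, ContinuousSMul ℝ (E y)]
  [FiberBundle F E] [VectorBundle ℂ F E] [VectorBundle ℝ F E]
  [ContMDiffVectorBundle ∞ F E 𝓘(ℝ, ℂ)]
  {nabla : CovariantDerivative 𝓘(ℝ, ℂ) F E} {Pi : ParabolicStructure nabla z}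

/-- If the transition endomorphism of two metrics on a stable bundle is parallel then it is a
multiple of the identity at every point. -/
lemma exists_transition_eq_smul_one (hn : IsFlatConnection nabla) (hst : Pi.IsSlopeStable)
    {H₁ H₂ : HermitianMetric F E} (hpar : IsParallelEnd nabla (H₁.transition H₂))
    (x : punctured P) : ∃ c : ℂ, H₁.transition H₂ x = c • 1 := by
  have hpre := preconnectedSpace_punctured z
  have hfin := finiteDimensional_fiber F (E := E)
  by_contra! hns
  have hsa : ∀ y s t, H₁.inner y (H₁.transition H₂ y s) t = H₁.inner y s (H₁.transition H₂ y t) :=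
    fun y => (H₁.isInnerForm y).transition_isSelfAdjoint (H₂.isInnerForm y)
      (H₁.inner_transition H₂ y)
  obtain ⟨p, hp, hp0, hp1⟩ := (H₁.isInnerForm x).exists_idempotent_aeval (hsa x) hns
  -- The idempotent is known only at x. The defect N = p(h)² - p(h) is parallel and self-adjoint, so
  -- tr(N²) is constant; it is 0 at x, and hence N = 0 everywhere.
  have hN : IsParallelEnd nabla (fun y => Polynomial.aeval (H₁.transition H₂ y)
      ((p * p - p).map Complex.ofRealHom)) := hpar.aeval hn _
  have hNeq : ∀ y, Polynomial.aeval (H₁.transition H₂ y) ((p * p - p).map Complex.ofRealHom)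
      = Polynomial.aeval (H₁.transition H₂ y) (p.map Complex.ofRealHom)
        * Polynomial.aeval (H₁.transition H₂ y) (p.map Complex.ofRealHom)
        - Polynomial.aeval (H₁.transition H₂ y) (p.map Complex.ofRealHom) := fun y => by
    rw [Polynomial.map_sub, Polynomial.map_mul, map_sub, map_mul]
  have hidem : ∀ y, IsIdempotentElem
      (Polynomial.aeval (H₁.transition H₂ y) (p.map Complex.ofRealHom)) := by
    intro y
    have htr := (hN.mul hN).trace_eq hn y x
    have hx0 : Polynomial.aeval (H₁.transition H₂ x) ((p * p - p).map Complex.ofRealHom) = 0 := by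
      rw [hNeq, sub_eq_zero]
      exact hp
    rw [hx0, mul_zero, map_zero] at htr
    have := (H₁.isInnerForm y).eq_zero_of_trace_mul_self
      (IsInnerForm.aeval_isSelfAdjoint (hsa y) (p * p - p)) htr
    rwa [hNeq, sub_eq_zero] at this
  rcases hst.eq_zero_or_eq_one H₁ hn (hpar.aeval hn (p.map Complex.ofRealHom)) hidem x with h | h
  · exact hp0 h
  · exact hp1 h

/-- The asymmetric form of the result: with c₂ ≤ c₁ the term 4ρ(c₁ - c₂) tr h has the sign needed
for subharmonicity. -/
lemma exists_inner_eq_mul_of_le (hF : 0 < Module.finrank ℂ F) (hn : IsFlatConnection nabla)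
    (hst : Pi.IsSlopeStable) {H₁ H₂ : HermitianMetric F E}
    {Ψ₁ Ψ₂ : ∀ y, TangentSpace 𝓘(ℝ, ℂ) y → E y →ₗ[ℂ] E y} {c₁ c₂ : ℝ} (hc : c₂ ≤ c₁)
    (hΨ₁ : IsPsi nabla H₁ Ψ₁) (hΨ₂ : IsPsi nabla H₂ Ψ₂)
    (hK₁ : IsCurvatureK g nabla Ψ₁ (fun _ => (c₁ : ℂ) • LinearMap.id))
    (hK₂ : IsCurvatureK g nabla Ψ₂ (fun _ => (c₂ : ℂ) • LinearMap.id))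
    {u : punctured P → ℝ} (hu : ContMDiff 𝓘(ℝ, ℂ) 𝓘(ℝ, ℝ) ∞ u)
    (hD₁ : Pi.CondD (H₁.rescale u hu)) (hD₂ : Pi.CondD (H₂.rescale u hu)) :
    ∃ c : ℝ, 0 < c ∧ ∀ (x : punctured P) (s t : E x),
      H₂.inner x s t = (c : ℂ) * H₁.inner x s t := by
  have hlog := eq_of_planeLap_nonneg_of_growth z
    (φ := fun x => Real.log (transitionTrace H₁ H₂ x))
    (fun e he w hw => (contDiffAt_transitionTrace he hw).log (transitionTrace_pos hF _).ne')
    (fun e he y hy => planeLap_log_transitionTrace_nonneg hF hn hΨ₁ hΨ₂ hK₁ hK₂ hc he hy)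
    (fun p η hη B => log_transitionTrace_add_le hF hn hu hD₁ hD₂ p hη B)
  have hconst : ∀ x y, transitionTrace H₁ H₂ x = transitionTrace H₁ H₂ y := fun x y =>
    Real.log_injOn_pos (transitionTrace_pos hF x) (transitionTrace_pos hF y) (hlog x y)
  have hpar := isParallelEnd_transition hΨ₁ hΨ₂ fun e he y hy a ha =>
    psi_eq_of_transitionTrace_const hF hn hΨ₁ hΨ₂ hK₁ hK₂ hc hconst he hy ha
  have hnR : (0 : ℝ) < Module.finrank ℂ F := by exact_mod_cast hF
  -- A scalar endomorphism is its trace divided by the rank, which makes the factor real, positive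
  -- and independent of the point.
  have hval : ∀ x (s t : E x), H₂.inner x s t
      = ((transitionTrace H₁ H₂ x / Module.finrank ℂ F : ℝ) : ℂ) * H₁.inner x s t := by
    intro x s t
    obtain ⟨c, hcx⟩ := exists_transition_eq_smul_one hn hst hpar x
    have hfin := finiteDimensional_fiber F (E := E) x
    have h1 := (H₁.isInnerForm x).trace_transition_re (H₂.isInnerForm x)
      (H₁.inner_transition H₂ x)
    change _ = ((transitionTrace H₁ H₂ x : ℝ) : ℂ) at h1
    rw [hcx, map_smul, LinearMap.trace_one, finrank_fiber F x, smul_eq_mul] at h1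
    have hne : (Module.finrank ℂ F : ℂ) ≠ 0 := by exact_mod_cast hF.ne'
    rw [← H₁.inner_transition H₂, hcx, LinearMap.smul_apply, map_smul, LinearMap.smul_apply,
      smul_eq_mul, Module.End.one_apply]
    congr 1
    push_cast
    rw [← h1, mul_div_cancel_right₀ _ hne]
  -- A point is needed to name the constant; on an empty surface any positive number serves, and 1
  -- is a default.
  rcases isEmpty_or_nonempty (punctured P) with hempty | ⟨⟨x₀⟩⟩
  · exact ⟨1, one_pos, fun x => (hempty.false x).elim⟩
  · exact ⟨_, div_pos (transitionTrace_pos hF x₀) hnR, fun x s t => by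
      rw [hval x s t, hconst x x₀]⟩

end Uniqueness

end

theorem mainTheorem5
    {X : Type*} [TopologicalSpace X] [T2Space X] [CompactSpace X] [ConnectedSpace X]
    [ChartedSpace ℂ X] [IsManifold 𝓘(ℂ) ω X] [MeasurableSpace X] [BorelSpace X]
    (gbar : SurfaceMetric X) (hgbar : IsKahlerMetric gbar)
    (P : Finset X) (z : ∀ p : P, PunctureCoord P (p : X))
    (g : SurfaceMetric (punctured P)) (hg : IsKahlerMetric g)
    (hvol : surfaceVolume g Set.univ < ⊤)
    {F : Type*} [NormedAddCommGroup F] [NormedSpace ℂ F] [FiniteDimensional ℂ F]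
    {E : punctured P → Type*} [TopologicalSpace (Bundle.TotalSpace F E)]
    [∀ y, AddCommGroup (E y)] [∀ y, Module ℂ (E y)] [∀ y, TopologicalSpace (E y)]
    [∀ y, IsTopologicalAddGroup (E y)] [∀ y, ContinuousSMul ℝ (E y)]
    [FiberBundle F E] [VectorBundle ℂ F E] [VectorBundle ℝ F E]
    [ContMDiffVectorBundle ∞ F E 𝓘(ℝ, ℂ)]
    (nabla : CovariantDerivative 𝓘(ℝ, ℂ) F E) (hnabla : IsFlatConnection nabla)
    (Pi : ParabolicStructure nabla z) (hstable : Pi.IsSlopeStable)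
    (H₁ H₂ : HermitianMetric F E)
    (hH₁ : IsPoissonMetric g nabla H₁) (hH₂ : IsPoissonMetric g nabla H₂)
    (u f : punctured P → ℝ)
    (hu : ContMDiff 𝓘(ℝ, ℂ) 𝓘(ℝ, ℝ) ∞ u) (hf : ContMDiff 𝓘(ℝ, ℂ) 𝓘(ℝ, ℝ) ∞ f)
    (hu2 : MemLp u 2 (Measure.comap (fun x : punctured P => (x : X)) (surfaceVolume gbar)))
    (hf1 : Integrable f (Measure.comap (fun x : punctured P => (x : X)) (surfaceVolume gbar)))
    (huf : DistribLaplaceEq gbar u f)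
    (ht₁ : Pi.StronglyTamed g (H₁.rescale u hu)) (ht₂ : Pi.StronglyTamed g (H₂.rescale u hu)) :
    ∃ c : ℝ, 0 < c ∧ ∀ (x : punctured P) (s t : E x),
      H₁.inner x s t = (c : ℂ) * H₂.inner x s t := by
  obtain ⟨c₁, Ψ₁, hΨ₁, hK₁⟩ := hH₁
  obtain ⟨c₂, Ψ₂, hΨ₂, hK₂⟩ := hH₂
  -- In rank zero the trace is 0 and has no useful logarithm, but both metrics vanish identically
  -- and 1 works.
  rcases Nat.eq_zero_or_pos (Module.finrank ℂ F) with hF | hF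
  · refine ⟨1, one_pos, fun x s t => ?_⟩
    have hfin := finiteDimensional_fiber F (E := E) x
    have : Subsingleton (E x) := Module.finrank_zero_iff.mp ((finrank_fiber F x).trans hF)
    rw [Subsingleton.elim s 0]
    simp
  -- The metric with the larger constant plays the role of H₁. In the first case the factor obtained
  -- is for H₂ in terms of H₁ and has to be inverted.
  rcases le_total c₂ c₁ with hc | hc
  · obtain ⟨c, hc0, h⟩ := exists_inner_eq_mul_of_le hF hnabla hstable hc hΨ₁ hΨ₂ hK₁ hK₂ hu
      ht₁.2.2.2 ht₂.2.2.2
    refine ⟨c⁻¹, inv_pos.mpr hc0, fun x s t => ?_⟩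
    have hne : (c : ℂ) ≠ 0 := Complex.ofReal_ne_zero.mpr hc0.ne'
    rw [h, Complex.ofReal_inv, inv_mul_cancel_left₀ hne]
  · exact exists_inner_eq_mul_of_le hF hnabla hstable hc hΨ₂ hΨ₁ hK₂ hK₁ hu
      ht₂.2.2.2 ht₁.2.2.2
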